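/- A Hilbert--Lie algebra is a real Lie algebra $\mathfrak k$ which is also a real Hilbert space such that $\langle [x,y],z\rangle=\langle x,[y,z]\rangle$ for all $x,y,z\in\mathfrak k$. It is called simple if it is nonabelian and $\{0\}$ and $\mathfrak k$ are its only closed ideals. Let $\mathfrak k$ be a simple Hilbert--Lie algebra, let $N\ge 1$, and let $\varphi$ be an isometric Lie algebra automorphism of $\mathfrak k$ with $\varphi^N=\mathrm{id}$. Let $$\mathcal L_\varphi(\mathfrak k)=\{\xi\in C^\infty(\mathbb R,\mathfrak k):\ \xi(t+\tfrac{2\pi}{N})=\varphi^{-1}(\xi(t))\ \text{for all } t\in\mathbb R\}$$ be the twisted loop algebra, with the pointwise bracket and the Fréchet topology of locally uniform convergence of all derivatives, and let $$\tilde{\mathcal L}_\varphi(\mathfrak k)=\mathbb R\oplus_\omega\mathcal L_\varphi(\mathfrak k),\qquad [(a,\xi),(b,\eta)]=(\omega(\xi,\eta),[\xi,\eta]),\qquad \omega(\xi,\eta)=\frac1{2\pi}\int_0^{2\pi}\langle\xi'(t),\eta(t)\rangle\,dt,$$ be its central extension, with the central element $c=(1,0)$. Let $G$ be any Lie group (modelled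 on a Hausdorff locally convex space) that has a smooth exponential function $\exp$ and whose Lie algebra is isomorphic, as a topological Lie algebra, to $\tilde{\mathcal L}_\varphi(\mathfrak k)$. This includes the central extension $\tilde{\mathcal L}_\varphi(K)$ of a twisted loop group $\mathcal L_\varphi(K)$, where $K$ is a $1$-connected Hilbert--Lie group with Lie algebra $\mathfrak k$; the kernel of $\tilde{\mathcal L}_\varphi(K)\to\mathcal L_\varphi(K)$ is then $\exp(\mathbb Rc)$. Let $\pi:G\to U(\mathcal H)$ be a unitary representation on a complex Hilbert space which is smooth, i.e. the space $\mathcal H^\infty$ of vectors $v$ with smooth orbit map $g\mapsto\pi(g)v$ is dense. For $x$ in the Lie algebra let $d\pi(x)v=\frac{d}{dt}\big|_{t=0}\pi(\exp tx)v$ for $v\in\mathcal H^\infty$, let $s_\pi(x)=\sup\operatorname{Spec}(i\,d\pi(x))$, where the spectrum is that of the closure of $i\,d\pi(x)$, and let $W_\pi$ be the set of all points of the Lie algebra that have a neighbourhood on which $s_\pi$ is bounded above. Call $\pi$ semibounded if $W_\pi\neq\emptyset$, and bounded if $W_\pi$ is the whole Lie algebra. **Theorem.** Every semibounded unitary representation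 $\pi$ of $G$ is trivial on the center, in the sense that $\pi(\exp(sc))=1$ for all $s\in\mathbb R$, and more generally $\pi(\exp z)=1$ for every $z$ in the center of the Lie algebra; and $\pi$ is bounded. -/

import Mathlib

open Set Filter Topology
open scoped ContDiff

universe u v w

/-! ### Hilbert–Lie algebras -/

/-- A Hilbert–Lie algebra: a real Lie algebra that is a real Hilbert space whose scalar product
is invariant under the adjoint action. -/
class HilbertLieAlgebra (k : Type u) extends NormedAddCommGroup k, InnerProductSpace ℝ k,
    CompleteSpace k, LieRing k, LieAlgebra ℝ k where
  inner_lie_left : ∀ x y z : k, Inner.inner ℝ ⁅x, y⁆ z = Inner.inner ℝ x ⁅y, z⁆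

namespace HilbertLieAlgebra

variable {k : Type u} [HilbertLieAlgebra k]

/-- A Hilbert–Lie algebra is simple if it is nonabelian (in particular nonzero) and
`{0}` and `k` are its only closed ideals. -/
def IsSimple (k : Type u) [HilbertLieAlgebra k] : Prop :=
  (∃ x y : k, ⁅x, y⁆ ≠ 0) ∧
    ∀ I : LieIdeal ℝ k, IsClosed (I : Set k) → I = ⊥ ∨ I = ⊤

theorem inner_lie_skew (x y z : k) : inner ℝ ⁅x, y⁆ z = - inner ℝ y ⁅x, z⁆ := by
  rw [← lie_skew, inner_neg_left, inner_lie_left]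

/-- The adjoint operator `ad x` as a linear map. -/
def adLin (x : k) : k →ₗ[ℝ] k where
  toFun y := ⁅x, y⁆
  map_add' y z := lie_add x y z
  map_smul' c y := lie_smul c x y

/-- The adjoint operator `ad x`, which is automatically continuous. -/
noncomputable def adL (x : k) : k →L[ℝ] k where
  toLinearMap := adLin x
  cont := by
    refine LinearMap.continuous_of_seq_closed_graph (adLin x) fun u y z hu hTu => ?_
    have hTu : Tendsto (fun n => ⁅x, u n⁆) atTop (𝓝 z) := hTu
    change z = ⁅x, y⁆
    rw [← sub_eq_zero, ← @inner_self_eq_zero ℝ]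
    refine tendsto_nhds_unique ((hTu.sub_const _).inner tendsto_const_nhds) ?_
    have h : ∀ n, inner ℝ (⁅x, u n⁆ - ⁅x, y⁆) (z - ⁅x, y⁆)
        = - inner ℝ (u n - y) ⁅x, z - ⁅x, y⁆⁆ := by
      intro n
      rw [← lie_sub, inner_lie_skew]
    have h2 : Tendsto (fun n => - inner ℝ (u n - y) ⁅x, z - ⁅x, y⁆⁆) atTop
        (𝓝 (- inner ℝ (y - y) ⁅x, z - ⁅x, y⁆⁆)) :=
      ((hu.sub_const y).inner tendsto_const_nhds).neg
    rw [sub_self, inner_zero_left, neg_zero] at h2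
    refine h2.congr fun n => ?_
    exact (h n).symm

@[simp] theorem adL_apply (x y : k) : adL x y = ⁅x, y⁆ := rfl

theorem exists_lie_bound : ∃ C : ℝ, ∀ x y : k, ‖⁅x, y⁆‖ ≤ C * ‖x‖ * ‖y‖ := by
  obtain ⟨C, hC⟩ := banach_steinhaus (g := fun x : {x : k // ‖x‖ ≤ 1} => adL (x : k)) (by
    intro y
    refine ⟨‖adL y‖, fun x => ?_⟩
    rw [adL_apply, ← lie_skew, norm_neg, ← adL_apply]
    calc ‖adL y (x : k)‖ ≤ ‖adL y‖ * ‖(x : k)‖ := (adL y).le_opNorm _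
      _ ≤ ‖adL y‖ * 1 := by gcongr; exact x.2
      _ = _ := mul_one _)
  refine ⟨C, fun x y => ?_⟩
  by_cases hx : x = 0
  · simp [hx]
  have hx' : 0 < ‖x‖ := norm_pos_iff.2 hx
  have h1 : ‖(‖x‖⁻¹ • x)‖ ≤ 1 := by
    rw [norm_smul, norm_inv, norm_norm, inv_mul_cancel₀ hx'.ne']
  have h2 := ((adL (‖x‖⁻¹ • x)).le_opNorm y).trans
    (mul_le_mul_of_nonneg_right (hC ⟨_, h1⟩) (norm_nonneg y))
  rw [adL_apply, smul_lie, norm_smul, norm_inv, norm_norm] at h2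
  calc ‖⁅x, y⁆‖ = ‖x‖ * (‖x‖⁻¹ * ‖⁅x, y⁆‖) := by field_simp
    _ ≤ ‖x‖ * (C * ‖y‖) := by gcongr
    _ = _ := by ring

/-- The Lie bracket as a continuous bilinear map. -/
noncomputable def lieL (k : Type u) [HilbertLieAlgebra k] : k →L[ℝ] k →L[ℝ] k :=
  LinearMap.mkContinuousOfExistsBound
    { toFun := adL
      map_add' := fun x y => by ext z; simp [add_lie]
      map_smul' := fun c x => by ext z; simp [smul_lie] }
    (by
      obtain ⟨C, hC⟩ := exists_lie_bound (k := k)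
      refine ⟨max C 0, fun x => ?_⟩
      refine ContinuousLinearMap.opNorm_le_bound _ (by positivity) fun y => ?_
      refine (hC x y).trans ?_
      gcongr
      exact le_max_left _ _)

@[simp] theorem lieL_apply (x y : k) : lieL k x y = ⁅x, y⁆ := rfl

theorem contDiff_lie {f g : ℝ → k} {n : WithTop ℕ∞} (hf : ContDiff ℝ n f)
    (hg : ContDiff ℝ n g) : ContDiff ℝ n (fun t => ⁅f t, g t⁆) :=
  ((lieL k).contDiff.comp hf).clm_apply hg

theorem hasDerivAt_lie {f g : ℝ → k} {f' g' : k} {t : ℝ} (hf : HasDerivAt f f' t)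
    (hg : HasDerivAt g g' t) : HasDerivAt (fun t => ⁅f t, g t⁆) (⁅f', g t⁆ + ⁅f t, g'⁆) t := by
  have h := ((lieL k).hasFDerivAt.comp_hasDerivAt t hf).clm_apply hg
  simpa using h

end HilbertLieAlgebra

/-! ### Twisted loop algebras and their central extensions -/

/-- An isometric Lie algebra automorphism `φ` of `k` together with an integer `N ≥ 1` such that
`φ ^ N = 1`. -/
structure FiniteOrderAut (k : Type u) [HilbertLieAlgebra k] where
  φ : k ≃ₗ⁅ℝ⁆ k
  N : ℕ
  isometry : ∀ x y, inner ℝ (φ x) (φ y) = inner ℝ x y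
  N_pos : 0 < N
  iterate_eq : ∀ x, φ^[N] x = x

/-- The underlying vector space of the twisted loop algebra: the smooth maps `ξ : ℝ → k` such
that `ξ (t + 2π/N) = φ⁻¹ (ξ t)` for all `t`. -/
def twistedLoopSubmodule {k : Type u} [HilbertLieAlgebra k] (T : FiniteOrderAut k) :
    Submodule ℝ (ℝ → k) where
  carrier := {ξ | ContDiff ℝ ∞ ξ ∧ ∀ t, ξ (t + 2 * Real.pi / T.N) = T.φ.symm (ξ t)}
  add_mem' := fun {f g} hf hg => ⟨hf.1.add hg.1, fun t => by
    simp only [Pi.add_apply, hf.2 t, hg.2 t, map_add]⟩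
  zero_mem' := ⟨contDiff_const, fun t => by simp⟩
  smul_mem' := fun c f hf => ⟨hf.1.const_smul c, fun t => by
    simp only [Pi.smul_apply, hf.2 t, map_smul]⟩

/-- The twisted loop algebra `L_φ(k)`. -/
def TwistedLoop {k : Type u} [HilbertLieAlgebra k] (T : FiniteOrderAut k) : Type u :=
  twistedLoopSubmodule T

namespace TwistedLoop

variable {k : Type u} [HilbertLieAlgebra k] {T : FiniteOrderAut k}

noncomputable instance : AddCommGroup (TwistedLoop T) :=
  inferInstanceAs (AddCommGroup (twistedLoopSubmodule T))

noncomputable instance : Module ℝ (TwistedLoop T) :=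
  inferInstanceAs (Module ℝ (twistedLoopSubmodule T))

/-- The function underlying a twisted loop. -/
def toFun (ξ : TwistedLoop T) : ℝ → k := Subtype.val (p := (· ∈ twistedLoopSubmodule T)) ξ

instance : CoeFun (TwistedLoop T) (fun _ => ℝ → k) := ⟨toFun⟩

@[ext] theorem ext {ξ η : TwistedLoop T} (h : ∀ t, ξ t = η t) : ξ = η :=
  Subtype.ext (funext h)

@[simp] theorem add_apply (ξ η : TwistedLoop T) (t : ℝ) : (ξ + η) t = ξ t + η t := rfl
@[simp] theorem zero_apply (t : ℝ) : (0 : TwistedLoop T) t = 0 := rfl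
@[simp] theorem smul_apply (c : ℝ) (ξ : TwistedLoop T) (t : ℝ) : (c • ξ) t = c • ξ t := rfl

theorem coe_add (ξ η : TwistedLoop T) : (⇑(ξ + η) : ℝ → k) = ⇑ξ + ⇑η := rfl
theorem coe_smul (c : ℝ) (ξ : TwistedLoop T) : (⇑(c • ξ) : ℝ → k) = c • ⇑ξ := rfl

theorem smooth (ξ : TwistedLoop T) : ContDiff ℝ ∞ ξ :=
  (Subtype.property (p := (· ∈ twistedLoopSubmodule T)) ξ).1

theorem twist (ξ : TwistedLoop T) (t : ℝ) :
    ξ (t + 2 * Real.pi / T.N) = T.φ.symm (ξ t) :=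
  (Subtype.property (p := (· ∈ twistedLoopSubmodule T)) ξ).2 t

/-- The pointwise Lie bracket of twisted loops. -/
noncomputable instance : LieRing (TwistedLoop T) where
  bracket ξ η := ⟨fun t => ⁅ξ t, η t⁆, HilbertLieAlgebra.contDiff_lie ξ.smooth η.smooth,
    fun t => by
      change ⁅ξ (t + 2 * Real.pi / T.N), η (t + 2 * Real.pi / T.N)⁆ = T.φ.symm ⁅ξ t, η t⁆
      rw [ξ.twist, η.twist, LieEquiv.map_lie]⟩
  add_lie ξ η ζ := ext fun t => add_lie (ξ t) (η t) (ζ t)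
  lie_add ξ η ζ := ext fun t => lie_add (ξ t) (η t) (ζ t)
  lie_self ξ := ext fun t => lie_self (ξ t)
  leibniz_lie ξ η ζ := ext fun t => leibniz_lie (ξ t) (η t) (ζ t)

@[simp] theorem lie_apply (ξ η : TwistedLoop T) (t : ℝ) : ⁅ξ, η⁆ t = ⁅ξ t, η t⁆ := rfl

noncomputable instance : LieAlgebra ℝ (TwistedLoop T) where
  lie_smul c ξ η := ext fun t => lie_smul c (ξ t) (η t)

/-- The sequence of all derivatives of a loop. -/
noncomputable def jet (T : FiniteOrderAut k) : TwistedLoop T →ₗ[ℝ] (ℕ → C(ℝ, k)) where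
  toFun ξ n := ⟨iteratedDeriv n ξ, ξ.smooth.continuous_iteratedDeriv n (by exact_mod_cast le_top)⟩
  map_add' ξ η := by
    funext n
    ext t
    exact iteratedDeriv_add (ξ.smooth.contDiffAt.of_le (by exact_mod_cast le_top))
      (η.smooth.contDiffAt.of_le (by exact_mod_cast le_top))
  map_smul' c ξ := by
    funext n
    ext t
    exact iteratedDeriv_const_smul_field c _

/-- The Fréchet topology of `L_φ(k)`: uniform convergence on compact sets of all derivatives. -/
noncomputable instance : TopologicalSpace (TwistedLoop T) :=
  TopologicalSpace.induced (jet T) inferInstance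

instance : IsTopologicalAddGroup (TwistedLoop T) := topologicalAddGroup_induced (jet T)

instance : ContinuousSMul ℝ (TwistedLoop T) := continuousSMul_induced (jet T)

theorem periodic (ξ : TwistedLoop T) (t : ℝ) : ξ (t + 2 * Real.pi) = ξ t := by
  have h : ∀ n : ℕ, T.φ^[n] (ξ (t + n * (2 * Real.pi / T.N))) = ξ t := by
    intro n
    induction n with
    | zero => simp
    | succ n ih =>
      have : t + ((n + 1 : ℕ) : ℝ) * (2 * Real.pi / T.N)
          = (t + n * (2 * Real.pi / T.N)) + 2 * Real.pi / T.N := by push_cast; ring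
      rw [this, ξ.twist, Function.iterate_succ_apply, LieEquiv.apply_symm_apply, ih]
  have h2 := h T.N
  rw [T.iterate_eq] at h2
  have hN : (T.N : ℝ) ≠ 0 := by exact_mod_cast T.N_pos.ne'
  rwa [mul_div_cancel₀ _ hN] at h2

/-- The cocycle `ω(ξ, η) = (1 / 2π) ∫₀^{2π} ⟨ξ'(t), η(t)⟩ dt`. -/
noncomputable def cocycle (ξ η : TwistedLoop T) : ℝ :=
  (1 / (2 * Real.pi)) * ∫ t in (0 : ℝ)..(2 * Real.pi), inner ℝ (deriv ξ t) (η t)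

theorem hasDerivAt (ξ : TwistedLoop T) (t : ℝ) : HasDerivAt ξ (deriv ξ t) t :=
  ((ξ.smooth.differentiable (by simp)) t).hasDerivAt

theorem continuous_deriv (ξ : TwistedLoop T) : Continuous (deriv ξ) :=
  ξ.smooth.continuous_deriv (by simp)

theorem continuous_inner (ξ η : TwistedLoop T) :
    Continuous fun t => inner ℝ (deriv ξ t) (η t) :=
  ξ.continuous_deriv.inner η.smooth.continuous

theorem cocycle_add_left (ξ ξ' η : TwistedLoop T) :
    cocycle (ξ + ξ') η = cocycle ξ η + cocycle ξ' η := by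
  have h : ∀ t, inner ℝ (deriv (ξ + ξ') t) (η t)
      = inner ℝ (deriv ξ t) (η t) + inner ℝ (deriv ξ' t) (η t) := by
    intro t
    rw [coe_add, ((ξ.hasDerivAt t).add (ξ'.hasDerivAt t)).deriv, inner_add_left]
  unfold cocycle
  simp_rw [h]
  rw [intervalIntegral.integral_add ((continuous_inner ξ η).intervalIntegrable _ _)
    ((continuous_inner ξ' η).intervalIntegrable _ _), mul_add]

theorem cocycle_add_right (ξ η η' : TwistedLoop T) :
    cocycle ξ (η + η') = cocycle ξ η + cocycle ξ η' := by
  unfold cocycle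
  simp_rw [add_apply, inner_add_right]
  rw [intervalIntegral.integral_add ((continuous_inner ξ η).intervalIntegrable _ _)
    ((continuous_inner ξ η').intervalIntegrable _ _), mul_add]

theorem cocycle_smul_right (c : ℝ) (ξ η : TwistedLoop T) :
    cocycle ξ (c • η) = c * cocycle ξ η := by
  unfold cocycle
  simp_rw [smul_apply, inner_smul_right]
  rw [intervalIntegral.integral_const_mul]
  ring

theorem cocycle_self (ξ : TwistedLoop T) : cocycle ξ ξ = 0 := by
  have h : ∀ t ∈ uIcc (0 : ℝ) (2 * Real.pi),
      HasDerivAt (fun t => (1 / 2 : ℝ) * inner ℝ (ξ t) (ξ t)) (inner ℝ (deriv ξ t) (ξ t)) t := by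
    intro t _
    have := ((ξ.hasDerivAt t).inner ℝ (ξ.hasDerivAt t)).const_mul (1 / 2 : ℝ)
    have e : inner ℝ (ξ t) (deriv ξ t) = inner ℝ (deriv ξ t) (ξ t) := real_inner_comm _ _
    rw [e] at this
    refine this.congr_deriv ?_
    ring
  unfold cocycle
  rw [intervalIntegral.integral_eq_sub_of_hasDerivAt h
    ((continuous_inner ξ ξ).intervalIntegrable _ _)]
  have := ξ.periodic 0
  rw [zero_add] at this
  rw [this]
  simp

theorem deriv_lie (ξ η : TwistedLoop T) (t : ℝ) :
    deriv (toFun ⁅ξ, η⁆) t = ⁅deriv ξ t, η t⁆ + ⁅ξ t, deriv η t⁆ :=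
  (HilbertLieAlgebra.hasDerivAt_lie (ξ.hasDerivAt t) (η.hasDerivAt t)).deriv

theorem cocycle_jacobi (ξ η ζ : TwistedLoop T) :
    cocycle ⁅ξ, η⁆ ζ + cocycle ⁅η, ζ⁆ ξ + cocycle ⁅ζ, ξ⁆ η = 0 := by
  have h : ∀ t ∈ uIcc (0 : ℝ) (2 * Real.pi),
      HasDerivAt (fun t => (2 : ℝ) * inner ℝ (toFun ⁅ξ, η⁆ t) (ζ t))
        (inner ℝ (deriv (toFun ⁅ξ, η⁆) t) (ζ t) + inner ℝ (deriv (toFun ⁅η, ζ⁆) t) (ξ t)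
          + inner ℝ (deriv (toFun ⁅ζ, ξ⁆) t) (η t)) t := by
    intro t _
    have := ((hasDerivAt ⁅ξ, η⁆ t).inner ℝ (ζ.hasDerivAt t)).const_mul (2 : ℝ)
    refine this.congr_deriv ?_
    simp only [deriv_lie, inner_add_left, lie_apply]
    have e1 : inner ℝ ⁅deriv η t, ζ t⁆ (ξ t) = inner ℝ ⁅ξ t, deriv η t⁆ (ζ t) := by
      rw [real_inner_comm, HilbertLieAlgebra.inner_lie_left]
    have e2 : inner ℝ ⁅η t, deriv ζ t⁆ (ξ t) = inner ℝ ⁅ξ t, η t⁆ (deriv ζ t) := by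
      rw [real_inner_comm, HilbertLieAlgebra.inner_lie_left]
    have e3 : inner ℝ ⁅deriv ζ t, ξ t⁆ (η t) = inner ℝ ⁅ξ t, η t⁆ (deriv ζ t) := by
      rw [HilbertLieAlgebra.inner_lie_left, real_inner_comm]
    have e4 : inner ℝ ⁅ζ t, deriv ξ t⁆ (η t) = inner ℝ ⁅deriv ξ t, η t⁆ (ζ t) := by
      rw [HilbertLieAlgebra.inner_lie_left, real_inner_comm]
    rw [e1, e2, e3, e4]
    ring
  unfold cocycle
  have c1 := continuous_inner ⁅ξ, η⁆ ζ
  have c2 := continuous_inner ⁅η, ζ⁆ ξ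
  have c3 := continuous_inner ⁅ζ, ξ⁆ η
  have hint := intervalIntegral.integral_eq_sub_of_hasDerivAt h
    (((c1.add c2).add c3).intervalIntegrable _ _)
  have i12 := intervalIntegral.integral_add (c1.intervalIntegrable 0 (2 * Real.pi))
    (c2.intervalIntegrable (μ := MeasureTheory.volume) 0 (2 * Real.pi))
  have i123 := intervalIntegral.integral_add ((c1.add c2).intervalIntegrable 0 (2 * Real.pi))
    (c3.intervalIntegrable (μ := MeasureTheory.volume) 0 (2 * Real.pi))
  simp only [Pi.add_apply] at i123
  rw [← mul_add, ← mul_add, ← i12, ← i123, hint]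
  have h1 := periodic ⁅ξ, η⁆ 0
  have h2 := ζ.periodic 0
  rw [zero_add] at h1 h2
  rw [h1, h2]
  simp

theorem cocycle_skew (ξ η : TwistedLoop T) : cocycle η ξ = - cocycle ξ η := by
  have h := cocycle_self (ξ + η)
  rw [cocycle_add_left, cocycle_add_right, cocycle_add_right, cocycle_self, cocycle_self] at h
  linarith

theorem cocycle_leibniz (ξ η ζ : TwistedLoop T) :
    cocycle ξ ⁅η, ζ⁆ = cocycle ⁅ξ, η⁆ ζ + cocycle η ⁅ξ, ζ⁆ := by
  have h := cocycle_jacobi ξ η ζ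
  have h1 := cocycle_skew ⁅η, ζ⁆ ξ
  have h2 : cocycle ⁅ζ, ξ⁆ η = cocycle η ⁅ξ, ζ⁆ := by
    have : (⁅ξ, ζ⁆ : TwistedLoop T) = (-1 : ℝ) • ⁅ζ, ξ⁆ := by
      rw [← lie_skew ξ ζ]; simp
    rw [this, cocycle_smul_right, cocycle_skew ⁅ζ, ξ⁆ η]
    ring
  linarith

end TwistedLoop

/-- The central extension `ℝ ⊕_ω L_φ(k)` of the twisted loop algebra. -/
def CentralLoop {k : Type u} [HilbertLieAlgebra k] (T : FiniteOrderAut k) : Type u :=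
  ℝ × TwistedLoop T

namespace CentralLoop

open TwistedLoop

variable {k : Type u} [HilbertLieAlgebra k] {T : FiniteOrderAut k}

noncomputable instance : AddCommGroup (CentralLoop T) :=
  inferInstanceAs (AddCommGroup (ℝ × TwistedLoop T))

noncomputable instance : Module ℝ (CentralLoop T) :=
  inferInstanceAs (Module ℝ (ℝ × TwistedLoop T))

noncomputable instance : TopologicalSpace (CentralLoop T) :=
  inferInstanceAs (TopologicalSpace (ℝ × TwistedLoop T))

/-- The central coordinate. -/
def coord (x : CentralLoop T) : ℝ := Prod.fst (α := ℝ) (β := TwistedLoop T) x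

/-- The projection onto the loop algebra. -/
def loop (x : CentralLoop T) : TwistedLoop T := Prod.snd (α := ℝ) (β := TwistedLoop T) x

/-- The element `(a, ξ)`. -/
def mk (a : ℝ) (ξ : TwistedLoop T) : CentralLoop T := Prod.mk (α := ℝ) (β := TwistedLoop T) a ξ

@[ext] theorem ext {x y : CentralLoop T} (h₁ : x.coord = y.coord) (h₂ : x.loop = y.loop) :
    x = y := Prod.ext (α := ℝ) (β := TwistedLoop T) h₁ h₂

/-- The Lie bracket `[(a, ξ), (b, η)] = (ω(ξ, η), [ξ, η])`. -/
noncomputable instance : LieRing (CentralLoop T) where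
  bracket x y := mk (cocycle x.loop y.loop) ⁅x.loop, y.loop⁆
  add_lie x y z := ext (cocycle_add_left x.loop y.loop z.loop) (add_lie x.loop y.loop z.loop)
  lie_add x y z := ext (cocycle_add_right x.loop y.loop z.loop) (lie_add x.loop y.loop z.loop)
  lie_self x := ext (cocycle_self x.loop) (lie_self x.loop)
  leibniz_lie x y z := ext (cocycle_leibniz x.loop y.loop z.loop)
    (leibniz_lie x.loop y.loop z.loop)

noncomputable instance : LieAlgebra ℝ (CentralLoop T) where
  lie_smul c x y := ext (cocycle_smul_right c x.loop y.loop) (lie_smul c x.loop y.loop)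

/-- The central element `c = (1, 0)`, so that `ℝ c` is the kernel of the projection onto
`L_φ(k)`. -/
noncomputable def c (T : FiniteOrderAut k) : CentralLoop T := mk 1 0

end CentralLoop

/-! ### Smooth maps and Lie groups over locally convex spaces -/

/-- `f` is of class `C^n` on the open set `U` in the sense of Bastiani (also called Michal–Bastiani
or Keller `C^n_c`): `f` is continuous on `U` and, for `n ≥ 1`, all directional derivatives
`df (x, v)` exist for `x ∈ U` and define a map of class `C^(n-1)` on `U × E`. -/
def BastianiC {F : Type v} [AddCommGroup F] [Module ℝ F] [TopologicalSpace F] :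
    ℕ → {E : Type u} → [AddCommGroup E] → [Module ℝ E] → [TopologicalSpace E] →
      (E → F) → Set E → Prop
  | 0, _, _, _, _, f, U => ContinuousOn f U
  | n + 1, E, _, _, _, f, U => ContinuousOn f U ∧ ∃ df : E × E → F,
      (∀ x ∈ U, ∀ y : E, Tendsto (fun t : ℝ => t⁻¹ • (f (x + t • y) - f x)) (𝓝[≠] 0)
        (𝓝 (df (x, y)))) ∧ BastianiC n df (U ×ˢ univ)

/-- Smooth maps on an open subset of a locally convex space. -/
def BastianiSmooth {E : Type u} [AddCommGroup E] [Module ℝ E] [TopologicalSpace E]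
    {F : Type v} [AddCommGroup F] [Module ℝ F] [TopologicalSpace F] (f : E → F) (U : Set E) :
    Prop :=
  ∀ n : ℕ, BastianiC n f U

/-- The curve `γ` is differentiable at `0` with derivative `y`. -/
def HasVelocity {E : Type u} [AddCommGroup E] [Module ℝ E] [TopologicalSpace E]
    (γ : ℝ → E) (y : E) : Prop :=
  Tendsto (fun t : ℝ => t⁻¹ • (γ t - γ 0)) (𝓝[≠] 0) (𝓝 y)

/-- The derivative at `0` of a curve that is differentiable there. -/
noncomputable def velocity {E : Type u} [AddCommGroup E] [Module ℝ E] [TopologicalSpace E]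
    (γ : ℝ → E) : E :=
  limUnder (𝓝[≠] 0) (fun t : ℝ => t⁻¹ • (γ t - γ 0))

/-- `G` is a Lie group modelled on the Hausdorff locally convex space `E`: all changes of charts
are smooth, and multiplication and inversion are smooth in charts. -/
class LCLieGroup (E : Type u) [AddCommGroup E] [Module ℝ E] [TopologicalSpace E]
    [IsTopologicalAddGroup E] [ContinuousSMul ℝ E] [LocallyConvexSpace ℝ E] [T2Space E]
    (G : Type v) [Group G] [TopologicalSpace G] [ChartedSpace E G] : Prop
    extends IsTopologicalGroup G where
  smooth_transition : ∀ e ∈ atlas E G, ∀ e' ∈ atlas E G,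
    BastianiSmooth (fun x : E => e' (e.symm x)) (e.target ∩ e.symm ⁻¹' e'.source)
  smooth_mul : ∀ e₁ ∈ atlas E G, ∀ e₂ ∈ atlas E G, ∀ e₃ ∈ atlas E G,
    BastianiSmooth (fun p : E × E => e₃ (e₁.symm p.1 * e₂.symm p.2))
      {p | p.1 ∈ e₁.target ∧ p.2 ∈ e₂.target ∧ e₁.symm p.1 * e₂.symm p.2 ∈ e₃.source}
  smooth_inv : ∀ e₁ ∈ atlas E G, ∀ e₂ ∈ atlas E G,
    BastianiSmooth (fun x : E => e₂ (e₁.symm x)⁻¹)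
      {x | x ∈ e₁.target ∧ (e₁.symm x)⁻¹ ∈ e₂.source}

namespace LCLieGroup

section

variable (E : Type u) [AddCommGroup E] [Module ℝ E] [TopologicalSpace E]
    (G : Type v) [Group G] [TopologicalSpace G] [ChartedSpace E G]

/-- The tangent space `T_1 G` is identified with the model space `E` through the preferred chart
at `1`. In this chart, `leftField E G y` is the left invariant vector field with value `y` at `1`:
its value at the point `p` is the derivative at `0` of the curve `t ↦ p · (1 + t y)`. -/
noncomputable def leftField (y : E) (p : E) : E :=
  velocity fun t : ℝ =>
    chartAt E (1 : G) ((chartAt E (1 : G)).symm p *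
      (chartAt E (1 : G)).symm (chartAt E (1 : G) 1 + t • y))

/-- The Lie bracket on `T_1 G`: the value at `1` of the commutator
`[X, Y] = dY(X) - dX(Y)` of the left invariant vector fields with values `x` and `y` at `1`. -/
noncomputable def lieBracket (x y : E) : E :=
  velocity (fun s : ℝ => leftField E G y (chartAt E (1 : G) 1 + s • x)) -
    velocity (fun s : ℝ => leftField E G x (chartAt E (1 : G) 1 + s • y))

variable {E G}

/-- `ex` is the exponential function of `G`, on the Lie algebra `T_1 G = E`: it is smooth, and for
every `x` the curve `t ↦ ex (t x)` is a one-parameter group with derivative `x` at `0`. -/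
structure IsExp (ex : E → G) : Prop where
  continuous : Continuous ex
  smooth : ∀ e ∈ atlas E G, BastianiSmooth (fun x => e (ex x)) (ex ⁻¹' e.source)
  map_add_smul : ∀ (s t : ℝ) (x : E), ex ((s + t) • x) = ex (s • x) * ex (t • x)
  hasVelocity : ∀ x : E, HasVelocity (fun t : ℝ => chartAt E (1 : G) (ex (t • x))) x

end

end LCLieGroup

/-! ### Unitary representations -/

namespace BastianiC

variable {F : Type v} [AddCommGroup F] [Module ℝ F] [TopologicalSpace F]

theorem zero_fun (n : ℕ) : ∀ {E : Type u} [AddCommGroup E] [Module ℝ E] [TopologicalSpace E]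
    (U : Set E), BastianiC n (fun _ : E => (0 : F)) U := by
  induction n with
  | zero => intro E _ _ _ U; exact continuousOn_const
  | succ n ih =>
    intro E _ _ _ U
    exact ⟨continuousOn_const, fun _ => 0, fun x _ y => by
      simpa using (tendsto_const_nhds : Tendsto (fun _ : ℝ => (0 : F)) (𝓝[≠] 0) (𝓝 0)), ih _⟩

theorem add [IsTopologicalAddGroup F] (n : ℕ) :
    ∀ {E : Type u} [AddCommGroup E] [Module ℝ E] [TopologicalSpace E]
    {U : Set E} {f g : E → F}, BastianiC n f U → BastianiC n g U →
      BastianiC n (fun x => f x + g x) U := by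
  induction n with
  | zero => intro E _ _ _ U f g hf hg; exact ContinuousOn.add hf hg
  | succ n ih =>
    rintro E _ _ _ U f g ⟨hf, df, hdf, hdf'⟩ ⟨hg, dg, hdg, hdg'⟩
    refine ⟨hf.add hg, fun p => df p + dg p, fun x hx y => ?_, ih hdf' hdg'⟩
    refine ((hdf x hx y).add (hdg x hx y)).congr fun t => ?_
    rw [← smul_add, add_sub_add_comm]

theorem clm_comp (L : F →L[ℝ] F) (n : ℕ) :
    ∀ {E : Type u} [AddCommGroup E] [Module ℝ E] [TopologicalSpace E]
    {U : Set E} {f : E → F}, BastianiC n f U → BastianiC n (fun x => L (f x)) U := by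
  induction n with
  | zero => intro E _ _ _ U f hf; exact L.continuous.comp_continuousOn hf
  | succ n ih =>
    rintro E _ _ _ U f ⟨hf, df, hdf, hdf'⟩
    refine ⟨L.continuous.comp_continuousOn hf, fun p => L (df p), fun x hx y => ?_, ih hdf'⟩
    refine ((L.continuous.tendsto _).comp (hdf x hx y)).congr fun t => ?_
    simp

/-- The chain rule for a `C^1` map with values in a normed space along a curve. -/
theorem hasDerivAt_comp {F : Type v} [NormedAddCommGroup F] [NormedSpace ℝ F]
    {E : Type u} [AddCommGroup E] [Module ℝ E] [TopologicalSpace E] [IsTopologicalAddGroup E]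
    [ContinuousSMul ℝ E] {U : Set E} (hU : IsOpen U) {f : E → F} (hf : BastianiC 1 f U)
    {γ : ℝ → E} {y : E} (h0 : γ 0 ∈ U) (hγ : HasVelocity γ y) :
    DifferentiableAt ℝ (fun t => f (γ t)) 0 := by
  obtain ⟨-, df, hdf, hc⟩ := hf
  have hc : ContinuousOn df (U ×ˢ univ) := hc
  refine HasDerivAt.differentiableAt (f' := df (γ 0, y)) ?_
  rw [hasDerivAt_iff_tendsto_slope]
  rw [Metric.tendsto_nhds]
  intro ε hε
  have hopen : IsOpen (U ×ˢ (univ : Set E)) := hU.prod isOpen_univ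
  have hcA : ContinuousAt df (γ 0, y) := hc.continuousAt (hopen.mem_nhds ⟨h0, mem_univ _⟩)
  have hW : ∀ᶠ p in 𝓝 (γ 0, y), p.1 ∈ U ∧ dist (df p) (df (γ 0, y)) < ε / 2 :=
    (Filter.Eventually.mono (hopen.mem_nhds ⟨h0, mem_univ _⟩) (fun p hp => hp.1)).and
      (hcA.eventually (Metric.ball_mem_nhds _ (half_pos hε)))
  have hm : Tendsto (fun q : ℝ × E => (γ 0 + q.1 • q.2, q.2)) (𝓝 ((0 : ℝ), y)) (𝓝 (γ 0, y)) := by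
    have : Continuous (fun q : ℝ × E => (γ 0 + q.1 • q.2, q.2)) := by fun_prop
    have h := this.tendsto ((0 : ℝ), y)
    simpa using h
  have hW' := hm.eventually hW
  rw [nhds_prod_eq, Filter.eventually_prod_iff] at hW'
  obtain ⟨pa, hpa, pb, hpb, hab⟩ := hW'
  obtain ⟨δ, hδ, hpaδ⟩ := Metric.eventually_nhds_iff.1 hpa
  have hev1 : ∀ᶠ t in 𝓝[≠] (0 : ℝ), pb (t⁻¹ • (γ t - γ 0)) := hγ.eventually hpb
  have hev2 : ∀ᶠ t in 𝓝[≠] (0 : ℝ), dist t 0 < δ :=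
    nhdsWithin_le_nhds (Metric.ball_mem_nhds (0 : ℝ) hδ)
  filter_upwards [hev1, hev2, self_mem_nhdsWithin] with t ht1 ht2 ht0
  have ht0 : t ≠ 0 := ht0
  set q : E := t⁻¹ • (γ t - γ 0) with hq
  have hγt : γ t = γ 0 + t • q := by
    rw [hq, smul_smul, mul_inv_cancel₀ ht0, one_smul]; abel
  have key : ∀ s ∈ Metric.ball (0 : ℝ) δ, HasDerivWithinAt
      (fun s : ℝ => f (γ 0 + s • q) - s • df (γ 0, y))
      (df (γ 0 + s • q, q) - df (γ 0, y)) (Metric.ball (0 : ℝ) δ) s := by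
    intro s hs
    have hsW := hab (hpaδ hs) ht1
    have h1 : HasDerivAt (fun s : ℝ => f (γ 0 + s • q)) (df (γ 0 + s • q, q)) s := by
      rw [hasDerivAt_iff_tendsto_slope_zero]
      refine (hdf _ hsW.1 q).congr fun r => ?_
      rw [add_smul, add_assoc]
    have h2 : HasDerivAt (fun s : ℝ => s • df (γ 0, y)) (df (γ 0, y)) s := by
      simpa using (hasDerivAt_id s).smul_const (df (γ 0, y))
    exact (h1.sub h2).hasDerivWithinAt
  have hb := Convex.norm_image_sub_le_of_norm_hasDerivWithin_le (C := ε / 2) key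
    (fun s hs => by
      rw [← dist_eq_norm]
      exact (hab (hpaδ hs) ht1).2.le)
    (convex_ball _ _) (Metric.mem_ball_self hδ) (Metric.mem_ball.2 ht2)
  simp only [zero_smul, add_zero, sub_zero] at hb
  rw [← hγt] at hb
  rw [slope_def_module, sub_zero, dist_eq_norm]
  have e : t⁻¹ • (f (γ t) - f (γ 0)) - df (γ 0, y)
      = t⁻¹ • (f (γ t) - t • df (γ 0, y) - f (γ 0)) := by
    have : df (γ 0, y) = t⁻¹ • (t • df (γ 0, y)) := by
      rw [smul_smul, inv_mul_cancel₀ ht0, one_smul]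
    conv_lhs => rw [this]
    rw [← smul_sub]
    congr 1
    abel
  rw [e, norm_smul, norm_inv]
  have htpos : 0 < ‖t‖ := norm_pos_iff.2 ht0
  calc ‖t‖⁻¹ * ‖f (γ t) - t • df (γ 0, y) - f (γ 0)‖ ≤ ‖t‖⁻¹ * (ε / 2 * ‖t‖) := by gcongr
    _ = ε / 2 := by field_simp
    _ < ε := half_lt_self hε

end BastianiC

section Representations

variable {E : Type u} [AddCommGroup E] [Module ℝ E] [TopologicalSpace E]
    {G : Type v} [Group G] [TopologicalSpace G] [ChartedSpace E G]
    {H : Type w} [NormedAddCommGroup H] [InnerProductSpace ℂ H] [CompleteSpace H]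

/-- The space `H^∞` of smooth vectors of a unitary representation `π` of `G` on `H`: the vectors
`v` whose orbit map `g ↦ π(g) v` is smooth. -/
def smoothVectors (E : Type u) [AddCommGroup E] [Module ℝ E] [TopologicalSpace E]
    [ChartedSpace E G] (π : G →* unitary (H →L[ℂ] H)) : Submodule ℂ H where
  carrier := {v | ∀ e ∈ atlas E G,
    BastianiSmooth (fun x : E => (π (e.symm x) : H →L[ℂ] H) v) e.target}
  add_mem' := fun {v v'} hv hv' e he n => by
    simp only [map_add]
    exact BastianiC.add n (hv e he n) (hv' e he n)
  zero_mem' := fun e he n => by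
    simp only [map_zero]
    exact BastianiC.zero_fun n _
  smul_mem' := fun a v hv e he n => by
    simp only [map_smul]
    exact BastianiC.clm_comp
      ((a • ContinuousLinearMap.id ℂ H).restrictScalars ℝ) n (hv e he n)

/-- A unitary representation is smooth if its smooth vectors are dense. -/
def IsSmoothRep (E : Type u) [AddCommGroup E] [Module ℝ E] [TopologicalSpace E]
    [ChartedSpace E G] (π : G →* unitary (H →L[ℂ] H)) : Prop :=
  Dense (smoothVectors E π : Set H)

theorem differentiableAt_orbit [IsTopologicalAddGroup E] [ContinuousSMul ℝ E]
    {ex : E → G} (hex : LCLieGroup.IsExp ex) (π : G →* unitary (H →L[ℂ] H)) (x : E) {v : H}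
    (hv : v ∈ smoothVectors E π) :
    DifferentiableAt ℝ (fun t : ℝ => (π (ex (t • x)) : H →L[ℂ] H) v) 0 := by
  have h1 : ex 0 = 1 := by
    have h := hex.map_add_smul 0 0 0
    simpa using h
  have hs : ∀ᶠ t in 𝓝 (0 : ℝ), ex (t • x) ∈ (chartAt E (1 : G)).source := by
    have hcont : Continuous fun t : ℝ => ex (t • x) := hex.continuous.comp (by fun_prop)
    refine hcont.continuousAt.eventually ((chartAt E (1 : G)).open_source.mem_nhds ?_)
    simp [h1]
  have h := BastianiC.hasDerivAt_comp (chartAt E (1 : G)).open_target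
    (hv (chartAt E (1 : G)) (chart_mem_atlas E 1) 1)
    (γ := fun t : ℝ => chartAt E (1 : G) (ex (t • x))) (y := x)
    (by simp [h1]) (hex.hasVelocity x)
  refine h.congr_of_eventuallyEq ?_
  filter_upwards [hs] with t ht
  rw [(chartAt E (1 : G)).left_inv ht]

/-- The derived representation: the operator `dπ(x) v = d/dt|₀ π(exp(t x)) v` with domain
`H^∞`. -/
noncomputable def derivedRep [IsTopologicalAddGroup E] [ContinuousSMul ℝ E]
    {ex : E → G} (hex : LCLieGroup.IsExp ex) (π : G →* unitary (H →L[ℂ] H)) (x : E) :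
    H →ₗ.[ℂ] H where
  domain := smoothVectors E π
  toFun :=
    { toFun := fun v => deriv (fun t : ℝ => (π (ex (t • x)) : H →L[ℂ] H) v) 0
      map_add' := fun v v' => by
        have h := (differentiableAt_orbit hex π x v.2).hasDerivAt.add
          (differentiableAt_orbit hex π x v'.2).hasDerivAt
        rw [← h.deriv]
        congr 1
        funext t
        simp
      map_smul' := fun a v => by
        have h := (differentiableAt_orbit hex π x v.2).hasDerivAt.const_smul a
        rw [RingHom.id_apply, ← h.deriv]
        congr 1
        funext t
        simp }

/-- The spectrum of a (closed, densely defined) unbounded operator `A`: the complement of the set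
of all `z` for which `A - z` is a bijection of the domain of `A` onto `H` with bounded inverse. -/
def unboundedSpectrum (A : H →ₗ.[ℂ] H) : Set ℂ :=
  {z | ¬ ∃ R : H →L[ℂ] H, (∀ v : A.domain, R (A v - z • (v : H)) = v) ∧
    ∀ y : H, ∃ v : A.domain, (v : H) = R y ∧ A v - z • (v : H) = y}

/-- The function `s_π(x) = sup Spec(i dπ(x))`, where the spectrum is that of the closure of
`i dπ(x)`. -/
noncomputable def supSpec [IsTopologicalAddGroup E] [ContinuousSMul ℝ E]
    {ex : E → G} (hex : LCLieGroup.IsExp ex) (π : G →* unitary (H →L[ℂ] H)) (x : E) : EReal :=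
  sSup ((fun z : ℂ => (z.re : EReal)) ''
    unboundedSpectrum ((Complex.I • derivedRep hex π x).closure))

/-- The set `W_π` of all points that have a neighbourhood on which `s_π` is bounded (above). -/
def semiboundedCone [IsTopologicalAddGroup E] [ContinuousSMul ℝ E]
    {ex : E → G} (hex : LCLieGroup.IsExp ex) (π : G →* unitary (H →L[ℂ] H)) : Set E :=
  {x₀ | ∃ M : ℝ, ∀ᶠ x in 𝓝 x₀, supSpec hex π x ≤ (M : EReal)}

/-- A semibounded representation: a smooth unitary representation such that `s_π` is bounded on a
neighbourhood of some point. -/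
def IsSemibounded [IsTopologicalAddGroup E] [ContinuousSMul ℝ E]
    {ex : E → G} (hex : LCLieGroup.IsExp ex) (π : G →* unitary (H →L[ℂ] H)) : Prop :=
  IsSmoothRep E π ∧ (semiboundedCone hex π).Nonempty

/-- A bounded representation: a smooth unitary representation for which `W_π` is the whole Lie
algebra. -/
def IsBoundedRep [IsTopologicalAddGroup E] [ContinuousSMul ℝ E]
    {ex : E → G} (hex : LCLieGroup.IsExp ex) (π : G →* unitary (H →L[ℂ] H)) : Prop :=
  IsSmoothRep E π ∧ semiboundedCone hex π = univ

end Representations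

/-! For a smooth vector v let Φ_v(x) = ⟨v, i dπ(x) v⟩ be its momentum (`momentum`). By
`supSpec_le_iff` a bound s_π(x) ≤ M says exactly that Φ_v(x) ≤ M‖v‖² for all smooth v, so
semiboundedness becomes a statement about linear functionals. `momentum_flow_eq` shows that momenta
are carried along by curves with y' = [x, y]; no adjoint action of `G` has to be constructed.

Centre. Near a point of W_π choose (a, ζ) with ‖ζ(t)‖² not constant. The loop η = (‖ζ‖²)' ζ commutes
with ζ but ω(η, ζ) ≠ 0, so the adjoint orbit of (a, ζ) contains the whole line (a, ζ) + ℝc. Momenta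
are bounded above on this line, hence Φ_v(c) = 0 (`momentum_c_eq_zero`), and polarisation gives
π(exp sc) = 1. As 𝔨 has trivial centre, the centre of the extension is ℝc.

Boundedness. Momenta are now functionals on the loop algebra, permuted by the operators e^{ad η}. If
(a, ζ) lies in W_π, the upper bounds at ζ ± u give |Φ_v(u)| ≤ M‖v‖² + Φ_v(−ζ) for u in a
neighbourhood U of 0. If Φ_v(−ζ)/‖v‖² were unbounded above, functionals normalised at −ζ would have
an ultrafilter limit g with g(−ζ) = 1 and |g(Su)| ≤ g(S(−ζ)) for all u in U and all products S of
operators e^{ad η}. `apply_eq_zero_of_dominates` excludes such a g.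

For this, functionals with such a domination form a convex cone with compact base, stable under the
operators S (`Dominated`). Since e^{ad η} is pointwise isometric, its norm is close to 1 in a C^m
norm with small weights on the derivatives. An average A of such operators therefore changes the
normalisation only subexponentially under iteration, and a weighted Krylov–Bogoliubov argument gives
a normalised f with f ∘ A = f (`Dominated.exists_invariant`). On loops with a fixed scalar profile
supported in an arc, f has the form v ↦ ⟨z, v⟩; invariance under an average of isometries forces z
to be fixed by each of them. In a limit z is fixed by all e^{ad y}, so it is central and 0, and f
vanishes on the arc. Four arcs cover the circle. Treated one after another, with the zeros already
found being kept, they leave a functional that is 0 and yet has the value 1 at a point. -/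

set_option linter.unusedSectionVars false

/-! ### Differential calculus for Bastiani maps -/

/-- The directional derivative of `f` as a function of the base point and the direction. -/
noncomputable def dirDeriv {E : Type u} [AddCommGroup E] [Module ℝ E]
    {F : Type v} [AddCommGroup F] [Module ℝ F] [TopologicalSpace F] (f : E → F) (p : E × E) : F :=
  velocity fun t : ℝ => f (p.1 + t • p.2)

theorem HasVelocity.velocity_eq {F : Type v} [AddCommGroup F] [Module ℝ F] [TopologicalSpace F]
    [T2Space F] {γ : ℝ → F} {y : F} (h : HasVelocity γ y) : velocity γ = y :=
  h.limUnder_eq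

theorem HasVelocity.congr_of_eventuallyEq {F : Type v} [AddCommGroup F] [Module ℝ F]
    [TopologicalSpace F] {γ δ : ℝ → F} {y : F} (h : HasVelocity γ y) (hγδ : γ =ᶠ[𝓝 0] δ) :
    HasVelocity δ y := by
  refine Tendsto.congr' ?_ h
  filter_upwards [hγδ.filter_mono nhdsWithin_le_nhds] with t ht
  rw [ht, hγδ.eq_of_nhds]

theorem hasVelocity_iff_hasDerivAt {F : Type v} [NormedAddCommGroup F] [NormedSpace ℝ F]
    {γ : ℝ → F} {y : F} : HasVelocity γ y ↔ HasDerivAt γ y 0 := by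
  rw [hasDerivAt_iff_tendsto_slope_zero]
  simp [HasVelocity]

namespace BastianiC

section general

variable {F : Type v} [AddCommGroup F] [Module ℝ F] [TopologicalSpace F]
  {E : Type u} [AddCommGroup E] [Module ℝ E] [TopologicalSpace E]

theorem continuousOn {n : ℕ} {f : E → F} {U : Set E} (h : BastianiC n f U) : ContinuousOn f U := by
  cases n with
  | zero => exact h
  | succ n => exact h.1

theorem hasVelocity_line [T2Space F] {n : ℕ} {f : E → F} {U : Set E} (h : BastianiC (n + 1) f U)
    {x : E} (hx : x ∈ U) (y : E) : HasVelocity (fun t : ℝ => f (x + t • y)) (dirDeriv f (x, y)) := by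
  obtain ⟨-, df, hdf, -⟩ := h
  have h1 : HasVelocity (fun t : ℝ => f (x + t • y)) (df (x, y)) := by
    simpa [HasVelocity] using hdf x hx y
  have : dirDeriv f (x, y) = df (x, y) := h1.velocity_eq
  rwa [this]

theorem eventually_line [IsTopologicalAddGroup E] [ContinuousSMul ℝ E] {U : Set E} (hU : IsOpen U)
    {x : E} (hx : x ∈ U) (y : E) : ∀ᶠ t in 𝓝 (0 : ℝ), x + t • y ∈ U := by
  have hc : Continuous fun t : ℝ => x + t • y := by fun_prop
  exact hc.continuousAt.eventually (hU.mem_nhds (by simpa using hx))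

theorem congr [IsTopologicalAddGroup E] [ContinuousSMul ℝ E] {n : ℕ} {f g : E → F} {U : Set E}
    (hU : IsOpen U) (h : BastianiC n f U) (hfg : ∀ x ∈ U, f x = g x) : BastianiC n g U := by
  cases n with
  | zero => exact ContinuousOn.congr h fun x hx => (hfg x hx).symm
  | succ n =>
    obtain ⟨h1, df, hdf, h2⟩ := h
    refine ⟨h1.congr fun x hx => (hfg x hx).symm, df, fun x hx y => ?_, h2⟩
    refine (hdf x hx y).congr' ?_
    filter_upwards [(eventually_line hU hx y).filter_mono nhdsWithin_le_nhds] with t ht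
    rw [hfg _ ht, hfg _ hx]

theorem dirDeriv_bastiani [T2Space F] [IsTopologicalAddGroup E] [ContinuousSMul ℝ E] {n : ℕ}
    {f : E → F} {U : Set E} (hU : IsOpen U) (h : BastianiC (n + 1) f U) :
    BastianiC n (dirDeriv f) (U ×ˢ univ) := by
  have h' := h
  obtain ⟨-, df, hdf, h2⟩ := h
  refine h2.congr (hU.prod isOpen_univ) fun p hp => ?_
  have h1 : HasVelocity (fun t : ℝ => f (p.1 + t • p.2)) (df p) := by
    simpa [HasVelocity] using hdf p.1 hp.1 p.2
  exact h1.velocity_eq.symm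

theorem succ_of_dirDeriv {n : ℕ} {f : E → F} {U : Set E} (h0 : ContinuousOn f U)
    (h1 : ∀ x ∈ U, ∀ y, HasVelocity (fun t : ℝ => f (x + t • y)) (dirDeriv f (x, y)))
    (h2 : BastianiC n (dirDeriv f) (U ×ˢ univ)) : BastianiC (n + 1) f U :=
  ⟨h0, dirDeriv f, fun x hx y => by simpa [HasVelocity] using h1 x hx y, h2⟩

end general

section general

variable {F : Type v} [AddCommGroup F] [Module ℝ F] [TopologicalSpace F]

theorem of_succ (n : ℕ) : ∀ {E : Type u} [AddCommGroup E] [Module ℝ E] [TopologicalSpace E]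
    {f : E → F} {U : Set E}, BastianiC (n + 1) f U → BastianiC n f U := by
  induction n with
  | zero => intro E _ _ _ f U h; exact h.1
  | succ n ih =>
    rintro E _ _ _ f U ⟨h, df, hdf, h2⟩
    exact ⟨h, df, hdf, ih h2⟩

/-- The derivative in `BastianiC` is only an existential witness. In a Hausdorff target it must
equal `dirDeriv`, so local witnesses glue. -/
theorem locally [T2Space F] (n : ℕ) : ∀ {E : Type u} [AddCommGroup E] [Module ℝ E]
    [TopologicalSpace E] [IsTopologicalAddGroup E] [ContinuousSMul ℝ E]
    {f : E → F} {U : Set E}, (∀ x ∈ U, ∃ V, IsOpen V ∧ x ∈ V ∧ BastianiC n f V) →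
      BastianiC n f U := by
  induction n with
  | zero =>
    intro E _ _ _ _ _ f U h x hx
    obtain ⟨V, hV, hxV, hf⟩ := h x hx
    exact (ContinuousOn.continuousAt hf (hV.mem_nhds hxV)).continuousWithinAt
  | succ n ih =>
    intro E _ _ _ _ _ f U h
    refine succ_of_dirDeriv ?_ ?_ ?_
    · intro x hx
      obtain ⟨V, hV, hxV, hf⟩ := h x hx
      exact (hf.continuousOn.continuousAt (hV.mem_nhds hxV)).continuousWithinAt
    · intro x hx y
      obtain ⟨V, hV, hxV, hf⟩ := h x hx
      exact hf.hasVelocity_line hxV y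
    · refine ih fun p hp => ?_
      obtain ⟨V, hV, hxV, hf⟩ := h p.1 hp.1
      exact ⟨V ×ˢ univ, hV.prod isOpen_univ, ⟨hxV, mem_univ _⟩, hf.dirDeriv_bastiani hV⟩

/-- An affine inner map needs no mean value inequality, so the target is an arbitrary topological
vector space here. This serves to restrict maps to slices and to forget variables. -/
theorem comp_affine (n : ℕ) : ∀ {E : Type u} [AddCommGroup E] [Module ℝ E] [TopologicalSpace E]
    {E' : Type w} [AddCommGroup E'] [Module ℝ E'] [TopologicalSpace E'] [ContinuousAdd E']
    {f : E' → F} {V : Set E'}, BastianiC n f V → ∀ (L : E →L[ℝ] E') (c : E') {U : Set E},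
      MapsTo (fun x => L x + c) U V → BastianiC n (fun x => f (L x + c)) U := by
  induction n with
  | zero =>
    intro E _ _ _ E' _ _ _ _ f V h L c U hUV
    exact ContinuousOn.comp h (L.continuous.add continuous_const).continuousOn hUV
  | succ n ih =>
    rintro E _ _ _ E' _ _ _ _ f V ⟨h, df, hdf, h2⟩ L c U hUV
    refine ⟨h.comp (L.continuous.add continuous_const).continuousOn hUV,
      fun p => df (L p.1 + c, L p.2), fun x hx y => ?_, ?_⟩
    · refine (hdf _ (hUV hx) (L y)).congr fun t => ?_
      have e : L x + c + t • L y = L (x + t • y) + c := by rw [map_add, map_smul]; abel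
      simp only [e]
    · have := ih h2 (L.prodMap L) (c, 0) (U := U ×ˢ univ) (fun p hp => by
        simpa using hUV hp.1)
      simpa [Prod.map, Prod.add_def] using this

theorem prodMk {F' : Type w} [AddCommGroup F'] [Module ℝ F'] [TopologicalSpace F'] (n : ℕ) :
    ∀ {E : Type u} [AddCommGroup E] [Module ℝ E] [TopologicalSpace E]
    {f : E → F} {g : E → F'} {U : Set E}, BastianiC n f U → BastianiC n g U →
      BastianiC n (fun x => (f x, g x)) U := by
  induction n with
  | zero => intro E _ _ _ f g U hf hg; exact ContinuousOn.prodMk hf hg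
  | succ n ih =>
    rintro E _ _ _ f g U ⟨hf, df, hdf, hdf'⟩ ⟨hg, dg, hdg, hdg'⟩
    exact ⟨hf.prodMk hg, fun p => (df p, dg p), fun x hx y =>
      (hdf x hx y).prodMk_nhds (hdg x hx y), ih hdf' hdg'⟩

end general

section normed

/-- The chain rule for a `C^1` map with values in a normed space along a curve. -/
theorem hasDerivAt_curve {F : Type v} [NormedAddCommGroup F] [NormedSpace ℝ F]
    {E : Type u} [AddCommGroup E] [Module ℝ E] [TopologicalSpace E] [IsTopologicalAddGroup E]
    [ContinuousSMul ℝ E] {U : Set E} (hU : IsOpen U) {f : E → F} (hf : BastianiC 1 f U)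
    {γ : ℝ → E} {y : E} (h0 : γ 0 ∈ U) (hγ : HasVelocity γ y) :
    HasDerivAt (fun t => f (γ t)) (dirDeriv f (γ 0, y)) 0 := by
  have hdf := fun x hx y => hf.hasVelocity_line (x := x) hx y
  have hc : ContinuousOn (dirDeriv f) (U ×ˢ univ) := (hf.dirDeriv_bastiani hU).continuousOn
  set df := dirDeriv f with hdf_def
  rw [hasDerivAt_iff_tendsto_slope]
  rw [Metric.tendsto_nhds]
  intro ε hε
  have hopen : IsOpen (U ×ˢ (univ : Set E)) := hU.prod isOpen_univ
  have hcA : ContinuousAt df (γ 0, y) := hc.continuousAt (hopen.mem_nhds ⟨h0, mem_univ _⟩)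
  have hW : ∀ᶠ p in 𝓝 (γ 0, y), p.1 ∈ U ∧ dist (df p) (df (γ 0, y)) < ε / 2 :=
    (Filter.Eventually.mono (hopen.mem_nhds ⟨h0, mem_univ _⟩) (fun p hp => hp.1)).and
      (hcA.eventually (Metric.ball_mem_nhds _ (half_pos hε)))
  have hm : Tendsto (fun q : ℝ × E => (γ 0 + q.1 • q.2, q.2)) (𝓝 ((0 : ℝ), y)) (𝓝 (γ 0, y)) := by
    have : Continuous (fun q : ℝ × E => (γ 0 + q.1 • q.2, q.2)) := by fun_prop
    have h := this.tendsto ((0 : ℝ), y)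
    simpa using h
  have hW' := hm.eventually hW
  rw [nhds_prod_eq, Filter.eventually_prod_iff] at hW'
  obtain ⟨pa, hpa, pb, hpb, hab⟩ := hW'
  obtain ⟨δ, hδ, hpaδ⟩ := Metric.eventually_nhds_iff.1 hpa
  have hev1 : ∀ᶠ t in 𝓝[≠] (0 : ℝ), pb (t⁻¹ • (γ t - γ 0)) := hγ.eventually hpb
  have hev2 : ∀ᶠ t in 𝓝[≠] (0 : ℝ), dist t 0 < δ :=
    nhdsWithin_le_nhds (Metric.ball_mem_nhds (0 : ℝ) hδ)
  filter_upwards [hev1, hev2, self_mem_nhdsWithin] with t ht1 ht2 ht0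
  have ht0 : t ≠ 0 := ht0
  -- With the difference quotient `q` frozen, γ t lies on the line through γ 0 with direction `q`,
  -- which is close to `y`. The mean value inequality along this line compares f(γ t) with its
  -- linear part.
  set q : E := t⁻¹ • (γ t - γ 0) with hq
  have hγt : γ t = γ 0 + t • q := by
    rw [hq, smul_smul, mul_inv_cancel₀ ht0, one_smul]; abel
  have key : ∀ s ∈ Metric.ball (0 : ℝ) δ, HasDerivWithinAt
      (fun s : ℝ => f (γ 0 + s • q) - s • df (γ 0, y))
      (df (γ 0 + s • q, q) - df (γ 0, y)) (Metric.ball (0 : ℝ) δ) s := by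
    intro s hs
    have hsW := hab (hpaδ hs) ht1
    have h1 : HasDerivAt (fun s : ℝ => f (γ 0 + s • q)) (df (γ 0 + s • q, q)) s := by
      rw [hasDerivAt_iff_tendsto_slope_zero]
      have h := hdf _ hsW.1 q
      simp only [HasVelocity, zero_smul, add_zero] at h
      refine h.congr fun r => ?_
      rw [add_smul, add_assoc]
    have h2 : HasDerivAt (fun s : ℝ => s • df (γ 0, y)) (df (γ 0, y)) s := by
      simpa using (hasDerivAt_id s).smul_const (df (γ 0, y))
    exact (h1.sub h2).hasDerivWithinAt
  have hb := Convex.norm_image_sub_le_of_norm_hasDerivWithin_le (C := ε / 2) key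
    (fun s hs => by
      rw [← dist_eq_norm]
      exact (hab (hpaδ hs) ht1).2.le)
    (convex_ball _ _) (Metric.mem_ball_self hδ) (Metric.mem_ball.2 ht2)
  simp only [zero_smul, add_zero, sub_zero] at hb
  rw [← hγt] at hb
  rw [slope_def_module, sub_zero, dist_eq_norm]
  have e : t⁻¹ • (f (γ t) - f (γ 0)) - df (γ 0, y)
      = t⁻¹ • (f (γ t) - t • df (γ 0, y) - f (γ 0)) := by
    have : df (γ 0, y) = t⁻¹ • (t • df (γ 0, y)) := by
      rw [smul_smul, inv_mul_cancel₀ ht0, one_smul]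
    conv_lhs => rw [this]
    rw [← smul_sub]
    congr 1
    abel
  rw [e, norm_smul, norm_inv]
  have htpos : 0 < ‖t‖ := norm_pos_iff.2 ht0
  calc ‖t‖⁻¹ * ‖f (γ t) - t • df (γ 0, y) - f (γ 0)‖ ≤ ‖t‖⁻¹ * (ε / 2 * ‖t‖) := by gcongr
    _ = ε / 2 := by field_simp
    _ < ε := half_lt_self hε

variable {F : Type v} [NormedAddCommGroup F] [NormedSpace ℝ F]

/-- The chain rule for Bastiani differentiable maps. -/
theorem comp (n : ℕ) : ∀ {E : Type u} [AddCommGroup E] [Module ℝ E] [TopologicalSpace E]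
    [IsTopologicalAddGroup E] [ContinuousSMul ℝ E]
    {E' : Type w} [AddCommGroup E'] [Module ℝ E'] [TopologicalSpace E']
    [IsTopologicalAddGroup E'] [ContinuousSMul ℝ E']
    {f : E' → F} {V : Set E'} {γ : E → E'} {U : Set E}, IsOpen V → BastianiC n f V →
      BastianiC n γ U → MapsTo γ U V → BastianiC n (fun x => f (γ x)) U := by
  induction n with
  | zero => intro E _ _ _ _ _ E' _ _ _ _ _ f V γ U hV hf hγ h; exact ContinuousOn.comp hf hγ h
  | succ n ih =>
    rintro E _ _ _ _ _ E' _ _ _ _ _ f V γ U hV hf hγ h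
    have hγ' := of_succ n hγ
    obtain ⟨h0, dγ, hdγ, h2⟩ := hγ
    have hf1 : BastianiC 1 f V := by
      obtain ⟨g0, df, g1, g2⟩ := hf
      exact ⟨g0, df, g1, g2.continuousOn⟩
    refine ⟨hf.continuousOn.comp h0 h, fun p => dirDeriv f (γ p.1, dγ p), fun x hx y => ?_, ?_⟩
    · have hv : HasVelocity (fun t : ℝ => γ (x + t • y)) (dγ (x, y)) := by
        simpa [HasVelocity] using hdγ x hx y
      have := hasDerivAt_curve hV hf1 (γ := fun t : ℝ => γ (x + t • y)) (by simpa using h hx) hv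
      have := hasVelocity_iff_hasDerivAt.2 this
      simpa [HasVelocity] using this
    · have hfst : BastianiC n (fun p : E × E => γ p.1) (U ×ˢ univ) := by
        have := comp_affine n hγ' (ContinuousLinearMap.fst ℝ E E) 0 (U := U ×ˢ univ)
          (fun p hp => by simpa using hp.1)
        simpa using this
      exact ih (hV.prod isOpen_univ) (hf.dirDeriv_bastiani hV) (prodMk n hfst h2)
        (fun p hp => ⟨h hp.1, mem_univ _⟩)

variable {E : Type u} [AddCommGroup E] [Module ℝ E] [TopologicalSpace E]
    {U : Set E} {f : E → F}

theorem hasDerivAt_line {x : E} (hf : BastianiC 1 f U) (y : E) {s : ℝ} (hs : x + s • y ∈ U) :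
    HasDerivAt (fun s : ℝ => f (x + s • y)) (dirDeriv f (x + s • y, y)) s := by
  rw [hasDerivAt_iff_tendsto_slope_zero]
  have h := hf.hasVelocity_line hs y
  simp only [HasVelocity, zero_smul, add_zero] at h
  refine h.congr fun r => ?_
  rw [add_smul, add_assoc]

theorem dirDeriv_smul (hf : BastianiC 1 f U) {x : E} (hx : x ∈ U) (c : ℝ) (a : E) :
    dirDeriv f (x, c • a) = c • dirDeriv f (x, a) := by
  have h4 := hf.hasDerivAt_line (x := x) (c • a) (s := 0) (by simpa using hx)
  have h1 := hf.hasDerivAt_line (x := x) a (s := 0 * c) (by simpa using hx)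
  have h2 : HasDerivAt (fun t : ℝ => t * c) c 0 := by simpa using (hasDerivAt_id (0 : ℝ)).mul_const c
  have h3 := HasDerivAt.scomp (0 : ℝ) h1 h2
  have h5 := h4.unique (h3.congr_of_eventuallyEq (Eventually.of_forall fun t => by
    simp [smul_smul]))
  simpa using h5

variable [IsTopologicalAddGroup E] [ContinuousSMul ℝ E]

/-- On a plane, continuous partial derivatives give Fréchet differentiability. Additivity of
`dirDeriv` and the symmetry of second derivatives are inherited from such planes. -/
theorem hasFDerivAt_plane (hU : IsOpen U) (hf : BastianiC 1 f U) (x a b : E) {s : ℝ × ℝ}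
    (hs : x + s.1 • a + s.2 • b ∈ U) :
    HasFDerivAt (fun s : ℝ × ℝ => f (x + s.1 • a + s.2 • b))
      ((ContinuousLinearMap.toSpanSingleton ℝ (dirDeriv f (x + s.1 • a + s.2 • b, a))).coprod
        (ContinuousLinearMap.toSpanSingleton ℝ (dirDeriv f (x + s.1 • a + s.2 • b, b)))) s := by
  have hcl : Continuous fun s : ℝ × ℝ => x + s.1 • a + s.2 • b := by fun_prop
  have hev : ∀ᶠ v in 𝓝 s, x + v.1 • a + v.2 • b ∈ U := hcl.continuousAt.eventually (hU.mem_nhds hs)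
  have hc := (hf.dirDeriv_bastiani hU).continuousOn
  have hcont : ∀ c : E, ContinuousAt (fun v : ℝ × ℝ =>
      ContinuousLinearMap.toSpanSingleton ℝ (dirDeriv f (x + v.1 • a + v.2 • b, c))) s := by
    intro c
    refine (ContinuousLinearMap.toSpanSingletonLIE ℝ F).continuous.continuousAt.comp
      (f := fun v : ℝ × ℝ => dirDeriv f (x + v.1 • a + v.2 • b, c)) ?_
    exact ContinuousAt.comp (f := fun v : ℝ × ℝ => (x + v.1 • a + v.2 • b, c))
      (hc.continuousAt ((hU.prod isOpen_univ).mem_nhds ⟨hs, mem_univ _⟩))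
      (hcl.prodMk continuous_const).continuousAt
  refine (hasStrictFDerivAt_uncurry_coprod (𝕜 := ℝ) (u := s)
    (f := fun s t => f (x + s • a + t • b))
    (f₁ := fun s t => ContinuousLinearMap.toSpanSingleton ℝ (dirDeriv f (x + s • a + t • b, a)))
    (f₂ := fun s t => ContinuousLinearMap.toSpanSingleton ℝ (dirDeriv f (x + s • a + t • b, b)))
    ?_ ?_ (hcont a) (hcont b)).hasFDerivAt
  · filter_upwards [hev] with v hv
    rw [add_right_comm] at hv
    have := (hf.hasDerivAt_line a hv).hasFDerivAt
    simp only [add_right_comm x (v.2 • b)] at this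
    exact this
  · filter_upwards [hev] with v hv
    exact (hf.hasDerivAt_line b hv).hasFDerivAt

theorem dirDeriv_add (hU : IsOpen U) (hf : BastianiC 1 f U) {x : E} (hx : x ∈ U) (a b : E) :
    dirDeriv f (x, a + b) = dirDeriv f (x, a) + dirDeriv f (x, b) := by
  have h1 := hasFDerivAt_plane hU hf x a b (s := 0) (by simpa using hx)
  have h2 : HasDerivAt (fun t : ℝ => ((t, t) : ℝ × ℝ)) (1, 1) 0 :=
    (hasDerivAt_id 0).prodMk (hasDerivAt_id 0)
  have h3 := HasFDerivAt.comp_hasDerivAt (0 : ℝ) (f := fun t : ℝ => ((t, t) : ℝ × ℝ)) h1 h2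
  have h4 := hf.hasDerivAt_line (x := x) (a + b) (s := 0) (by simpa using hx)
  have h5 := h4.unique (h3.congr_of_eventuallyEq (Eventually.of_forall fun t => by
    simp [add_assoc]))
  simpa using h5

theorem dirDeriv_dirDeriv_symm (hU : IsOpen U) (hf : BastianiC 2 f U) {x : E} (hx : x ∈ U)
    (a b : E) : dirDeriv (dirDeriv f) ((x, a), (b, 0)) = dirDeriv (dirDeriv f) ((x, b), (a, 0)) := by
  have hf1 : BastianiC 1 f U := of_succ 1 hf
  have hdir : ∀ c : E, BastianiC 1 (fun p => dirDeriv f (p, c)) U := by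
    intro c
    have := comp_affine 1 (hf.dirDeriv_bastiani hU) (ContinuousLinearMap.inl ℝ E E) (0, c) (U := U)
      (fun p hp => by simpa using hp)
    simpa using this
  have hev : ∀ᶠ s : ℝ × ℝ in 𝓝 0, x + s.1 • a + s.2 • b ∈ U := by
    have hcl : Continuous fun s : ℝ × ℝ => x + s.1 • a + s.2 • b := by fun_prop
    exact hcl.continuousAt.eventually (hU.mem_nhds (by simpa using hx))
  have hA := hasFDerivAt_plane hU (hdir a) x a b (s := 0) (by simpa using hx)
  have hB := hasFDerivAt_plane hU (hdir b) x a b (s := 0) (by simpa using hx)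
  have hc := fun c => ((ContinuousLinearMap.toSpanSingletonLIE ℝ F).toContinuousLinearEquiv.hasFDerivAt
    (x := c))
  have hA' := HasFDerivAt.comp (0 : ℝ × ℝ) (hc _) hA
  have hB' := HasFDerivAt.comp (0 : ℝ × ℝ) (hc _) hB
  -- The Fréchet derivative on the plane is a part through `fst` plus a part through `snd`; they are
  -- differentiated separately.
  have hAf := (ContinuousLinearMap.precomp F (ContinuousLinearMap.fst ℝ ℝ ℝ)).hasFDerivAt.comp
    (0 : ℝ × ℝ) hA'
  have hBf := (ContinuousLinearMap.precomp F (ContinuousLinearMap.snd ℝ ℝ ℝ)).hasFDerivAt.comp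
    (0 : ℝ × ℝ) hB'
  have hsum := hAf.add hBf
  have key := second_derivative_symmetric_of_eventually_of_real (hev.mono fun s hs =>
    hasFDerivAt_plane hU hf1 x a b hs) (hsum.congr_of_eventuallyEq
      (Eventually.of_forall fun s => by ext <;> simp)) (1, 0) (0, 1)
  have e : ∀ c d : E, dirDeriv (fun p => dirDeriv f (p, c)) (x, d)
      = dirDeriv (dirDeriv f) ((x, c), (d, 0)) := by
    intro c d; simp [dirDeriv]
  simp [e] at key
  exact key.symm

end normed

end BastianiC

/-! ### Smooth vectors and the derived representation -/

section Orbits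

variable {E : Type u} [AddCommGroup E] [Module ℝ E] [TopologicalSpace E]
    [IsTopologicalAddGroup E] [ContinuousSMul ℝ E] [LocallyConvexSpace ℝ E] [T2Space E]
    {G : Type v} [Group G] [TopologicalSpace G] [ChartedSpace E G] [LCLieGroup E G]
    {H : Type w} [NormedAddCommGroup H] [InnerProductSpace ℂ H] [CompleteSpace H]
    {π : G →* unitary (H →L[ℂ] H)} {ex : E → G}

theorem unitary_inner_map (g : G) (v w : H) :
    inner ℂ ((π g : H →L[ℂ] H) v) ((π g : H →L[ℂ] H) w) = inner ℂ v w :=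
  ContinuousLinearMap.inner_map_map_of_mem_unitary (π g).2 v w

theorem unitary_norm_map (g : G) (v : H) : ‖(π g : H →L[ℂ] H) v‖ = ‖v‖ :=
  ContinuousLinearMap.norm_map_of_mem_unitary (π g).2 v

theorem rep_mul_apply (g h : G) (v : H) :
    (π (g * h) : H →L[ℂ] H) v = (π g : H →L[ℂ] H) ((π h : H →L[ℂ] H) v) := by
  simp

theorem isOpen_mulDomain {e₁ e₂ e₃ : OpenPartialHomeomorph G E} :
    IsOpen {p : E × E | p.1 ∈ e₁.target ∧ p.2 ∈ e₂.target ∧ e₁.symm p.1 * e₂.symm p.2 ∈ e₃.source} := by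
  have : IsTopologicalGroup G := LCLieGroup.toIsTopologicalGroup E
  have hc : ContinuousOn (fun p : E × E => e₁.symm p.1 * e₂.symm p.2) (e₁.target ×ˢ e₂.target) :=
    (e₁.continuousOn_symm.comp continuousOn_fst fun p hp => hp.1).mul
      (e₂.continuousOn_symm.comp continuousOn_snd fun p hp => hp.2)
  have := hc.isOpen_inter_preimage (e₁.open_target.prod e₂.open_target) e₃.open_source
  convert this using 1
  ext p
  simp [and_assoc]

/-- The product of two chart points may leave any given chart, so around each pair a chart at the
product is used, and `BastianiC.locally` glues. -/
theorem bastianiC_orbit_mul {v : H} (hv : v ∈ smoothVectors E π) {e₁ e₂ : OpenPartialHomeomorph G E}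
    (he₁ : e₁ ∈ atlas E G) (he₂ : e₂ ∈ atlas E G) (n : ℕ) :
    BastianiC n (fun p : E × E => (π (e₁.symm p.1 * e₂.symm p.2) : H →L[ℂ] H) v)
      (e₁.target ×ˢ e₂.target) := by
  refine BastianiC.locally n fun p hp => ?_
  set e₃ := chartAt E (e₁.symm p.1 * e₂.symm p.2)
  refine ⟨_, isOpen_mulDomain (e₁ := e₁) (e₂ := e₂) (e₃ := e₃), ⟨hp.1, hp.2, mem_chart_source _ _⟩, ?_⟩
  have h3 : e₃ ∈ atlas E G := chart_mem_atlas _ _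
  have h := BastianiC.comp n e₃.open_target (hv e₃ h3 n) (LCLieGroup.smooth_mul e₁ he₁ e₂ he₂ e₃ h3 n)
    (fun q hq => e₃.map_source hq.2.2)
  refine h.congr isOpen_mulDomain fun q hq => ?_
  rw [e₃.left_inv hq.2.2]

/-- The orbit map of π(g)v is h ↦ π(hg)v, which is the map of `bastianiC_orbit_mul` with its second
argument frozen. -/
theorem rep_mem_smoothVectors {v : H} (hv : v ∈ smoothVectors E π) (g : G) :
    (π g : H →L[ℂ] H) v ∈ smoothVectors E π := by
  intro e he n
  set e' := chartAt E g
  have h := BastianiC.comp_affine n (bastianiC_orbit_mul hv he (chart_mem_atlas E g) n)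
    (ContinuousLinearMap.inl ℝ E E) (0, e' g) (U := e.target) (fun x hx => by
      simpa [e'] using hx)
  simpa [e'] using h

/-- The derivative at `0` of `t ↦ π (ex (t x)) v`. -/
noncomputable def dRep (ex : E → G) (π : G →* unitary (H →L[ℂ] H)) (x : E) (v : H) : H :=
  deriv (fun t : ℝ => (π (ex (t • x)) : H →L[ℂ] H) v) 0

variable (hex : LCLieGroup.IsExp ex)
include hex

theorem LCLieGroup.IsExp.map_zero : ex 0 = 1 := by
  simpa using hex.map_add_smul 0 0 0

theorem LCLieGroup.IsExp.eventually_mem_source (x : E) :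
    ∀ᶠ t in 𝓝 (0 : ℝ), ex (t • x) ∈ (chartAt E (1 : G)).source := by
  have hcont : Continuous fun t : ℝ => ex (t • x) := hex.continuous.comp (by fun_prop)
  refine hcont.continuousAt.eventually ((chartAt E (1 : G)).open_source.mem_nhds ?_)
  simp [hex.map_zero]

theorem hasDerivAt_dRep {v : H} (hv : v ∈ smoothVectors E π) (x : E) :
    HasDerivAt (fun t : ℝ => (π (ex (t • x)) : H →L[ℂ] H) v) (dRep ex π x v) 0 :=
  (differentiableAt_orbit hex π x hv).hasDerivAt

theorem hasDerivAt_dRep_flow {v : H} (hv : v ∈ smoothVectors E π) (x : E) (t : ℝ) :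
    HasDerivAt (fun t : ℝ => (π (ex (t • x)) : H →L[ℂ] H) v)
      (dRep ex π x ((π (ex (t • x)) : H →L[ℂ] H) v)) t := by
  have h := hasDerivAt_dRep hex (rep_mem_smoothVectors hv (ex (t • x))) x
  rw [← sub_self t] at h
  have := h.comp_sub_const t t
  refine this.congr_of_eventuallyEq (Eventually.of_forall fun s => ?_)
  simp only
  rw [← rep_mul_apply, ← hex.map_add_smul, sub_add_cancel]

/-- Replaces the curve `ex (t • x)` by a straight line in the chart; linearity of `dRep` in `x`
follows from this. -/
theorem dRep_eq_dirDeriv {v : H} (hv : v ∈ smoothVectors E π) (x : E) :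
    dRep ex π x v = dirDeriv (fun p => (π ((chartAt E (1 : G)).symm p) : H →L[ℂ] H) v)
      (chartAt E (1 : G) 1, x) := by
  set e := chartAt E (1 : G)
  have h := BastianiC.hasDerivAt_curve e.open_target (hv e (chart_mem_atlas E 1) 1)
    (γ := fun t : ℝ => e (ex (t • x))) (by simp [hex.map_zero, e]) (hex.hasVelocity x)
  simp only [zero_smul, hex.map_zero] at h
  refine (hasDerivAt_dRep hex hv x).unique (h.congr_of_eventuallyEq ?_)
  filter_upwards [hex.eventually_mem_source x] with t ht
  rw [e.left_inv ht]

theorem dRep_add_left {v : H} (hv : v ∈ smoothVectors E π) (x y : E) :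
    dRep ex π (x + y) v = dRep ex π x v + dRep ex π y v := by
  simp only [dRep_eq_dirDeriv hex hv]
  exact BastianiC.dirDeriv_add (chartAt E (1 : G)).open_target (hv _ (chart_mem_atlas E 1) 1)
    (mem_chart_target E 1) x y

theorem dRep_smul_left {v : H} (hv : v ∈ smoothVectors E π) (c : ℝ) (x : E) :
    dRep ex π (c • x) v = c • dRep ex π x v := by
  simp only [dRep_eq_dirDeriv hex hv]
  exact BastianiC.dirDeriv_smul (hv _ (chart_mem_atlas E 1) 1) (mem_chart_target E 1) c x

theorem dRep_sub_left {v : H} (hv : v ∈ smoothVectors E π) (x y : E) :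
    dRep ex π (x - y) v = dRep ex π x v - dRep ex π y v := by
  have h := dRep_add_left hex hv (x - y) y
  rw [sub_add_cancel] at h
  rw [h, add_sub_cancel_right]

theorem dRep_sub_right {v w : H} (hv : v ∈ smoothVectors E π) (hw : w ∈ smoothVectors E π) (x : E) :
    dRep ex π x (v - w) = dRep ex π x v - dRep ex π x w := by
  have h := (hasDerivAt_dRep hex hv x).sub (hasDerivAt_dRep hex hw x)
  rw [← h.deriv]
  unfold dRep
  congr 1
  funext t
  simp

theorem inner_dRep_left {v w : H} (hv : v ∈ smoothVectors E π) (hw : w ∈ smoothVectors E π) (x : E) :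
    inner ℂ (dRep ex π x v) w = - inner ℂ v (dRep ex π x w) := by
  have h := (hasDerivAt_dRep hex hv x).inner ℂ (hasDerivAt_dRep hex hw x)
  have h2 : HasDerivAt (fun t : ℝ => inner ℂ ((π (ex (t • x)) : H →L[ℂ] H) v)
      ((π (ex (t • x)) : H →L[ℂ] H) w)) 0 0 := by
    simp only [unitary_inner_map]
    exact hasDerivAt_const _ _
  have h3 := h.unique h2
  simp only [zero_smul, hex.map_zero, map_one, OneMemClass.coe_one,
    one_apply_eq_self] at h3
  rw [add_comm] at h3
  exact eq_neg_of_add_eq_zero_left h3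

/-- The map `(p, q) ↦ π (p q) v` in the chart at `1`. -/
noncomputable def orbitMul (E : Type u) [AddCommGroup E] [Module ℝ E] [TopologicalSpace E]
    [ChartedSpace E G] (π : G →* unitary (H →L[ℂ] H)) (v : H) (p : E × E) : H :=
  (π ((chartAt E (1 : G)).symm p.1 * (chartAt E (1 : G)).symm p.2) : H →L[ℂ] H) v

omit hex in
theorem bastianiC_orbitMul {v : H} (hv : v ∈ smoothVectors E π) (n : ℕ) :
    BastianiC n (orbitMul E π v) ((chartAt E (1 : G)).target ×ˢ (chartAt E (1 : G)).target) :=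
  bastianiC_orbit_mul hv (chart_mem_atlas E 1) (chart_mem_atlas E 1) n

omit hex in
theorem isOpen_chart_target_prod : IsOpen
    ((chartAt E (1 : G)).target ×ˢ (chartAt E (1 : G)).target) :=
  (chartAt E (1 : G)).open_target.prod (chartAt E (1 : G)).open_target

/-- Differentiating the left factor puts dπ(x) outside π(q); differentiating the right factor, in
`dirDeriv_orbitMul_right`, puts dπ(y) inside π(p). The mixed second derivative at (1, 1) then stands
for dπ(x) dπ(y) v. -/
theorem dirDeriv_orbitMul_left {v : H} (hv : v ∈ smoothVectors E π) (x : E) {q : E}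
    (hq : q ∈ (chartAt E (1 : G)).target) :
    dirDeriv (orbitMul E π v) ((chartAt E (1 : G) 1, q), (x, 0))
      = dRep ex π x ((π ((chartAt E (1 : G)).symm q) : H →L[ℂ] H) v) := by
  set e := chartAt E (1 : G)
  have hvel : HasVelocity (fun t : ℝ => (e (ex (t • x)), q)) (x, (0 : E)) := by
    have := (hex.hasVelocity x).prodMk_nhds (tendsto_const_nhds (x := (0 : E)))
    simpa [HasVelocity] using this
  have h := BastianiC.hasDerivAt_curve isOpen_chart_target_prod (bastianiC_orbitMul hv 1)
    (γ := fun t : ℝ => (e (ex (t • x)), q)) (by simp [hex.map_zero, e, hq]) hvel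
  simp only [zero_smul, hex.map_zero] at h
  refine h.unique ((hasDerivAt_dRep hex (rep_mem_smoothVectors hv (e.symm q)) x).congr_of_eventuallyEq ?_)
  filter_upwards [hex.eventually_mem_source x] with t ht
  simp only [orbitMul]
  rw [e.left_inv ht, rep_mul_apply]

theorem dirDeriv_orbitMul_right {v : H} (hv : v ∈ smoothVectors E π) (y : E) {p : E}
    (hp : p ∈ (chartAt E (1 : G)).target) :
    dirDeriv (orbitMul E π v) ((p, chartAt E (1 : G) 1), (0, y))
      = (π ((chartAt E (1 : G)).symm p) : H →L[ℂ] H) (dRep ex π y v) := by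
  set e := chartAt E (1 : G)
  have hvel : HasVelocity (fun t : ℝ => (p, e (ex (t • y)))) ((0 : E), y) := by
    have := (tendsto_const_nhds (x := (0 : E))).prodMk_nhds (hex.hasVelocity y)
    simpa [HasVelocity] using this
  have h := BastianiC.hasDerivAt_curve isOpen_chart_target_prod (bastianiC_orbitMul hv 1)
    (γ := fun t : ℝ => (p, e (ex (t • y)))) (by simp [hex.map_zero, e, hp]) hvel
  simp only [zero_smul, hex.map_zero] at h
  have h2 := ((π (e.symm p) : H →L[ℂ] H).restrictScalars ℝ).hasFDerivAt.comp_hasDerivAt (0 : ℝ)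
    (hasDerivAt_dRep hex hv y)
  refine h.unique (h2.congr_of_eventuallyEq ?_)
  filter_upwards [hex.eventually_mem_source y] with t ht
  simp only [orbitMul, Function.comp]
  rw [e.left_inv ht, rep_mul_apply]
  rfl

/-- Joint continuity of `(t, y) ↦ dπ(y) π(exp(t x)) v`. -/
theorem continuousAt_dRep_flow {v : H} (hv : v ∈ smoothVectors E π) (x y : E) :
    ContinuousAt (fun p : ℝ × E => dRep ex π p.2 ((π (ex (p.1 • x)) : H →L[ℂ] H) v)) (0, y) := by
  set e := chartAt E (1 : G)
  have hc := (BastianiC.dirDeriv_bastiani isOpen_chart_target_prod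
    (bastianiC_orbitMul (E := E) hv 1)).continuousOn
  have hex0 := hex.map_zero
  have hcx : ContinuousAt (fun p : ℝ × E => e (ex (p.1 • x))) (0, y) := by
    have h1 : Continuous fun p : ℝ × E => ex (p.1 • x) := hex.continuous.comp (by fun_prop)
    refine ContinuousAt.comp (g := e) ?_ h1.continuousAt
    refine e.continuousAt ?_
    simp [hex0, e]
  have hcont : ContinuousAt (fun p : ℝ × E =>
      dirDeriv (orbitMul E π v) ((e 1, e (ex (p.1 • x))), (p.2, 0))) (0, y) := by
    refine ContinuousAt.comp (g := dirDeriv (orbitMul E π v))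
      (f := fun p : ℝ × E => ((e 1, e (ex (p.1 • x))), (p.2, (0 : E)))) (hc.continuousAt ?_) ?_
    · refine (isOpen_chart_target_prod.prod isOpen_univ).mem_nhds ?_
      simp [hex0, e]
    · exact (continuousAt_const.prodMk hcx).prodMk (continuousAt_snd.prodMk continuousAt_const)
  refine hcont.congr ?_
  have hev := ((continuous_fst (X := ℝ) (Y := E)).tendsto (0, y)).eventually
    (hex.eventually_mem_source x)
  filter_upwards [hev] with p hp
  rw [dirDeriv_orbitMul_left hex hv p.2 (e.map_source hp), e.left_inv hp]

omit hex in
theorem leftField_eq_dirDeriv (y p : E) : LCLieGroup.leftField E G y p =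
    dirDeriv (fun p : E × E => chartAt E (1 : G) ((chartAt E (1 : G)).symm p.1 *
      (chartAt E (1 : G)).symm p.2)) ((p, chartAt E (1 : G) 1), (0, y)) := by
  simp [LCLieGroup.leftField, dirDeriv]

omit hex in
theorem leftField_one (y : E) : LCLieGroup.leftField E G y (chartAt E (1 : G) 1) = y := by
  set e := chartAt E (1 : G)
  refine HasVelocity.velocity_eq (HasVelocity.congr_of_eventuallyEq
    (γ := fun t : ℝ => e 1 + t • y) ?_ ?_)
  · refine tendsto_const_nhds.congr' ?_
    filter_upwards [self_mem_nhdsWithin] with t ht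
    have ht : t ≠ 0 := ht
    rw [zero_smul, add_zero, add_sub_cancel_left, smul_smul, inv_mul_cancel₀ ht, one_smul]
  · filter_upwards [BastianiC.eventually_line e.open_target (mem_chart_target E (1 : G)) y] with t ht
    rw [e.left_inv (mem_chart_source E (1 : G)), one_mul, e.right_inv ht]

omit hex in
/-- The domain on which the multiplication is defined in the chart at `1`. -/
theorem one_mem_mulDomain : ((chartAt E (1 : G) 1, chartAt E (1 : G) 1) : E × E) ∈
    {p : E × E | p.1 ∈ (chartAt E (1 : G)).target ∧ p.2 ∈ (chartAt E (1 : G)).target ∧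
      (chartAt E (1 : G)).symm p.1 * (chartAt E (1 : G)).symm p.2 ∈ (chartAt E (1 : G)).source} := by
  simp

omit hex in
theorem hasVelocity_leftField (x y : E) :
    HasVelocity (fun s : ℝ => LCLieGroup.leftField E G y (chartAt E (1 : G) 1 + s • x))
      (velocity fun s : ℝ => LCLieGroup.leftField E G y (chartAt E (1 : G) 1 + s • x)) := by
  have hμ := LCLieGroup.smooth_mul (chartAt E (1 : G)) (chart_mem_atlas E 1)
    (chartAt E (1 : G)) (chart_mem_atlas E 1) (chartAt E (1 : G)) (chart_mem_atlas E 1) 2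
  have h := (hμ.dirDeriv_bastiani isOpen_mulDomain).hasVelocity_line
    (x := ((chartAt E (1 : G) 1, chartAt E (1 : G) 1), (0, y))) ⟨one_mem_mulDomain, mem_univ _⟩
    ((x, 0), (0, 0))
  simp only [leftField_eq_dirDeriv]
  simp only [Prod.smul_mk, smul_zero, Prod.mk_add_mk, add_zero] at h
  rwa [h.velocity_eq]

/-- With m the orbit map in the chart, the derivative in the right factor is dm(p; Y(p)), where Y is
the left invariant field of y. Differentiating in p splits the result into the second derivative of
m, which is symmetric, and dm applied to dY(x). -/
theorem dirDeriv_dirDeriv_orbitMul {v : H} (hv : v ∈ smoothVectors E π) (x y : E) :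
    dirDeriv (dirDeriv (orbitMul E π v))
        (((chartAt E (1 : G) 1, chartAt E (1 : G) 1), (0, y)), ((x, 0), (0, 0)))
      = dirDeriv (dirDeriv (fun p => (π ((chartAt E (1 : G)).symm p) : H →L[ℂ] H) v))
          ((chartAt E (1 : G) 1, y), (x, 0))
        + dRep ex π (velocity fun s : ℝ =>
            LCLieGroup.leftField E G y (chartAt E (1 : G) 1 + s • x)) v := by
  set e := chartAt E (1 : G) with he
  set m : E → H := fun p => (π (e.symm p) : H →L[ℂ] H) v with hm
  set z := velocity fun s : ℝ => LCLieGroup.leftField E G y (e 1 + s • x) with hz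
  have hm2 : BastianiC 2 m e.target := hv e (chart_mem_atlas E 1) 2
  have hm1 : BastianiC 1 m e.target := hv e (chart_mem_atlas E 1) 1
  have ho : e 1 ∈ e.target := mem_chart_target E (1 : G)
  have hopen : IsOpen (e.target ×ˢ (univ : Set E)) := e.open_target.prod isOpen_univ
  have hvel : HasVelocity (fun s : ℝ => (e 1 + s • x, LCLieGroup.leftField E G y (e 1 + s • x)))
      (x, z) := by
    have h1 : Tendsto (fun s : ℝ => s⁻¹ • (e 1 + s • x - (e 1 + (0 : ℝ) • x))) (𝓝[≠] 0) (𝓝 x) := by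
      refine tendsto_const_nhds.congr' ?_
      filter_upwards [self_mem_nhdsWithin] with t ht
      have ht : t ≠ 0 := ht
      rw [zero_smul, add_zero, add_sub_cancel_left, smul_smul, inv_mul_cancel₀ ht, one_smul]
    exact h1.prodMk_nhds (hasVelocity_leftField x y)
  have hA := BastianiC.hasDerivAt_curve hopen (hm2.dirDeriv_bastiani e.open_target)
    (γ := fun s : ℝ => (e 1 + s • x, LCLieGroup.leftField E G y (e 1 + s • x)))
    (by simpa using ho) hvel
  have hB := (BastianiC.dirDeriv_bastiani isOpen_chart_target_prod
    (bastianiC_orbitMul (E := E) hv 2)).hasVelocity_line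
    (x := ((e 1, e 1), (0, y))) ⟨⟨ho, ho⟩, mem_univ _⟩ ((x, 0), (0, 0))
  simp only [Prod.smul_mk, smul_zero, Prod.mk_add_mk, add_zero] at hB
  rw [hasVelocity_iff_hasDerivAt] at hB
  have hμ := LCLieGroup.smooth_mul (chartAt E (1 : G)) (chart_mem_atlas E 1)
    (chartAt E (1 : G)) (chart_mem_atlas E 1) (chartAt E (1 : G)) (chart_mem_atlas E 1) 1
  have hev : ∀ᶠ s in 𝓝 (0 : ℝ), dirDeriv (orbitMul E π v) ((e 1 + s • x, e 1), (0, y))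
      = dirDeriv m (e 1 + s • x, LCLieGroup.leftField E G y (e 1 + s • x)) := by
    have := BastianiC.eventually_line (isOpen_mulDomain (e₁ := e) (e₂ := e) (e₃ := e))
      (one_mem_mulDomain (E := E) (G := G)) (x, 0)
    filter_upwards [this] with s hs
    simp only [Prod.smul_mk, smul_zero, Prod.mk_add_mk, add_zero] at hs
    have h1 := hμ.hasVelocity_line (x := (e 1 + s • x, e 1)) hs (0, y)
    have h2 := BastianiC.hasDerivAt_curve e.open_target hm1 (γ := fun t : ℝ =>
      e (e.symm ((e 1 + s • x, e 1) + t • ((0 : E), y)).1 *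
        e.symm ((e 1 + s • x, e 1) + t • ((0 : E), y)).2)) (by
          simpa using e.map_source hs.2.2) h1
    rw [leftField_eq_dirDeriv]
    have h3 := BastianiC.hasDerivAt_line (bastianiC_orbitMul (E := E) hv 1)
      (x := (e 1 + s • x, e 1)) (0, y) (s := 0) (by simpa using ⟨hs.1, hs.2.1⟩)
    rw [zero_smul, add_zero] at h3
    refine h3.unique ?_
    have h4 : e 1 + s • x = e 1 + s • x := rfl
    have hb : e (e.symm ((e 1 + s • x, e 1) + (0 : ℝ) • ((0 : E), y)).1 *
        e.symm ((e 1 + s • x, e 1) + (0 : ℝ) • ((0 : E), y)).2) = e 1 + s • x := by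
      simp only [zero_smul, add_zero]
      rw [e.left_inv (mem_chart_source E (1 : G)), mul_one, e.right_inv hs.1]
    simp only [hb] at h2
    refine h2.congr_of_eventuallyEq ?_
    have := BastianiC.eventually_line (isOpen_mulDomain (e₁ := e) (e₂ := e) (e₃ := e))
      (x := (e 1 + s • x, e 1)) hs (0, y)
    filter_upwards [this] with t ht
    simp only [hm, orbitMul]
    rw [e.left_inv ht.2.2]
  have h5 := hB.unique (hA.congr_of_eventuallyEq hev)
  rw [h5]
  simp only [zero_smul, add_zero]
  rw [leftField_one, show ((x, z) : E × E) = (x, 0) + (0, z) by simp,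
    BastianiC.dirDeriv_add hopen (hm2.dirDeriv_bastiani e.open_target) ⟨ho, mem_univ _⟩,
    dRep_eq_dirDeriv hex hv]
  congr 1
  have h6 := (hm2.dirDeriv_bastiani e.open_target).hasVelocity_line
    (x := (e 1, y)) ⟨ho, mem_univ _⟩ (0, z)
  rw [hasVelocity_iff_hasDerivAt] at h6
  refine h6.unique ?_
  have h7 : HasDerivAt (fun t : ℝ => dirDeriv m (e 1, y) + t • dirDeriv m (e 1, z))
      (dirDeriv m (e 1, z)) 0 := by
    simpa using ((hasDerivAt_id (0 : ℝ)).smul_const (dirDeriv m (e 1, z))).const_add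
      (dirDeriv m (e 1, y))
  refine h7.congr_of_eventuallyEq (Eventually.of_forall fun t => ?_)
  simp only [Prod.smul_mk, smul_zero, Prod.mk_add_mk, add_zero]
  rw [BastianiC.dirDeriv_add e.open_target hm1 ho, BastianiC.dirDeriv_smul hm1 ho]

/-- Differentiates the constant ⟨π(p)v, π(p)a⟩, with a = dπ(y)v, in the direction x. By unitarity
only first derivatives of the orbit of v appear in the result, so a need not be known to be a smooth
vector. -/
theorem inner_dirDeriv_dirDeriv_orbitMul {v : H} (hv : v ∈ smoothVectors E π) (x y : E) :
    inner ℂ v (dirDeriv (dirDeriv (orbitMul E π v))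
        (((chartAt E (1 : G) 1, chartAt E (1 : G) 1), (0, y)), ((x, 0), (0, 0))))
      = - inner ℂ (dRep ex π x v) (dRep ex π y v) := by
  set e := chartAt E (1 : G) with he
  have ho : e 1 ∈ e.target := mem_chart_target E (1 : G)
  have hB := (BastianiC.dirDeriv_bastiani isOpen_chart_target_prod
    (bastianiC_orbitMul (E := E) hv 2)).hasVelocity_line
    (x := ((e 1, e 1), (0, y))) ⟨⟨ho, ho⟩, mem_univ _⟩ ((x, 0), (0, 0))
  simp only [Prod.smul_mk, smul_zero, Prod.mk_add_mk, add_zero] at hB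
  rw [hasVelocity_iff_hasDerivAt] at hB
  have hev := BastianiC.eventually_line e.open_target ho x
  set a := dRep ex π y v with ha
  have hB' := hB.congr_of_eventuallyEq (f₁ := fun s : ℝ => (π (e.symm (e 1 + s • x)) : H →L[ℂ] H) a)
    (hev.mono fun s hs => (dirDeriv_orbitMul_right hex hv y hs).symm)
  have hm := (hv e (chart_mem_atlas E 1) 1).hasDerivAt_line (x := e 1) x (s := 0)
    (by simpa using ho)
  rw [zero_smul, add_zero, ← dRep_eq_dirDeriv hex hv] at hm
  have h1 := hm.inner ℂ hB'
  have h2 : HasDerivAt (fun s : ℝ => inner ℂ ((π (e.symm (e 1 + s • x)) : H →L[ℂ] H) v)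
      ((π (e.symm (e 1 + s • x)) : H →L[ℂ] H) a)) 0 0 := by
    simp only [unitary_inner_map]
    exact hasDerivAt_const _ _
  have h3 := h1.unique h2
  rw [zero_smul, add_zero, e.left_inv (mem_chart_source E (1 : G))] at h3
  simp only [map_one, OneMemClass.coe_one, one_apply_eq_self] at h3
  exact eq_neg_of_add_eq_zero_left h3

/-- The difference of the two mixed derivatives loses the symmetric second derivatives and keeps the
bracket of the left invariant fields. This is dπ([x, y]) = [dπ(x), dπ(y)] in weak form. -/
theorem inner_dRep_lieBracket {v : H} (hv : v ∈ smoothVectors E π) (x y : E) :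
    inner ℂ v (dRep ex π (LCLieGroup.lieBracket E G x y) v)
      = inner ℂ (dRep ex π y v) (dRep ex π x v) - inner ℂ (dRep ex π x v) (dRep ex π y v) := by
  have h1 := inner_dirDeriv_dirDeriv_orbitMul hex hv x y
  have h2 := inner_dirDeriv_dirDeriv_orbitMul hex hv y x
  rw [dirDeriv_dirDeriv_orbitMul hex hv, inner_add_right] at h1 h2
  rw [BastianiC.dirDeriv_dirDeriv_symm (chartAt E (1 : G)).open_target
    (hv _ (chart_mem_atlas E 1) 2) (mem_chart_target E 1)] at h2
  rw [LCLieGroup.lieBracket, dRep_sub_left hex hv, inner_sub_right]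
  linear_combination h1 - h2

theorem hasDerivAt_inner_dRep_flow {v : H} (hv : v ∈ smoothVectors E π) (x : E) {y : ℝ → E} {y' : E}
    (hy : HasVelocity y y') :
    HasDerivAt (fun t : ℝ => inner ℂ ((π (ex (t • x)) : H →L[ℂ] H) v)
        (dRep ex π (y t) ((π (ex (t • x)) : H →L[ℂ] H) v)))
      (inner ℂ v (dRep ex π y' v) - inner ℂ v (dRep ex π (LCLieGroup.lieBracket E G x (y 0)) v)) 0 := by
  set V : ℝ → H := fun t => (π (ex (t • x)) : H →L[ℂ] H) v with hV
  have hVs : ∀ t, V t ∈ smoothVectors E π := fun t => rep_mem_smoothVectors hv _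
  have hV0 : V 0 = v := by simp [hV, hex.map_zero]
  have hVd : HasDerivAt V (dRep ex π x v) 0 := hasDerivAt_dRep hex hv x
  have hslope := hVd.tendsto_slope_zero
  simp only [zero_add] at hslope
  have hVc : Tendsto V (𝓝[≠] 0) (𝓝 v) := by
    have := hVd.continuousAt.tendsto.mono_left (nhdsWithin_le_nhds (s := {0}ᶜ))
    rwa [hV0] at this
  have hid : Tendsto (fun t : ℝ => t) (𝓝[≠] 0) (𝓝 0) := tendsto_id.mono_left nhdsWithin_le_nhds
  have hj1 : Tendsto (fun t : ℝ => dRep ex π (y 0) (V t)) (𝓝[≠] 0) (𝓝 (dRep ex π (y 0) v)) := by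
    have := (continuousAt_dRep_flow hex hv x (y 0)).tendsto.comp
      (hid.prodMk_nhds (tendsto_const_nhds (x := y 0)))
    simpa [Function.comp_def, hex.map_zero] using this
  have hj2 : Tendsto (fun t : ℝ => dRep ex π (t⁻¹ • (y t - y 0)) (V t)) (𝓝[≠] 0)
      (𝓝 (dRep ex π y' v)) := by
    have := (continuousAt_dRep_flow hex hv x y').tendsto.comp (hid.prodMk_nhds hy)
    simpa [Function.comp_def, hex.map_zero] using this
  have hlim := ((hslope.inner (𝕜 := ℂ) hj1).sub ((tendsto_const_nhds (x := dRep ex π (y 0) v)).inner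
    (𝕜 := ℂ) hslope)).add (hVc.inner (𝕜 := ℂ) hj2)
  rw [hasDerivAt_iff_tendsto_slope_zero, inner_dRep_lieBracket hex hv]
  simp only [zero_add]
  refine (hlim.congr fun t => ?_).trans (le_of_eq ?_)
  · have e1 : dRep ex π (y t) (V t) = dRep ex π (y t - y 0) (V t) + dRep ex π (y 0) (V t) := by
      rw [← dRep_add_left hex (hVs t), sub_add_cancel]
    -- Skew symmetry trades the increment of dπ(y 0)V, whose derivative is not available, for the
    -- increment of `V`.
    have e2 : inner ℂ (dRep ex π (y 0) (V 0)) (V t - V 0)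
        = - inner ℂ (V 0) (dRep ex π (y 0) (V t) - dRep ex π (y 0) (V 0)) := by
      rw [inner_dRep_left hex (hVs 0) (Submodule.sub_mem _ (hVs t) (hVs 0)),
        dRep_sub_right hex (hVs t) (hVs 0)]
    have e3 : dRep ex π (y 0) v = dRep ex π (y 0) (V 0) := by rw [hV0]
    change _ = t⁻¹ • (inner ℂ (V t) (dRep ex π (y t) (V t)) -
      inner ℂ (V 0) (dRep ex π (y 0) (V 0)))
    rw [dRep_smul_left hex (hVs t), e1, e3, inner_smul_right_eq_smul, inner_smul_left_eq_smul,
      inner_smul_right_eq_smul, ← smul_sub, ← smul_add]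
    congr 1
    rw [e2, inner_add_right, inner_sub_left, inner_sub_right]
    ring
  · congr 1
    ring

/-- The group law reduces every time t to time 0, with v replaced by π(exp tx)v. The hypothesis
compares only expectation values, so y' may differ from the bracket by an element of zero
expectation; this absorbs central terms later. -/
theorem inner_dRep_flow_eq {v : H} (hv : v ∈ smoothVectors E π) (x : E) {y y' : ℝ → E}
    (hy : ∀ t, HasVelocity (fun s => y (t + s)) (y' t))
    (hxy : ∀ w ∈ smoothVectors E π, ∀ t, inner ℂ w (dRep ex π (y' t) w)
      = inner ℂ w (dRep ex π (LCLieGroup.lieBracket E G x (y t)) w)) (t : ℝ) :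
    inner ℂ ((π (ex (t • x)) : H →L[ℂ] H) v) (dRep ex π (y t) ((π (ex (t • x)) : H →L[ℂ] H) v))
      = inner ℂ v (dRep ex π (y 0) v) := by
  set F : ℝ → ℂ := fun t => inner ℂ ((π (ex (t • x)) : H →L[ℂ] H) v)
    (dRep ex π (y t) ((π (ex (t • x)) : H →L[ℂ] H) v)) with hF
  have hd : ∀ t, HasDerivAt F 0 t := by
    intro t
    have hw := rep_mem_smoothVectors hv (ex (t • x))
    have h := hasDerivAt_inner_dRep_flow hex hw x (hy t)
    rw [add_zero, hxy _ hw, sub_self, ← sub_self t] at h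
    refine (h.comp_sub_const t t).congr_of_eventuallyEq (Eventually.of_forall fun s => ?_)
    simp only [hF, ← rep_mul_apply, ← hex.map_add_smul, sub_add_cancel, add_sub_cancel]
  have := is_const_of_deriv_eq_zero (fun t => (hd t).differentiableAt) (fun t => (hd t).deriv) t 0
  simpa [hF, hex.map_zero] using this

end Orbits

/-! ### Spectral bounds and form bounds for symmetric operators -/

section SymmetricOperators

variable {H : Type w} [NormedAddCommGroup H] [InnerProductSpace ℂ H] [CompleteSpace H]
  {A : H →ₗ.[ℂ] H}

/-- Phrased with graphs, because the closure of an operator is accessible through the closure of its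
graph. -/
theorem notMem_unboundedSpectrum_iff {B : H →ₗ.[ℂ] H} {z : ℂ} : z ∉ unboundedSpectrum B ↔
    ∃ R : H →L[ℂ] H, (∀ p ∈ B.graph, R (p.2 - z • p.1) = p.1) ∧
      ∀ y : H, (R y, y + z • R y) ∈ B.graph := by
  simp only [unboundedSpectrum, mem_ofPred_eq, not_not]
  refine exists_congr fun R => and_congr ⟨fun h p hp => ?_, fun h v => h _ (B.mem_graph v)⟩
    (forall_congr' fun y => ⟨?_, ?_⟩)
  · obtain ⟨v, hv1, hv2⟩ := B.mem_graph_iff.1 hp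
    rw [← hv1, ← hv2, h]
  · rintro ⟨v, hv1, hv2⟩
    exact B.mem_graph_iff.2 ⟨v, hv1, by rw [← hv1, ← hv2, sub_add_cancel]⟩
  · intro h
    obtain ⟨v, hv1, hv2⟩ := B.mem_graph_iff.1 h
    simp only at hv1 hv2
    exact ⟨v, hv1, by rw [hv1, hv2, add_sub_cancel_right]⟩

theorem LinearPMap.IsFormalAdjoint.isClosable (hA : A.IsFormalAdjoint A)
    (hd : Dense (A.domain : Set H)) : A.IsClosable :=
  (LinearPMap.adjoint_isClosed hd).isClosable.leIsClosable (hA.le_adjoint hd)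

theorem mem_graph_closure_iff (hA : A.IsFormalAdjoint A) (hd : Dense (A.domain : Set H))
    {p : H × H} : p ∈ A.closure.graph ↔ p ∈ _root_.closure (A.graph : Set (H × H)) := by
  rw [← (hA.isClosable hd).graph_closure_eq_closure_graph]
  rfl

theorem inner_graph_closure (hA : A.IsFormalAdjoint A) (hd : Dense (A.domain : Set H))
    {p q : H × H} (hp : p ∈ A.closure.graph) (hq : q ∈ A.closure.graph) :
    inner ℂ p.2 q.1 = inner ℂ p.1 q.2 := by
  rw [mem_graph_closure_iff hA hd] at hp hq
  have hpq : (p, q) ∈ _root_.closure ((A.graph : Set (H × H)) ×ˢ (A.graph : Set (H × H))) := by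
    rw [closure_prod_eq]; exact ⟨hp, hq⟩
  have hcl : _root_.IsClosed {r : (H × H) × (H × H) | inner ℂ r.1.2 r.2.1 = inner ℂ r.1.1 r.2.2} :=
    isClosed_eq (by fun_prop) (by fun_prop)
  refine closure_minimal ?_ hcl hpq
  rintro ⟨⟨a, b⟩, ⟨c, d⟩⟩ ⟨h1, h2⟩
  obtain ⟨v, rfl, rfl⟩ := A.mem_graph_iff.1 h1
  obtain ⟨w, rfl, rfl⟩ := A.mem_graph_iff.1 h2
  exact hA v w

/-- For real l > M the resolvent R of the closure at l is bounded and symmetric. A spectral point x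
< 0 of −R would correspond to the spectral point l − 1/x > M of the closure, so −R ≥ 0. The form of
−R at (A − l)u gives the bound with l in place of M, and l decreases to M. -/
theorem re_inner_le_of_spectrum_le (hA : A.IsFormalAdjoint A) (hd : Dense (A.domain : Set H))
    {M : ℝ} (hM : ∀ z ∈ unboundedSpectrum A.closure, z.re ≤ M) (u : A.domain) :
    (inner ℂ (u : H) (A u)).re ≤ M * ‖(u : H)‖ ^ 2 := by
  have hres : ∀ z : ℂ, M < z.re → ∃ R : H →L[ℂ] H,
      (∀ p ∈ A.closure.graph, R (p.2 - z • p.1) = p.1) ∧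
      ∀ y : H, (R y, y + z • R y) ∈ A.closure.graph := fun z hz =>
    notMem_unboundedSpectrum_iff.1 fun h => absurd (hM z h) (not_le.2 hz)
  have key : ∀ l : ℝ, M < l → (inner ℂ (u : H) (A u)).re ≤ l * ‖(u : H)‖ ^ 2 := by
    intro l hl
    obtain ⟨R, hR1, hR2⟩ := hres l (by simpa using hl)
    have hsymm : (R : H →ₗ[ℂ] H).IsSymmetric := by
      intro y y'
      have h := inner_graph_closure hA hd (hR2 y) (hR2 y')
      simp only [inner_add_left, inner_add_right, inner_smul_left, inner_smul_right,
        Complex.conj_ofReal] at h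
      exact (add_right_cancel h).symm
    have hsa : IsSelfAdjoint (-R) :=
      (ContinuousLinearMap.isSelfAdjoint_iff_isSymmetric.2 hsymm).neg
    have hspec : ∀ x ∈ spectrum ℝ (-R), 0 ≤ x := by
      intro x hx
      by_contra hneg
      rw [not_le] at hneg
      obtain ⟨Rz, hz1, hz2⟩ := hres ((l - x⁻¹ : ℝ) : ℂ) (by
        rw [Complex.ofReal_re]
        have : x⁻¹ < 0 := inv_lt_zero.2 hneg
        linarith)
      have hx0 : (x : ℂ) ≠ 0 := by exact_mod_cast hneg.ne
      have e1 : ∀ y, R (Rz y) = (x : ℂ) • (R y - Rz y) := by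
        intro y
        have h := hR1 _ (hz2 y)
        have e : y + ((l - x⁻¹ : ℝ) : ℂ) • Rz y - (l : ℂ) • Rz y = y - (x : ℂ)⁻¹ • Rz y := by
          push_cast; module
        simp only [e, map_sub, map_smul] at h
        rw [← sub_eq_zero] at h
        have h2 : R (Rz y) - (x : ℂ) • (R y - Rz y)
            = -((x : ℂ) • (R y - (x : ℂ)⁻¹ • R (Rz y) - Rz y)) := by
          rw [smul_sub, smul_sub, smul_sub, smul_smul, mul_inv_cancel₀ hx0, one_smul]
          abel
        rw [← sub_eq_zero, h2, h, smul_zero, neg_zero]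
      have e2 : ∀ y, Rz (R y) = (x : ℂ) • (R y - Rz y) := by
        intro y
        have h := hz1 _ (hR2 y)
        have e : y + (l : ℂ) • R y - ((l - x⁻¹ : ℝ) : ℂ) • R y = y + (x : ℂ)⁻¹ • R y := by
          push_cast; module
        simp only [e, map_add, map_smul] at h
        rw [← sub_eq_zero] at h
        have h2 : Rz (R y) - (x : ℂ) • (R y - Rz y)
            = (x : ℂ) • (Rz y + (x : ℂ)⁻¹ • Rz (R y) - R y) := by
          rw [smul_sub, smul_sub, smul_add, smul_smul, mul_inv_cancel₀ hx0, one_smul]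
          abel
        rw [← sub_eq_zero, h2, h, smul_zero]
      refine hx ?_
      -- From x + R = x(A − z)(A − l)⁻¹ with z = l − x⁻¹ one reads off the inverse x⁻¹(A − l)(A −
      -- z)⁻¹ = x⁻¹(1 − x⁻¹ Rz).
      set S : H →L[ℂ] H := (x : ℂ)⁻¹ • (1 - (x : ℂ)⁻¹ • Rz) with hS
      have hSy : ∀ y, S y = (x : ℂ)⁻¹ • (y - (x : ℂ)⁻¹ • Rz y) := fun _ => rfl
      have hT : ∀ y, (algebraMap ℝ (H →L[ℂ] H) x - -R) y = (x : ℂ) • y + R y := by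
        intro y
        rw [sub_neg_eq_add, Algebra.algebraMap_eq_smul_one, Complex.coe_smul]
        rfl
      refine isUnit_iff_exists.2 ⟨S, ?_, ?_⟩
      · ext y
        change (algebraMap ℝ (H →L[ℂ] H) x - -R) (S y) = y
        rw [hT, hSy]
        simp only [map_sub, map_smul, e1, smul_sub, smul_smul, mul_inv_cancel₀ hx0, one_smul]
        rw [show (x : ℂ)⁻¹ * (x : ℂ)⁻¹ * x = (x : ℂ)⁻¹ by field_simp,
          show (x : ℂ) * ((x : ℂ)⁻¹ * (x : ℂ)⁻¹) = (x : ℂ)⁻¹ by field_simp]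
        abel
      · ext y
        change S ((algebraMap ℝ (H →L[ℂ] H) x - -R) y) = y
        rw [hT, hSy]
        simp only [map_add, map_smul, e2, smul_sub, smul_add, smul_smul, inv_mul_cancel₀ hx0,
          one_smul]
        abel
    have hpos : 0 ≤ -R := (StarOrderedRing.nonneg_iff_spectrum_nonneg (R := ℝ) _ hsa).2 hspec
    rw [ContinuousLinearMap.nonneg_iff_isPositive] at hpos
    have h := hpos.re_inner_nonneg_right (A u - (l : ℂ) • (u : H))
    have hRu := hR1 _ ((LinearPMap.le_graph_of_le A.le_closure) (A.mem_graph u))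
    simp only at hRu
    rw [neg_apply, hRu, inner_neg_right, inner_sub_left, inner_smul_left, Complex.conj_ofReal,
      hA u u] at h
    have h3 : inner ℂ (u : H) (u : H) = ((‖(u : H)‖ ^ 2 : ℝ) : ℂ) := by
      rw [inner_self_eq_norm_sq_to_K]; norm_cast
    rw [h3] at h
    simp only [RCLike.re_to_complex, Complex.neg_re, Complex.sub_re, ← Complex.ofReal_mul,
      Complex.ofReal_re] at h
    linarith
  refine le_of_forall_pos_lt_add fun ε hε => ?_
  have hpos : 0 < ‖(u : H)‖ ^ 2 + 1 := by positivity
  have h := key (M + ε / (‖(u : H)‖ ^ 2 + 1)) (by linarith [div_pos hε hpos])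
  have h2 : ε / (‖(u : H)‖ ^ 2 + 1) * ‖(u : H)‖ ^ 2 < ε := by
    rw [div_mul_eq_mul_div, div_lt_iff₀ hpos]
    nlinarith
  linarith [add_mul M (ε / (‖(u : H)‖ ^ 2 + 1)) (‖(u : H)‖ ^ 2)]

theorem norm_sub_smul_ge {M : ℝ} (hM : ∀ u : A.domain, (inner ℂ (u : H) (A u)).re ≤ M * ‖(u : H)‖ ^ 2)
    (z : ℂ) (u : A.domain) : (z.re - M) * ‖(u : H)‖ ≤ ‖A u - z • (u : H)‖ := by
  by_cases hu : (u : H) = 0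
  · simp [hu]
  have hu' : 0 < ‖(u : H)‖ := norm_pos_iff.2 hu
  have h1 : -(inner ℂ (u : H) (A u - z • (u : H))).re ≤ ‖(u : H)‖ * ‖A u - z • (u : H)‖ :=
    (neg_le_abs _).trans ((Complex.abs_re_le_norm _).trans (norm_inner_le_norm _ _))
  have h3 : inner ℂ (u : H) (u : H) = ((‖(u : H)‖ ^ 2 : ℝ) : ℂ) := by
    rw [inner_self_eq_norm_sq_to_K]; norm_cast
  rw [inner_sub_right, inner_smul_right, h3, Complex.sub_re, Complex.re_mul_ofReal] at h1
  have h2 := hM u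
  refine le_of_mul_le_mul_left ?_ hu'
  nlinarith

/-- The form bound makes A − z bounded below for Re z > M, so the closure of A − z is injective with
closed range and only density of the range is left. For nonreal z this is the hypothesis on the
deficiency spaces. -/
theorem spectrum_le_of_re_inner_le (hA : A.IsFormalAdjoint A) (hd : Dense (A.domain : Set H))
    (hdef : ∀ z : ℂ, z.im ≠ 0 → ∀ w : H, (∀ u : A.domain, inner ℂ w (A u - z • (u : H)) = 0) → w = 0)
    {M : ℝ} (hM : ∀ u : A.domain, (inner ℂ (u : H) (A u)).re ≤ M * ‖(u : H)‖ ^ 2)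
    {z : ℂ} (hz : z ∈ unboundedSpectrum A.closure) : z.re ≤ M := by
  by_contra hzM
  rw [not_le] at hzM
  revert hz
  have hc : 0 < z.re - M := sub_pos.2 hzM
  let shift : ℂ → A.domain →ₗ[ℂ] H := fun z => A.toFun - z • A.domain.subtype
  have hshift : ∀ z u, shift z u = A u - z • (u : H) := fun z u => rfl
  have hdense : ∀ z : ℂ, (∀ w : H, (∀ u : A.domain, inner ℂ w (A u - z • (u : H)) = 0) → w = 0) →
      Dense (range (shift z)) := by
    intro z h
    have : (LinearMap.range (shift z)).topologicalClosure = ⊤ := by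
      rw [Submodule.topologicalClosure_eq_top_iff, Submodule.eq_bot_iff]
      intro w hw
      refine h w fun u => ?_
      rw [Submodule.mem_orthogonal'] at hw
      exact hw _ ⟨u, rfl⟩
    have h2 := (Submodule.dense_iff_topologicalClosure_eq_top.2 this)
    exact h2
  have hdefz : ∀ w : H, (∀ u : A.domain, inner ℂ w (A u - z • (u : H)) = 0) → w = 0 := by
    -- A real z is moved to z' = z + εi, where the range is dense. If w is orthogonal to the range
    -- at z, then |⟨w, (A − z')u⟩| = ε|⟨w, u⟩|, and ‖u‖ is controlled by ‖(A − z')u‖. The choice ε =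
    -- (Re z − M)/2 gives ‖w‖² ≤ ‖w‖²/2.
    by_cases him : z.im = 0
    · intro w hw
      have hbound : ∀ ε : ℝ, 0 < ε → ‖w‖ ^ 2 ≤ ε / (z.re - M) * ‖w‖ ^ 2 := by
        intro ε hε
        set z' : ℂ := z + ε * Complex.I with hz'
        have hz're : z'.re = z.re := by simp [hz']
        have hz'im : z'.im ≠ 0 := by simp [hz', him, hε.ne']
        have hdz := hdense z' (hdef z' hz'im)
        have hall : ∀ y : H, ‖inner ℂ w y‖ ≤ ε / (z.re - M) * ‖w‖ * ‖y‖ := by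
          intro y
          refine hdz.induction (P := fun y => ‖inner ℂ w y‖ ≤ ε / (z.re - M) * ‖w‖ * ‖y‖) ?_
            (isClosed_le (by fun_prop) (by fun_prop)) y
          rintro _ ⟨u, rfl⟩
          rw [hshift]
          have e : A u - z' • (u : H) = (A u - z • (u : H)) - (ε * Complex.I) • (u : H) := by
            rw [hz']; module
          have h1 := norm_sub_smul_ge hM z' u
          rw [hz're] at h1
          have h2 : ‖inner ℂ w (A u - z' • (u : H))‖ ≤ ε * (‖w‖ * ‖(u : H)‖) := by
            rw [e, inner_sub_right, hw u, zero_sub, norm_neg, inner_smul_right, norm_mul, norm_mul,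
              Complex.norm_I, Complex.norm_real, Real.norm_of_nonneg hε.le, mul_one]
            gcongr
            exact norm_inner_le_norm _ _
          refine h2.trans ?_
          calc ε * (‖w‖ * ‖(u : H)‖) = ε / (z.re - M) * ‖w‖ * ((z.re - M) * ‖(u : H)‖) := by
                field_simp
            _ ≤ _ := by gcongr
        have h := hall w
        rw [inner_self_eq_norm_sq_to_K, norm_pow, RCLike.norm_ofReal, abs_norm] at h
        calc ‖w‖ ^ 2 ≤ _ := h
          _ = _ := by ring
      have h := hbound ((z.re - M) / 2) (by positivity)
      rw [div_div, mul_comm (2 : ℝ), ← div_div, div_self hc.ne'] at h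
      have : ‖w‖ ^ 2 ≤ 0 := by linarith
      have h0 : ‖w‖ = 0 := by
        have := le_antisymm this (by positivity)
        exact pow_eq_zero_iff (two_ne_zero) |>.1 this
      exact norm_eq_zero.1 h0
    · exact hdef z him
  have hlow : ∀ p ∈ A.closure.graph, (z.re - M) * ‖p.1‖ ≤ ‖p.2 - z • p.1‖ := by
    intro p hp
    rw [mem_graph_closure_iff hA hd] at hp
    have hcl : _root_.IsClosed {p : H × H | (z.re - M) * ‖p.1‖ ≤ ‖p.2 - z • p.1‖} :=
      isClosed_le (by fun_prop) (by fun_prop)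
    refine closure_minimal ?_ hcl hp
    rintro ⟨a, b⟩ hab
    obtain ⟨v, rfl, rfl⟩ := A.mem_graph_iff.1 hab
    exact norm_sub_smul_ge hM z v
  have hsurj : ∀ y : H, ∃ p ∈ A.closure.graph, p.2 - z • p.1 = y := by
    intro y
    obtain ⟨s, hs, hsy⟩ := mem_closure_iff_seq_limit.1 (hdense z hdefz y)
    choose a ha using hs
    have hcau : CauchySeq fun n => (a n : H) := by
      have hs' : CauchySeq s := hsy.cauchySeq
      rw [Metric.cauchySeq_iff] at hs' ⊢
      intro ε hε
      obtain ⟨N, hN⟩ := hs' ((z.re - M) * ε) (by positivity)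
      refine ⟨N, fun m hm n hn => ?_⟩
      have h1 := hN m hm n hn
      have h2 := norm_sub_smul_ge hM z (a m - a n)
      rw [← hshift, map_sub, ha, ha, ← dist_eq_norm] at h2
      rw [dist_eq_norm]
      exact lt_of_mul_lt_mul_left (h2.trans_lt h1) hc.le
    obtain ⟨u, hu⟩ := cauchySeq_tendsto_of_complete hcau
    have hAu : Tendsto (fun n => A (a n)) atTop (𝓝 (y + z • u)) := by
      refine (hsy.add (hu.const_smul z)).congr fun n => ?_
      rw [← ha n, hshift, sub_add_cancel]
    refine ⟨(u, y + z • u), ?_, by simp⟩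
    rw [mem_graph_closure_iff hA hd]
    refine mem_closure_of_tendsto (hu.prodMk_nhds hAu) (Eventually.of_forall fun n => ?_)
    exact A.mem_graph (a n)
  choose P hP1 hP2 using hsurj
  have huniq : ∀ p ∈ A.closure.graph, ∀ q ∈ A.closure.graph,
      p.2 - z • p.1 = q.2 - z • q.1 → p.1 = q.1 := by
    intro p hp q hq hpq
    have h := hlow _ (A.closure.graph.sub_mem hp hq)
    have e : (p - q).2 - z • (p - q).1 = (p.2 - z • p.1) - (q.2 - z • q.1) := by
      simp only [Prod.fst_sub, Prod.snd_sub]; module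
    rw [e, hpq, sub_self, norm_zero] at h
    have h0 : ‖(p - q).1‖ ≤ 0 := by
      by_contra hcon
      rw [not_le] at hcon
      linarith [mul_pos hc hcon]
    exact sub_eq_zero.1 (norm_le_zero_iff.1 h0)
  let R : H →ₗ[ℂ] H :=
    { toFun := fun y => (P y).1
      map_add' := fun y y' => by
        refine huniq _ (hP1 _) (P y + P y') (A.closure.graph.add_mem (hP1 _) (hP1 _)) ?_
        rw [hP2, Prod.fst_add, Prod.snd_add, smul_add, add_sub_add_comm, hP2, hP2]
      map_smul' := fun c y => by
        refine huniq _ (hP1 _) (c • P y) (A.closure.graph.smul_mem c (hP1 _)) ?_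
        rw [hP2, Prod.smul_fst, Prod.smul_snd, smul_comm, ← smul_sub, hP2] }
  refine notMem_unboundedSpectrum_iff.2 ⟨R.mkContinuous (z.re - M)⁻¹ fun y => ?_, ?_, ?_⟩
  · rw [inv_mul_eq_div, le_div_iff₀' hc]
    have := hlow _ (hP1 y)
    rwa [hP2] at this
  · intro p hp
    exact huniq _ (hP1 _) p hp (hP2 _)
  · intro y
    have h := hP1 y
    have e : P y = ((P y).1, y + z • (P y).1) := Prod.ext rfl (by
      simp only
      rw [← sub_eq_iff_eq_add, hP2])
    rw [e] at h
    exact h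

end SymmetricOperators

/-! ### The function s_π in terms of momenta -/

section SpectralBound

variable {E : Type u} [AddCommGroup E] [Module ℝ E] [TopologicalSpace E]
    [IsTopologicalAddGroup E] [ContinuousSMul ℝ E] [LocallyConvexSpace ℝ E] [T2Space E]
    {G : Type v} [Group G] [TopologicalSpace G] [ChartedSpace E G] [LCLieGroup E G]
    {H : Type w} [NormedAddCommGroup H] [InnerProductSpace ℂ H] [CompleteSpace H]
    {π : G →* unitary (H →L[ℂ] H)} {ex : E → G}

/-- The value `⟨i dπ(x) v, v⟩` of the momentum functional of `v`. -/
noncomputable def momentum (ex : E → G) (π : G →* unitary (H →L[ℂ] H)) (v : H) (x : E) : ℝ :=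
  (inner ℂ v (Complex.I • dRep ex π x v)).re

variable (hex : LCLieGroup.IsExp ex)

theorem derivedRep_isFormalAdjoint (x : E) :
    (Complex.I • derivedRep hex π x).IsFormalAdjoint (Complex.I • derivedRep hex π x) := by
  intro u v
  have h := inner_dRep_left hex (π := π) u.2 v.2 x
  change inner ℂ (Complex.I • dRep ex π x (u : H)) (v : H)
    = inner ℂ (u : H) (Complex.I • dRep ex π x (v : H))
  rw [inner_smul_left, inner_smul_right, h, Complex.conj_I]
  ring

/-- If w is orthogonal to the range of i dπ(x) − z, then ⟨w, π(exp tx)u⟩ e^{izt} is constant in t,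
because the smooth vectors are invariant under the group. The first factor is bounded and |e^{izt}|
= e^{−t Im z} tends to 0 in one direction of t, so the constant ⟨w, u⟩ is 0. -/
theorem derivedRep_deficiency (hπ : IsSmoothRep E π) (x : E) {z : ℂ} (hz : z.im ≠ 0) (w : H)
    (hw : ∀ u : (Complex.I • derivedRep hex π x).domain,
      inner ℂ w ((Complex.I • derivedRep hex π x) u - z • (u : H)) = 0) : w = 0 := by
  have hw' : ∀ u ∈ smoothVectors E π, inner ℂ w (dRep ex π x u) = -Complex.I * z * inner ℂ w u := by
    intro u hu
    have h : inner ℂ w (Complex.I • dRep ex π x u - z • u) = 0 := hw ⟨u, hu⟩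
    rw [inner_sub_right, inner_smul_right, inner_smul_right] at h
    linear_combination (-Complex.I) * h + inner ℂ w (dRep ex π x u) * Complex.I_mul_I
  have horth : ∀ u ∈ smoothVectors E π, inner ℂ w u = 0 := by
    intro u hu
    set F : ℝ → ℂ := fun t => inner ℂ w ((π (ex (t • x)) : H →L[ℂ] H) u) *
      Complex.exp (Complex.I * z * t) with hF
    have hd : ∀ t, HasDerivAt F 0 t := by
      intro t
      have h1 := (hasDerivAt_const t w).inner ℂ (hasDerivAt_dRep_flow hex hu x t)
      have h2 : HasDerivAt (fun t : ℝ => Complex.exp (Complex.I * z * t))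
          (Complex.exp (Complex.I * z * t) * (Complex.I * z)) t := by
        have h3 : HasDerivAt (fun t : ℝ => Complex.I * z * (t : ℂ)) (Complex.I * z) t := by
          simpa using (Complex.ofRealCLM.hasDerivAt (x := t)).const_mul (Complex.I * z)
        exact h3.cexp
      refine (h1.mul h2).congr_deriv ?_
      rw [hw' _ (rep_mem_smoothVectors hu _), inner_zero_left]
      ring
    have hconst : ∀ t, F t = inner ℂ w u := by
      intro t
      have := is_const_of_deriv_eq_zero (fun t => (hd t).differentiableAt)
        (fun t => (hd t).deriv) t 0
      rw [this]
      simp [hF, hex.map_zero]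
    have hb : ∀ t : ℝ, ‖(inner ℂ w u : ℂ)‖ ≤ ‖w‖ * ‖u‖ * Real.exp (-(z.im * t)) := by
      intro t
      rw [← hconst t, hF]
      simp only [norm_mul, Complex.norm_exp]
      have e : (Complex.I * z * t).re = -(z.im * t) := by simp
      rw [e]
      gcongr
      refine (norm_inner_le_norm _ _).trans ?_
      rw [unitary_norm_map]
    have hlim : Tendsto (fun s : ℝ => ‖w‖ * ‖u‖ * Real.exp (-s)) atTop (𝓝 (‖w‖ * ‖u‖ * 0)) :=
      (Real.tendsto_exp_neg_atTop_nhds_zero).const_mul _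
    have h0 : ‖(inner ℂ w u : ℂ)‖ ≤ ‖w‖ * ‖u‖ * 0 := by
      refine ge_of_tendsto' hlim fun s => ?_
      have := hb (s / z.im)
      rwa [mul_div_cancel₀ _ hz] at this
    rw [mul_zero] at h0
    exact norm_le_zero_iff.1 h0
  have hall : ∀ u : H, inner ℂ w u = 0 := fun u =>
    hπ.induction (P := fun u => inner ℂ w u = 0) horth (isClosed_eq (by fun_prop) (by fun_prop)) u
  exact inner_self_eq_zero.1 (hall w)

theorem supSpec_le_iff (hπ : IsSmoothRep E π) (x : E) (M : ℝ) :
    supSpec hex π x ≤ (M : EReal) ↔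
      ∀ v ∈ smoothVectors E π, momentum ex π v x ≤ M * ‖v‖ ^ 2 := by
  have hd : Dense ((Complex.I • derivedRep hex π x).domain : Set H) := hπ
  have hA := derivedRep_isFormalAdjoint (π := π) hex x
  constructor
  · intro h v hv
    refine re_inner_le_of_spectrum_le hA hd (fun z hz => ?_) ⟨v, hv⟩
    exact_mod_cast (le_sSup (mem_image_of_mem _ hz)).trans h
  · intro h
    refine sSup_le ?_
    rintro _ ⟨z, hz, rfl⟩
    exact EReal.coe_le_coe_iff.2 <| spectrum_le_of_re_inner_le hA hd
      (fun z hz w hw => derivedRep_deficiency hex hπ x hz w hw) (fun u => h u u.2) hz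

end SpectralBound

/-! ### The isometric automorphisms exp(ad x) -/

namespace HilbertLieAlgebra

variable {k : Type u} [HilbertLieAlgebra k]

theorem adL_mem_skewAdjoint (x : k) : adL x ∈ skewAdjoint (k →L[ℝ] k) := by
  rw [skewAdjoint.mem_iff, ContinuousLinearMap.star_eq_adjoint]
  symm
  rw [ContinuousLinearMap.eq_adjoint_iff]
  intro y z
  simpa using inner_lie_left y x z

/-- The automorphism `exp (ad x)` of a Hilbert–Lie algebra. -/
noncomputable def expAd (x : k) : k →L[ℝ] k := NormedSpace.exp (adL x)

theorem expAd_mem_unitary (x : k) : expAd x ∈ unitary (k →L[ℝ] k) := by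
  let _ : NormedAlgebra ℚ (k →L[ℝ] k) := .restrictScalars ℚ ℝ _
  exact NormedSpace.exp_mem_unitary_of_mem_skewAdjoint (adL_mem_skewAdjoint x)

@[simp] theorem norm_expAd (x v : k) : ‖expAd x v‖ = ‖v‖ :=
  ContinuousLinearMap.norm_map_of_mem_unitary (expAd_mem_unitary x) v

@[simp] theorem inner_expAd (x v w : k) : inner ℝ (expAd x v) (expAd x w) = inner ℝ v w :=
  ContinuousLinearMap.inner_map_map_of_mem_unitary (expAd_mem_unitary x) v w

@[simp] theorem expAd_zero : expAd (0 : k) = 1 := by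
  have : adL (0 : k) = 0 := by ext; simp
  rw [expAd, this, NormedSpace.exp_zero]

theorem adL_neg (x : k) : adL (-x) = -adL x := by ext; simp

theorem adL_smul (c : ℝ) (x : k) : adL (c • x) = c • adL x := by ext; simp

@[simp] theorem expAd_neg_expAd (x v : k) : expAd (-x) (expAd x v) = v := by
  let _ : NormedAlgebra ℚ (k →L[ℝ] k) := .restrictScalars ℚ ℝ _
  have h : expAd (-x) * expAd x = 1 := by
    rw [expAd, expAd, adL_neg, ← NormedSpace.exp_add_of_commute (Commute.refl (adL x)).neg_left,
      neg_add_cancel, NormedSpace.exp_zero]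
  exact congrArg (fun A : k →L[ℝ] k => A v) h

/-- Used with powers of `φ` as `S`: intertwining passes from the operators `ad` to their
exponentials. -/
theorem map_expAd (S : k →L[ℝ] k) {x y : k} (h : ∀ v, S ⁅x, v⁆ = ⁅y, S v⁆) (v : k) :
    S (expAd x v) = expAd y (S v) := by
  let _ : NormedAlgebra ℚ (k →L[ℝ] k) := .restrictScalars ℚ ℝ _
  have h1 : SemiconjBy S (adL x) (adL y) := by ext v; exact h v
  exact congrArg (fun A : k →L[ℝ] k => A v) h1.exp_right

theorem contDiff_adL {F : Type*} [NormedAddCommGroup F] [NormedSpace ℝ F] {f : F → k}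
    (hf : ContDiff ℝ ∞ f) : ContDiff ℝ ∞ fun t => adL (f t) :=
  (lieL k).contDiff.comp hf

theorem contDiff_expAd {F : Type*} [NormedAddCommGroup F] [NormedSpace ℝ F] {f : F → k}
    (hf : ContDiff ℝ ∞ f) : ContDiff ℝ ∞ fun t => expAd (f t) := by
  have h : ContDiff ℝ ∞ (NormedSpace.exp : (k →L[ℝ] k) → (k →L[ℝ] k)) :=
    contDiff_iff_contDiffAt.2 fun x => (NormedSpace.exp_analytic (𝕂 := ℝ) x).contDiffAt
  exact h.comp (contDiff_adL hf)

theorem hasDerivAt_expAd_smul (x v : k) (t : ℝ) :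
    HasDerivAt (fun t : ℝ => expAd (t • x) v) ⁅x, expAd (t • x) v⁆ t := by
  have h := hasDerivAt_exp_smul_const' (𝕂 := ℝ) (adL x) t
  have h2 := h.clm_apply (hasDerivAt_const t v)
  simp only [map_zero, add_zero] at h2
  simp only [expAd, adL_smul]
  exact h2

theorem lie_eq_zero_of_expAd_smul_eq {x z : k} (h : ∀ s : ℝ, expAd (s • x) z = z) : ⁅x, z⁆ = 0 := by
  have h1 := hasDerivAt_expAd_smul x z 0
  simp only [h] at h1
  exact h1.unique (hasDerivAt_const _ _)

end HilbertLieAlgebra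

/-! ### Smooth families of loops and their velocities -/

/-- The partial derivative in the first variable. -/
noncomputable def partialFst {F : Type*} [NormedAddCommGroup F] [NormedSpace ℝ F]
    (K : ℝ × ℝ → F) (p : ℝ × ℝ) : F := fderiv ℝ K p (1, 0)

/-- The partial derivative in the second variable. -/
noncomputable def partialSnd {F : Type*} [NormedAddCommGroup F] [NormedSpace ℝ F]
    (K : ℝ × ℝ → F) (p : ℝ × ℝ) : F := fderiv ℝ K p (0, 1)

section Partial

variable {F : Type*} [NormedAddCommGroup F] [NormedSpace ℝ F] {K : ℝ × ℝ → F}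

theorem contDiff_partialFst (hK : ContDiff ℝ ∞ K) : ContDiff ℝ ∞ (partialFst K) :=
  (hK.fderiv_right (by simp)).clm_apply contDiff_const

theorem contDiff_partialSnd (hK : ContDiff ℝ ∞ K) : ContDiff ℝ ∞ (partialSnd K) :=
  (hK.fderiv_right (by simp)).clm_apply contDiff_const

theorem hasDerivAt_partialFst (hK : ContDiff ℝ ∞ K) (s t : ℝ) :
    HasDerivAt (fun s => K (s, t)) (partialFst K (s, t)) s := by
  have h := (hK.differentiable (by simp) (s, t)).hasFDerivAt
  exact h.comp_hasDerivAt s ((hasDerivAt_id s).prodMk (hasDerivAt_const s t))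

theorem hasDerivAt_partialSnd (hK : ContDiff ℝ ∞ K) (s t : ℝ) :
    HasDerivAt (fun t => K (s, t)) (partialSnd K (s, t)) t := by
  have h := (hK.differentiable (by simp) (s, t)).hasFDerivAt
  exact h.comp_hasDerivAt t ((hasDerivAt_const t s).prodMk (hasDerivAt_id t))

theorem partialFst_partialSnd (hK : ContDiff ℝ ∞ K) :
    partialFst (partialSnd K) = partialSnd (partialFst K) := by
  have hd : Differentiable ℝ (fderiv ℝ K) :=
    (hK.fderiv_right (m := ∞) (by simp)).differentiable (by simp)
  have e : ∀ (v w : ℝ × ℝ) p, fderiv ℝ (fun q => fderiv ℝ K q v) p w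
      = fderiv ℝ (fderiv ℝ K) p w v := by
    intro v w p
    have := (hd p).hasFDerivAt.clm_apply (hasFDerivAt_const v p)
    rw [this.fderiv]
    simp
  funext p
  have hs : IsSymmSndFDerivAt ℝ K p := hK.contDiffAt.isSymmSndFDerivAt (by
    rw [minSmoothness_of_isRCLikeNormedField]; exact WithTop.coe_le_coe.2 le_top)
  change fderiv ℝ (fun q => fderiv ℝ K q (0, 1)) p (1, 0)
    = fderiv ℝ (fun q => fderiv ℝ K q (1, 0)) p (0, 1)
  rw [e, e]
  exact hs (1, 0) (0, 1)

theorem contDiff_partialSnd_iterate (hK : ContDiff ℝ ∞ K) (n : ℕ) :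
    ContDiff ℝ ∞ (partialSnd^[n] K) := by
  induction n with
  | zero => exact hK
  | succ n ih => rw [Function.iterate_succ_apply']; exact contDiff_partialSnd ih

theorem iteratedDeriv_snd (hK : ContDiff ℝ ∞ K) (n : ℕ) (s : ℝ) :
    iteratedDeriv n (fun t => K (s, t)) = fun t => partialSnd^[n] K (s, t) := by
  induction n with
  | zero => simp
  | succ n ih =>
    rw [iteratedDeriv_succ, ih]
    funext t
    rw [Function.iterate_succ_apply']
    exact (hasDerivAt_partialSnd (contDiff_partialSnd_iterate hK n) s t).deriv

theorem partialSnd_iterate_partialFst (hK : ContDiff ℝ ∞ K) (n : ℕ) :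
    partialSnd^[n] (partialFst K) = partialFst (partialSnd^[n] K) := by
  induction n with
  | zero => rfl
  | succ n ih =>
    rw [Function.iterate_succ_apply', Function.iterate_succ_apply', ih,
      partialFst_partialSnd (contDiff_partialSnd_iterate hK n)]

end Partial

namespace TwistedLoop

open HilbertLieAlgebra

variable {k : Type u} [HilbertLieAlgebra k] {T : FiniteOrderAut k}

/-- A smooth family of loops has a velocity in the Fréchet topology. -/
theorem hasVelocity_of_contDiff {ζ : ℝ → TwistedLoop T} {ζ' : TwistedLoop T} {K : ℝ × ℝ → k}
    (hK : ContDiff ℝ ∞ K) (hζ : ∀ s t, ζ s t = K (s, t)) (hζ' : ∀ t, ζ' t = partialFst K (0, t)) :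
    HasVelocity ζ ζ' := by
  have hind : IsInducing (jet T) := ⟨rfl⟩
  rw [HasVelocity, hind.tendsto_nhds_iff, tendsto_pi_nhds]
  intro n
  rw [ContinuousMap.tendsto_iff_tendstoLocallyUniformly, Metric.tendstoLocallyUniformly_iff]
  intro ε hε t₀
  set Kn := partialSnd^[n] K with hKn
  have hKns : ContDiff ℝ ∞ Kn := contDiff_partialSnd_iterate hK n
  have hval : ∀ s t, jet T (ζ s) n t = Kn (s, t) := by
    intro s t
    have : (ζ s).toFun = fun t => K (s, t) := funext (hζ s)
    change iteratedDeriv n (ζ s).toFun t = _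
    rw [this, iteratedDeriv_snd hK]
  have hval' : ∀ t, jet T ζ' n t = partialFst Kn (0, t) := by
    intro t
    have : ζ'.toFun = fun t => partialFst K (0, t) := funext hζ'
    change iteratedDeriv n ζ'.toFun t = _
    rw [this, iteratedDeriv_snd (contDiff_partialFst hK), partialSnd_iterate_partialFst hK]
  -- Strict differentiability at (0, t₀) compares (s, t) with (0, t) under one error bound for all t
  -- near t₀, which is the locally uniform convergence required.
  have hstrict : HasStrictFDerivAt Kn (fderiv ℝ Kn (0, t₀)) (0, t₀) :=
    hKns.contDiffAt.hasStrictFDerivAt (by simp)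
  have h1 := hstrict.isLittleO.def (half_pos hε)
  have hmap : Tendsto (fun p : ℝ × ℝ => (p, ((0 : ℝ), p.2))) (𝓝 (0, t₀)) (𝓝 ((0, t₀), (0, t₀))) := by
    have : Continuous (fun p : ℝ × ℝ => (p, ((0 : ℝ), p.2))) := by fun_prop
    simpa using this.tendsto (0, t₀)
  have h2 := hmap.eventually h1
  have h3 : ∀ᶠ t in 𝓝 t₀, dist (partialFst Kn (0, t)) (partialFst Kn (0, t₀)) < ε / 2 := by
    have : Continuous fun t => partialFst Kn (0, t) :=
      (contDiff_partialFst hKns).continuous.comp (by fun_prop)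
    exact this.continuousAt.eventually (Metric.ball_mem_nhds _ (half_pos hε))
  rw [nhds_prod_eq, eventually_prod_iff] at h2
  obtain ⟨pa, hpa, pb, hpb, hab⟩ := h2
  refine ⟨{t | pb t ∧ dist (partialFst Kn (0, t)) (partialFst Kn (0, t₀)) < ε / 2}, hpb.and h3, ?_⟩
  filter_upwards [hpa.filter_mono nhdsWithin_le_nhds, self_mem_nhdsWithin] with s hs hs0 t ht
  have hs0 : s ≠ 0 := hs0
  have h4 := hab hs ht.1
  have e : jet T (s⁻¹ • (ζ s - ζ 0)) n t = s⁻¹ • (Kn (s, t) - Kn (0, t)) := by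
    rw [map_smul, map_sub, ← hval, ← hval]; rfl
  change dist (jet T ζ' n t) (jet T (s⁻¹ • (ζ s - ζ 0)) n t) < ε
  rw [e, hval']
  have e2 : fderiv ℝ Kn (0, t₀) ((s, t) - (0, t)) = s • partialFst Kn (0, t₀) := by
    rw [partialFst, ← map_smul]; simp
  rw [e2] at h4
  have hspos : 0 < ‖s‖ := norm_pos_iff.2 hs0
  have h5 : ‖((s, t) : ℝ × ℝ) - (0, t)‖ = ‖s‖ := by simp [Prod.norm_def]
  rw [h5] at h4
  have h6 : dist (partialFst Kn (0, t₀)) (s⁻¹ • (Kn (s, t) - Kn (0, t))) ≤ ε / 2 := by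
    rw [dist_comm, dist_eq_norm]
    have : s⁻¹ • (Kn (s, t) - Kn (0, t)) - partialFst Kn (0, t₀)
        = s⁻¹ • (Kn (s, t) - Kn (0, t) - s • partialFst Kn (0, t₀)) := by
      rw [smul_sub _ _ (s • _), smul_smul, inv_mul_cancel₀ hs0, one_smul]
    rw [this, norm_smul, norm_inv, inv_mul_le_iff₀ hspos, mul_comm]
    exact h4
  have h7 : dist (partialFst Kn (0, t)) (partialFst Kn (0, t₀)) < ε / 2 := ht.2
  calc _ ≤ _ := dist_triangle _ (partialFst Kn (0, t₀)) _
    _ < ε / 2 + ε / 2 := add_lt_add_of_lt_of_le h7 h6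
    _ = ε := add_halves ε

end TwistedLoop

/-! ### The operators e^{ad η} on twisted loops -/

namespace FiniteOrderAut

open HilbertLieAlgebra

variable {k : Type u} [HilbertLieAlgebra k] (T : FiniteOrderAut k)

/-- The automorphism as a linear isometry. -/
noncomputable def isom : k ≃ₗᵢ[ℝ] k :=
  T.φ.toLinearEquiv.isometryOfInner T.isometry

theorem isom_zpow_lie (n : ℤ) (x y : k) : (T.isom ^ n) ⁅x, y⁆ = ⁅(T.isom ^ n) x, (T.isom ^ n) y⁆ := by
  induction n with
  | zero => simp
  | succ n ih =>
    rw [zpow_add_one]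
    have h := (T.isom ^ (n : ℤ))
    have e : ∀ z, ((T.isom ^ (n : ℤ)) * T.isom) z = (T.isom ^ (n : ℤ)) (T.isom z) := fun z => rfl
    have comm : (T.isom ^ (n : ℤ)) * T.isom = T.isom * (T.isom ^ (n : ℤ)) :=
      ((Commute.refl T.isom).zpow_left n)
    have e' : ∀ z, (T.isom * (T.isom ^ (n : ℤ))) z = T.φ ((T.isom ^ (n : ℤ)) z) := fun z => rfl
    rw [comm, e', e', e', ih, LieEquiv.map_lie]
  | pred n ih =>
    rw [zpow_sub_one]
    have comm : (T.isom ^ (-n : ℤ)) * T.isom⁻¹ = T.isom⁻¹ * (T.isom ^ (-n : ℤ)) :=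
      ((Commute.refl T.isom).inv_right.zpow_left (-n))
    have e' : ∀ z, (T.isom⁻¹ * (T.isom ^ (-n : ℤ))) z = T.φ.symm ((T.isom ^ (-n : ℤ)) z) :=
      fun z => rfl
    rw [comm, e', e', e', ih, LieEquiv.map_lie]

theorem isom_zpow_expAd (n : ℤ) (x v : k) :
    (T.isom ^ n) (expAd x v) = expAd ((T.isom ^ n) x) ((T.isom ^ n) v) :=
  map_expAd ((T.isom ^ n).toContinuousLinearEquiv : k →L[ℝ] k)
    (fun v => T.isom_zpow_lie n x v) v

theorem symm_expAd (x v : k) : T.φ.symm (expAd x v) = expAd (T.φ.symm x) (T.φ.symm v) :=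
  map_expAd (T.isom.symm.toContinuousLinearEquiv : k →L[ℝ] k)
    (fun v => LieEquiv.map_lie T.φ.symm x v) v

end FiniteOrderAut

namespace TwistedLoop

open HilbertLieAlgebra

variable {k : Type u} [HilbertLieAlgebra k] {T : FiniteOrderAut k}

/-- The automorphism `e^{ad η}` of the twisted loop algebra. -/
noncomputable def Ad (η : TwistedLoop T) : Module.End ℝ (TwistedLoop T) where
  toFun ξ := ⟨fun t => expAd (η t) (ξ t), (contDiff_expAd η.smooth).clm_apply ξ.smooth, fun t => by
    change expAd (η (t + 2 * Real.pi / T.N)) (ξ (t + 2 * Real.pi / T.N)) = _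
    rw [η.twist, ξ.twist, T.symm_expAd]⟩
  map_add' ξ ξ' := ext fun t => map_add (expAd (η t)) (ξ t) (ξ' t)
  map_smul' c ξ := ext fun t => map_smul (expAd (η t)) c (ξ t)

@[simp] theorem Ad_apply (η ξ : TwistedLoop T) (t : ℝ) : Ad η ξ t = expAd (η t) (ξ t) := rfl

@[simp] theorem neg_apply (ξ : TwistedLoop T) (t : ℝ) : (-ξ) t = -ξ t := rfl

@[simp] theorem sub_apply (ξ η : TwistedLoop T) (t : ℝ) : (ξ - η) t = ξ t - η t := rfl

theorem Ad_neg_Ad (η ξ : TwistedLoop T) : Ad (-η) (Ad η ξ) = ξ := ext fun t => by simp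

theorem Ad_Ad_neg (η ξ : TwistedLoop T) : Ad η (Ad (-η) ξ) = ξ := by
  simpa using Ad_neg_Ad (-η) ξ

theorem Ad_zero : Ad (0 : TwistedLoop T) = 1 := by
  ext ξ t
  simp

/-- Supplies the curves for `momentum_flow_eq`: e^{ad sη} ξ solves y' = [η, y] in the Fréchet
topology. -/
theorem hasVelocity_Ad (η ξ : TwistedLoop T) (t₀ : ℝ) :
    HasVelocity (fun s : ℝ => Ad ((t₀ + s) • η) ξ) ⁅η, Ad (t₀ • η) ξ⁆ := by
  set K : ℝ × ℝ → k := fun p => expAd ((t₀ + p.1) • η p.2) (ξ p.2) with hKdef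
  have hη : ContDiff ℝ ∞ fun p : ℝ × ℝ => η p.2 := η.smooth.comp contDiff_snd
  have hξ : ContDiff ℝ ∞ fun p : ℝ × ℝ => ξ p.2 := ξ.smooth.comp contDiff_snd
  have hK : ContDiff ℝ ∞ K :=
    (contDiff_expAd ((contDiff_const.add contDiff_fst).smul hη)).clm_apply hξ
  refine hasVelocity_of_contDiff hK (fun s t => rfl) fun t => ?_
  have h1 := hasDerivAt_partialFst hK 0 t
  have h2 := hasDerivAt_expAd_smul (η t) (ξ t) (t₀ + 0)
  have h3 := h2.comp_const_add t₀ 0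
  rw [add_zero] at h3
  exact h3.unique h1

end TwistedLoop

/-! ### Weighted C^m norms and finite rank approximation -/

section JetBound

variable {F : Type*} [NormedAddCommGroup F] [NormedSpace ℝ F]

/-- The weighted `C^m` norm of `u` is at most `r`. -/
def JetBound (m : ℕ) (δ r : ℝ) (u : ℝ → F) : Prop :=
  ∀ t, ∑ j ∈ Finset.range (m + 1), δ ^ j / j.factorial * ‖iteratedDeriv j u t‖ ≤ r

theorem JetBound.mono {m : ℕ} {δ r r' : ℝ} {u : ℝ → F} (h : JetBound m δ r u) (hr : r ≤ r') :
    JetBound m δ r' u := fun t => (h t).trans hr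

theorem JetBound.norm_iteratedDeriv_le {m : ℕ} {δ r : ℝ} {u : ℝ → F} (hδ : 0 < δ) (hδ1 : δ ≤ 1)
    (h : JetBound m δ r u) {j : ℕ} (hj : j ≤ m) (t : ℝ) :
    ‖iteratedDeriv j u t‖ ≤ m.factorial / δ ^ m * r := by
  have h1 : δ ^ j / j.factorial * ‖iteratedDeriv j u t‖ ≤ r := by
    refine le_trans ?_ (h t)
    exact Finset.single_le_sum (f := fun j => δ ^ j / j.factorial * ‖iteratedDeriv j u t‖)
      (fun i _ => by positivity) (Finset.mem_range.2 (by omega))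
  have h2 : δ ^ m / m.factorial ≤ δ ^ j / j.factorial := by
    refine div_le_div₀ (by positivity) (pow_le_pow_of_le_one hδ.le hδ1 hj) (by positivity) ?_
    exact_mod_cast Nat.factorial_le hj
  have h3 : δ ^ m / m.factorial * ‖iteratedDeriv j u t‖ ≤ r :=
    (mul_le_mul_of_nonneg_right h2 (norm_nonneg _)).trans h1
  calc ‖iteratedDeriv j u t‖
      = m.factorial / δ ^ m * (δ ^ m / m.factorial * ‖iteratedDeriv j u t‖) := by
        have : (m.factorial : ℝ) ≠ 0 := by positivity
        field_simp
    _ ≤ _ := by gcongr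

theorem jetBound_of_norm_iteratedDeriv_le {m : ℕ} {δ ε : ℝ} {u : ℝ → F} (hδ : 0 ≤ δ) (hδ1 : δ ≤ 1)
    (h : ∀ j ≤ m, ∀ t, ‖iteratedDeriv j u t‖ ≤ ε) : JetBound m δ ((m + 1) * ε) u := by
  intro t
  calc _ ≤ ∑ j ∈ Finset.range (m + 1), ε := by
        refine Finset.sum_le_sum fun j hj => ?_
        have hj' : j ≤ m := by have := Finset.mem_range.1 hj; omega
        have h1 : δ ^ j / j.factorial ≤ 1 := by
          refine div_le_one_of_le₀ ((pow_le_one₀ hδ hδ1).trans ?_) (by positivity)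
          exact_mod_cast j.factorial_pos
        calc _ ≤ 1 * ‖iteratedDeriv j u t‖ := by gcongr
          _ ≤ ε := by rw [one_mul]; exact h j hj' t
    _ = _ := by simp

theorem periodic_iteratedDeriv {u : ℝ → F} {p : ℝ} (hper : ∀ t, u (t + p) = u t) (j : ℕ) :
    Function.Periodic (iteratedDeriv j u) p := by
  intro t
  have h := congrFun (iteratedDeriv_comp_add_const (n := j) (f := u) (s := p)) t
  rw [← h]
  simp only [hper]

theorem exists_norm_iteratedDeriv_le_of_periodic {u : ℝ → F} (hu : ContDiff ℝ ∞ u) {p : ℝ}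
    (hp : 0 < p) (hper : ∀ t, u (t + p) = u t) (m : ℕ) :
    ∃ C : ℝ, 0 ≤ C ∧ ∀ j ≤ m, ∀ t, ‖iteratedDeriv j u t‖ ≤ C := by
  have hb : ∀ j : ℕ, ∃ C : ℝ, ∀ t, ‖iteratedDeriv j u t‖ ≤ C := by
    intro j
    have hper' := periodic_iteratedDeriv hper j
    have := hper'.isBounded_of_continuous hp.ne'
      (hu.continuous_iteratedDeriv j (by exact_mod_cast le_top))
    obtain ⟨C, hC⟩ := this.exists_norm_le
    exact ⟨C, fun t => hC _ (mem_range_self t)⟩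
  choose C hC using hb
  refine ⟨∑ j ∈ Finset.range (m + 1), |C j|, Finset.sum_nonneg fun _ _ => abs_nonneg _,
    fun j hj t => ?_⟩
  refine (hC j t).trans ((le_abs_self _).trans ?_)
  exact Finset.single_le_sum (f := fun j => |C j|) (fun i _ => abs_nonneg _)
    (Finset.mem_range.2 (by omega))

theorem sum_range_convolution_le {a b : ℕ → ℝ} (ha : ∀ i, 0 ≤ a i) (hb : ∀ i, 0 ≤ b i) (m : ℕ) :
    ∑ j ∈ Finset.range (m + 1), ∑ i ∈ Finset.range (j + 1), a i * b (j - i)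
      ≤ (∑ i ∈ Finset.range (m + 1), a i) * ∑ i ∈ Finset.range (m + 1), b i := by
  rw [Finset.sum_mul_sum, Finset.sum_sigma', ← Finset.sum_product']
  have hinj : Set.InjOn (fun x : (_ : ℕ) × ℕ => (x.2, x.1 - x.2))
      ((Finset.range (m + 1)).sigma fun j => Finset.range (j + 1)) := by
    rintro ⟨j, i⟩ h ⟨j', i'⟩ h' heq
    simp only [Finset.coe_sigma, Set.mem_sigma_iff, Finset.coe_range, Set.mem_Iio] at h h'
    simp only [Prod.mk.injEq] at heq
    have e2 : i = i' := heq.1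
    have e1 : j = j' := by omega
    subst e1; subst e2; rfl
  rw [← Finset.sum_image (f := fun p : ℕ × ℕ => a p.1 * b p.2) hinj]
  refine Finset.sum_le_sum_of_subset_of_nonneg ?_ fun p _ _ => mul_nonneg (ha _) (hb _)
  intro p hp
  obtain ⟨⟨j, i⟩, h, rfl⟩ := Finset.mem_image.1 hp
  simp only [Finset.mem_sigma, Finset.mem_range] at h
  simp only [Finset.mem_product, Finset.mem_range]
  omega

/-- A periodic family of contractions increases the weighted `C^m` norm by a factor that tends
to `1` with the weight. -/
theorem eventually_jetBound_clm_apply {A : ℝ → F →L[ℝ] F} (hA : ContDiff ℝ ∞ A) {p : ℝ}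
    (hp : 0 < p) (hper : ∀ t, A (t + p) = A t) (hnorm : ∀ t, ‖A t‖ ≤ 1) (m : ℕ) {ρ : ℝ}
    (hρ : 1 < ρ) : ∀ᶠ δ in 𝓝[>] (0 : ℝ), ∀ u : ℝ → F, ContDiff ℝ ∞ u → ∀ r, JetBound m δ r u →
      JetBound m δ (ρ * r) (fun t => A t (u t)) := by
  obtain ⟨C, hC0, hC⟩ := exists_norm_iteratedDeriv_le_of_periodic hA hp hper m
  have hlim : Tendsto (fun δ : ℝ => 1 + ∑ i ∈ Finset.range m, δ ^ (i + 1) * C) (𝓝[>] 0) (𝓝 1) := by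
    have hc : Continuous fun δ : ℝ => 1 + ∑ i ∈ Finset.range m, δ ^ (i + 1) * C := by fun_prop
    have h := (hc.tendsto 0).mono_left (nhdsWithin_le_nhds (s := Ioi 0))
    simpa using h
  filter_upwards [hlim.eventually (gt_mem_nhds hρ), self_mem_nhdsWithin] with δ hδ hδ0 u hu r hr t
  have hδ0 : 0 < δ := hδ0
  have hleib : ∀ j, j ≤ m → ‖iteratedDeriv j (fun t => A t (u t)) t‖
      ≤ ∑ i ∈ Finset.range (j + 1), (j.choose i : ℝ) * ‖iteratedDeriv i A t‖ *
        ‖iteratedDeriv (j - i) u t‖ := by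
    intro j _
    have h := norm_iteratedFDeriv_clm_apply hA hu t (n := j) (by exact_mod_cast le_top)
    simpa only [norm_iteratedFDeriv_eq_norm_iteratedDeriv] using h
  -- The weights δ^j/j! turn the Leibniz rule into a convolution, hence into a product of the
  -- weighted norms of `A` and `u`. That of `A` is 1 + O(δ): the zeroth term is at most 1 by
  -- contractivity and the others carry a factor δ.
  set a : ℕ → ℝ := fun i => δ ^ i / i.factorial * ‖iteratedDeriv i A t‖ with ha
  set b : ℕ → ℝ := fun i => δ ^ i / i.factorial * ‖iteratedDeriv i u t‖ with hb
  have hsum : ∑ i ∈ Finset.range (m + 1), a i ≤ ρ := by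
    refine le_trans ?_ hδ.le
    rw [Finset.sum_range_succ', add_comm]
    refine add_le_add ?_ (Finset.sum_le_sum fun i hi => ?_)
    · simpa [ha] using hnorm t
    · have hi' : i + 1 ≤ m := Finset.mem_range.1 hi
      have h1 : δ ^ (i + 1) / (i + 1).factorial ≤ δ ^ (i + 1) :=
        div_le_self (by positivity) (by exact_mod_cast (i + 1).factorial_pos)
      exact mul_le_mul h1 (hC _ hi' t) (norm_nonneg _) (by positivity)
  calc _ ≤ ∑ j ∈ Finset.range (m + 1), ∑ i ∈ Finset.range (j + 1), a i * b (j - i) := by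
        refine Finset.sum_le_sum fun j hj => ?_
        have hj' : j ≤ m := by have := Finset.mem_range.1 hj; omega
        refine (mul_le_mul_of_nonneg_left (hleib j hj') (by positivity)).trans (le_of_eq ?_)
        rw [Finset.mul_sum]
        refine Finset.sum_congr rfl fun i hi => ?_
        have hi' : i ≤ j := by have := Finset.mem_range.1 hi; omega
        have hch : (j.choose i : ℝ) = j.factorial / (i.factorial * (j - i).factorial) :=
          Nat.cast_choose ℝ hi'
        have hpow : δ ^ j = δ ^ i * δ ^ (j - i) := by rw [← pow_add]; congr 1; omega
        have f1 : (j.factorial : ℝ) ≠ 0 := by positivity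
        have f2 : (i.factorial : ℝ) ≠ 0 := by positivity
        have f3 : ((j - i).factorial : ℝ) ≠ 0 := by positivity
        rw [hch, hpow, ha, hb]
        field_simp
    _ ≤ (∑ i ∈ Finset.range (m + 1), a i) * ∑ i ∈ Finset.range (m + 1), b i :=
        sum_range_convolution_le (fun i => by positivity) (fun i => by positivity) m
    _ ≤ ρ * r := mul_le_mul hsum (hr t) (Finset.sum_nonneg fun i _ => by positivity) (by linarith)

theorem iteratedDeriv_clm_comp {F' : Type*} [NormedAddCommGroup F'] [NormedSpace ℝ F']
    (L : F →L[ℝ] F') {u : ℝ → F} (hu : ContDiff ℝ ∞ u) (j : ℕ) (t : ℝ) :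
    iteratedDeriv j (fun t => L (u t)) t = L (iteratedDeriv j u t) := by
  have h := L.iteratedFDeriv_comp_left (f := u) (x := t) (n := ∞) (i := j) hu.contDiffAt
    (by exact_mod_cast le_top)
  simp only [iteratedDeriv_eq_iteratedFDeriv]
  change (iteratedFDeriv ℝ j (⇑L ∘ u) t) _ = _
  rw [h]
  rfl

end JetBound

/-- A smooth periodic function with values in a Hilbert space and finitely many of its derivatives
are uniformly approximated by their projections to a finite-dimensional subspace. -/
theorem exists_finite_rank_approx {F : Type*} [NormedAddCommGroup F] [InnerProductSpace ℝ F]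
    {u : ℝ → F} (hu : ContDiff ℝ ∞ u) {p : ℝ} (hp : 0 < p) (hper : ∀ t, u (t + p) = u t) (m : ℕ)
    {ε : ℝ} (hε : 0 < ε) : ∃ (n : ℕ) (b : Fin n → F), ∀ j ≤ m, ∀ t,
      ‖iteratedDeriv j u t - ∑ i, inner ℝ (b i) (iteratedDeriv j u t) • b i‖ ≤ ε := by
  have hcomp : IsCompact (⋃ j ∈ Finset.range (m + 1), range (iteratedDeriv j u)) := by
    refine Finset.isCompact_biUnion _ fun j _ => ?_
    have hper' := periodic_iteratedDeriv hper j
    exact hper'.compact_of_continuous hp.ne'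
      (hu.continuous_iteratedDeriv j (by exact_mod_cast le_top))
  -- The span of a finite ε-net has a point within ε of every value of the derivatives, and the
  -- orthogonal projection is at least as close.
  obtain ⟨S, hSfin, hS⟩ := Metric.totallyBounded_iff.1 hcomp.totallyBounded ε hε
  set V : Submodule ℝ F := Submodule.span ℝ S with hV
  have : FiniteDimensional ℝ V := FiniteDimensional.span_of_finite ℝ hSfin
  set B := stdOrthonormalBasis ℝ V
  refine ⟨_, fun i => (B i : F), fun j hj t => ?_⟩
  have hmem : iteratedDeriv j u t ∈ ⋃ j ∈ Finset.range (m + 1), range (iteratedDeriv j u) :=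
    mem_biUnion (Finset.mem_range.2 (by omega)) (mem_range_self t)
  obtain ⟨y, hy, hyt⟩ := mem_iUnion₂.1 (hS hmem)
  have hyV : y ∈ V := Submodule.subset_span hy
  have hproj : ∑ i, inner ℝ (B i : F) (iteratedDeriv j u t) • (B i : F)
      = V.starProjection (iteratedDeriv j u t) := by
    rw [Submodule.starProjection_apply, ← B.sum_repr' (V.orthogonalProjectionOnto _)]
    simp only [Submodule.coe_sum, Submodule.coe_smul, Submodule.coe_inner,
      Submodule.coe_orthogonalProjectionOnto_apply]
    refine Finset.sum_congr rfl fun i _ => ?_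
    rw [← Submodule.inner_starProjection_left_eq_right,
      Submodule.starProjection_eq_self_iff.2 (B i).2]
  rw [hproj, Submodule.starProjection_minimal]
  refine (ciInf_le ⟨0, ?_⟩ (⟨y, hyV⟩ : V)).trans ?_
  · rintro _ ⟨x, rfl⟩; exact norm_nonneg _
  · rw [Metric.mem_ball, dist_eq_norm] at hyt
    exact hyt.le

namespace TwistedLoop

open HilbertLieAlgebra

variable {k : Type u} [HilbertLieAlgebra k] {T : FiniteOrderAut k}

theorem exists_jetBound (ξ : TwistedLoop T) (m : ℕ) : ∃ r : ℝ, 0 < r ∧ ∀ δ, 0 ≤ δ → δ ≤ 1 →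
    JetBound m δ r ξ := by
  obtain ⟨C, hC0, hC⟩ := exists_norm_iteratedDeriv_le_of_periodic ξ.smooth
    (by positivity) ξ.periodic m
  exact ⟨(m + 1) * C + 1, by positivity, fun δ h0 h1 =>
    (jetBound_of_norm_iteratedDeriv_le h0 h1 hC).mono (by linarith)⟩

theorem eventually_jetBound_Ad (η : TwistedLoop T) (m : ℕ) {ρ : ℝ} (hρ : 1 < ρ) :
    ∀ᶠ δ in 𝓝[>] (0 : ℝ), ∀ ξ : TwistedLoop T, ∀ r, JetBound m δ r ξ →
      JetBound m δ (ρ * r) (Ad η ξ) := by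
  have h := eventually_jetBound_clm_apply (contDiff_expAd η.smooth) (p := 2 * Real.pi)
    (by positivity) (fun t => by rw [η.periodic]) (fun t =>
      ContinuousLinearMap.opNorm_le_bound _ zero_le_one fun v => by simp) m hρ
  filter_upwards [h] with δ hδ ξ r hr
  exact hδ ξ ξ.smooth r hr

/-- A neighbourhood of zero contains all loops with small derivatives up to some order. -/
theorem exists_norm_iteratedDeriv_le_imp_mem {U : Set (TwistedLoop T)} (hU : U ∈ 𝓝 0) :
    ∃ (m : ℕ) (r : ℝ), 0 < r ∧ ∀ ξ : TwistedLoop T,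
      (∀ j ≤ m, ∀ t, ‖iteratedDeriv j ξ t‖ ≤ r) → ξ ∈ U := by
  by_contra! hcon
  -- Loops outside `U` with derivatives up to order m at most 1/(m + 1) would converge to 0.
  choose ξ hξ hξU using fun m : ℕ => hcon m (1 / ((m : ℝ) + 1)) (by positivity)
  have hind : IsInducing (jet T) := ⟨rfl⟩
  have hlim : Tendsto ξ atTop (𝓝 0) := by
    rw [hind.tendsto_nhds_iff, tendsto_pi_nhds]
    intro n
    rw [ContinuousMap.tendsto_iff_tendstoLocallyUniformly]
    refine TendstoUniformly.tendstoLocallyUniformly ?_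
    rw [Metric.tendstoUniformly_iff]
    intro ε hε
    have h1 := (tendsto_one_div_add_atTop_nhds_zero_nat (𝕜 := ℝ)).eventually (gt_mem_nhds hε)
    filter_upwards [h1, eventually_ge_atTop n] with m hm hnm t
    have e : jet T 0 n t = 0 := by rw [map_zero]; rfl
    rw [e, dist_zero_left]
    exact (hξ m n hnm t).trans_lt hm
  obtain ⟨m, hm⟩ := (hlim.eventually hU).exists
  exact hξU m hm

end TwistedLoop

/-! ### Untwisting loops on arcs -/

namespace FiniteOrderAut

open HilbertLieAlgebra

variable {k : Type u} [HilbertLieAlgebra k] (T : FiniteOrderAut k)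

/-- The coordinate on `ℝ` in which the period of the twisting is `1` and the origin is shifted
to `α`. -/
noncomputable def phase (α t : ℝ) : ℝ := T.N * t / (2 * Real.pi) - α

theorem continuous_phase (α : ℝ) : Continuous (T.phase α) := by
  unfold phase; fun_prop

theorem contDiff_phase (α : ℝ) : ContDiff ℝ ∞ (T.phase α) := by
  unfold phase; fun_prop

theorem phase_add_period (α t : ℝ) : T.phase α (t + 2 * Real.pi / T.N) = T.phase α t + 1 := by
  have hN : (T.N : ℝ) ≠ 0 := by exact_mod_cast T.N_pos.ne'
  have := Real.pi_pos.ne'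
  unfold phase
  field_simp
  ring

theorem period_pos : 0 < 2 * Real.pi / T.N := by
  have hN : (0 : ℝ) < T.N := by exact_mod_cast T.N_pos
  positivity

/-- The function `cos (N t - 2π α)`, which is positive near the jumps of `⌊phase α t⌋`. -/
noncomputable def phaseCos (α t : ℝ) : ℝ := Real.cos (2 * Real.pi * T.phase α t)

theorem contDiff_phaseCos (α : ℝ) : ContDiff ℝ ∞ (T.phaseCos α) :=
  Real.contDiff_cos.comp (contDiff_const.mul (T.contDiff_phase α))

theorem phaseCos_add_period (α t : ℝ) : T.phaseCos α (t + 2 * Real.pi / T.N) = T.phaseCos α t := by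
  unfold phaseCos
  rw [phase_add_period, mul_add, mul_one, Real.cos_add_two_pi]

/-- A smooth periodic function that vanishes where `cos (2π (N t / 2π - α)) ≥ c`. -/
structure IsLocalized {F : Type*} [NormedAddCommGroup F] [NormedSpace ℝ F] (α c : ℝ)
    (u : ℝ → F) : Prop where
  smooth : ContDiff ℝ ∞ u
  periodic : ∀ t, u (t + 2 * Real.pi / T.N) = u t
  eq_zero : ∀ t, c ≤ T.phaseCos α t → u t = 0

theorem isLocalized_smoothTransition (α : ℝ) {a b c : ℝ} (h : ∀ s, c ≤ s → a + b * s ≤ 0) :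
    T.IsLocalized α c fun t => Real.smoothTransition (a + b * T.phaseCos α t) where
  smooth := Real.smoothTransition.contDiff.comp
    (contDiff_const.add (contDiff_const.mul (T.contDiff_phaseCos α)))
  periodic t := by rw [phaseCos_add_period]
  eq_zero t ht := Real.smoothTransition.zero_of_nonpos (h _ ht)

/-- The function `t ↦ φ^(n ⌊N t / 2π - α⌋) (u t)`. -/
noncomputable def floorTwist (α : ℝ) (n : ℤ) (u : ℝ → k) (t : ℝ) : k :=
  (T.isom ^ (n * ⌊T.phase α t⌋)) (u t)

/-- The exponent jumps only at integer phases, where `phaseCos` is 1 and `u` vanishes nearby. So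
`floorTwist` is locally a fixed isometry applied to `u`, which gives smoothness and preserves the
norms of all derivatives. -/
theorem eventually_floorTwist_eq {α : ℝ} {u : ℝ → k} (hu : ∀ t, 1 / 2 ≤ T.phaseCos α t → u t = 0)
    (n : ℤ) (t : ℝ) : ∃ j : ℤ, T.floorTwist α n u =ᶠ[𝓝 t] fun s => (T.isom ^ j) (u s) := by
  by_cases h : 1 / 2 < T.phaseCos α t
  · refine ⟨0, ?_⟩
    filter_upwards [(T.contDiff_phaseCos α).continuous.continuousAt.eventually (lt_mem_nhds h)]
      with s hs
    simp [floorTwist, hu s hs.le]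
  · refine ⟨n * ⌊T.phase α t⌋, ?_⟩
    have hlt : (⌊T.phase α t⌋ : ℝ) < T.phase α t := by
      refine lt_of_le_of_ne (Int.floor_le _) fun he => h ?_
      unfold phaseCos
      rw [← he, mul_comm, Real.cos_int_mul_two_pi]
      norm_num
    filter_upwards [(T.continuous_phase α).continuousAt.eventually
      (Ioo_mem_nhds hlt (Int.lt_floor_add_one _))] with s hs
    have : ⌊T.phase α s⌋ = ⌊T.phase α t⌋ := Int.floor_eq_iff.2 ⟨hs.1.le, hs.2⟩
    simp only [floorTwist, this]

theorem contDiff_floorTwist {α : ℝ} {u : ℝ → k} (hs : ContDiff ℝ ∞ u)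
    (hu : ∀ t, 1 / 2 ≤ T.phaseCos α t → u t = 0) (n : ℤ) :
    ContDiff ℝ ∞ (T.floorTwist α n u) := by
  rw [contDiff_iff_contDiffAt]
  intro t
  obtain ⟨j, hj⟩ := T.eventually_floorTwist_eq hu n t
  refine ContDiffAt.congr_of_eventuallyEq ?_ hj
  exact ((T.isom ^ j).contDiff.comp hs).contDiffAt

theorem norm_iteratedDeriv_floorTwist {α : ℝ} {u : ℝ → k}
    (hu : ∀ t, 1 / 2 ≤ T.phaseCos α t → u t = 0) (n : ℤ) (i : ℕ) (t : ℝ) :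
    ‖iteratedDeriv i (T.floorTwist α n u) t‖ = ‖iteratedDeriv i u t‖ := by
  obtain ⟨j, hj⟩ := T.eventually_floorTwist_eq hu n t
  rw [hj.iteratedDeriv_eq i, ← norm_iteratedFDeriv_eq_norm_iteratedDeriv,
    ← norm_iteratedFDeriv_eq_norm_iteratedDeriv]
  exact (T.isom ^ j).norm_iteratedFDeriv_comp_left u t i

end FiniteOrderAut

namespace TwistedLoop

open HilbertLieAlgebra

variable {k : Type u} [HilbertLieAlgebra k] {T : FiniteOrderAut k}

/-- The product of a twisted loop with a scalar function of period `2π / N`. -/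
noncomputable def mulFun {ρ : ℝ → ℝ} (hρ : ContDiff ℝ ∞ ρ)
    (hper : ∀ t, ρ (t + 2 * Real.pi / T.N) = ρ t) (ξ : TwistedLoop T) : TwistedLoop T :=
  ⟨fun t => ρ t • ξ t, hρ.smul ξ.smooth, fun t => by
    change ρ (t + 2 * Real.pi / T.N) • ξ (t + 2 * Real.pi / T.N) = T.φ.symm (ρ t • ξ t)
    rw [hper, ξ.twist, map_smul]⟩

@[simp] theorem mulFun_apply {ρ : ℝ → ℝ} (hρ : ContDiff ℝ ∞ ρ)
    (hper : ∀ t, ρ (t + 2 * Real.pi / T.N) = ρ t) (ξ : TwistedLoop T) (t : ℝ) :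
    mulFun hρ hper ξ t = ρ t • ξ t := rfl

variable {α : ℝ} {ψ χ : ℝ → ℝ}

/-- The twisted loop that agrees with `ψ v` on the fundamental interval around `α + 1/2`. -/
noncomputable def bump (hψ : T.IsLocalized α (1 / 2) ψ) : k →ₗ[ℝ] TwistedLoop T where
  toFun v := ⟨T.floorTwist α (-1) fun t => ψ t • v,
    T.contDiff_floorTwist (u := fun t => ψ t • v) (hψ.smooth.smul contDiff_const)
      (fun t ht => by rw [hψ.eq_zero t ht, zero_smul]) _, fun t => by
    change (T.isom ^ ((-1) * ⌊T.phase α (t + 2 * Real.pi / T.N)⌋)) (ψ (t + 2 * Real.pi / T.N) • v)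
      = T.isom.symm ((T.isom ^ ((-1) * ⌊T.phase α t⌋)) (ψ t • v))
    rw [hψ.periodic, T.phase_add_period, Int.floor_add_one]
    have e : (-1 : ℤ) * (⌊T.phase α t⌋ + 1) = -1 + (-1) * ⌊T.phase α t⌋ := by ring
    rw [e, zpow_add, zpow_neg_one]
    rfl⟩
  map_add' v w := ext fun t => by
    change (T.isom ^ _) (ψ t • (v + w)) = (T.isom ^ _) (ψ t • v) + (T.isom ^ _) (ψ t • w)
    rw [smul_add, map_add]
  map_smul' c v := ext fun t => by
    change (T.isom ^ _) (ψ t • c • v) = c • (T.isom ^ _) (ψ t • v)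
    rw [smul_comm, map_smul]

theorem bump_apply (hψ : T.IsLocalized α (1 / 2) ψ) (v : k) (t : ℝ) :
    bump hψ v t = (T.isom ^ ((-1) * ⌊T.phase α t⌋)) (ψ t • v) := rfl

theorem coe_bump (hψ : T.IsLocalized α (1 / 2) ψ) (v : k) :
    ⇑(bump hψ v) = T.floorTwist α (-1) fun t => ψ t • v := rfl

/-- Where ψ is nonzero the cutoff χ is 1, so the two bumps carry the same power of `φ` and it passes
through `expAd`. Thus the isometries `expAd y` of 𝔨 are realised by operators e^{ad η} on loops with
profile ψ. -/
theorem Ad_bump_bump (hχ : T.IsLocalized α (1 / 2) χ) (hψ : T.IsLocalized α (1 / 2) ψ)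
    (h : ∀ t, ψ t ≠ 0 → χ t = 1) (y v : k) :
    Ad (bump hχ y) (bump hψ v) = bump hψ (expAd y v) := by
  ext t
  rw [Ad_apply, bump_apply, bump_apply, bump_apply, ← T.isom_zpow_expAd]
  by_cases h0 : ψ t = 0
  · simp [h0]
  · rw [h t h0, one_smul, map_smul]

theorem exists_jetBound_bump (hψ : T.IsLocalized α (1 / 2) ψ) (m : ℕ) :
    ∃ C : ℝ, 0 ≤ C ∧ ∀ δ, 0 ≤ δ → δ ≤ 1 → ∀ v, JetBound m δ (C * ‖v‖) (bump hψ v) := by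
  obtain ⟨C, hC0, hC⟩ := exists_norm_iteratedDeriv_le_of_periodic hψ.smooth T.period_pos
    hψ.periodic m
  refine ⟨(m + 1) * C, by positivity, fun δ h0 h1 v => ?_⟩
  rw [mul_assoc]
  refine jetBound_of_norm_iteratedDeriv_le h0 h1 fun j hj t => ?_
  rw [coe_bump, T.norm_iteratedDeriv_floorTwist
    (fun t ht => by rw [hψ.eq_zero t ht, zero_smul])]
  have e := iteratedDeriv_clm_comp ((ContinuousLinearMap.id ℝ ℝ).smulRight v) hψ.smooth j t
  simp only [ContinuousLinearMap.smulRight_apply, ContinuousLinearMap.id_apply] at e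
  rw [e, norm_smul]
  gcongr
  exact hC j hj t

theorem exists_apply_eq (t : ℝ) (v : k) : ∃ ξ : TwistedLoop T, ξ t = v := by
  -- The arc is centred at `t`: the phase there is −1/2 and `phaseCos` is −1, so the cutoff is 1.
  -- The power of `φ` in the bump is cancelled in advance in the vector.
  set α := T.phase 0 t + 1 / 2 with hα
  have hψ := T.isLocalized_smoothTransition α (a := 0) (b := -1) (c := 1 / 2)
    fun s hs => by linarith
  refine ⟨bump hψ ((T.isom ^ (-((-1) * ⌊T.phase α t⌋))) v), ?_⟩
  have hph : T.phase α t = - (1 / 2) := by simp [hα, FiniteOrderAut.phase]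
  have hcos : T.phaseCos α t = -1 := by
    unfold FiniteOrderAut.phaseCos
    rw [hph]
    have : 2 * Real.pi * -(1 / 2) = -Real.pi := by ring
    rw [this, Real.cos_neg, Real.cos_pi]
  rw [bump_apply, hcos, Real.smoothTransition.one_of_one_le (by norm_num), one_smul]
  change ((T.isom ^ ((-1) * ⌊T.phase α t⌋)) * (T.isom ^ (-((-1) * ⌊T.phase α t⌋)))) v = v
  rw [← zpow_add, add_neg_cancel, zpow_zero]
  rfl

/-- The loops supported where `cos (2π (N t / 2π - α)) < 0`. -/
noncomputable def localSubmodule (T : FiniteOrderAut k) (α : ℝ) : Submodule ℝ (TwistedLoop T) where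
  carrier := {ξ | ∀ t, 0 ≤ T.phaseCos α t → ξ t = 0}
  add_mem' hξ hη t ht := by rw [add_apply, hξ t ht, hη t ht, add_zero]
  zero_mem' t _ := rfl
  smul_mem' c ξ hξ t ht := by rw [smul_apply, hξ t ht, smul_zero]

theorem Ad_mem_localSubmodule {ξ : TwistedLoop T} (h : ξ ∈ localSubmodule T α) (η : TwistedLoop T) :
    Ad η ξ ∈ localSubmodule T α := fun t ht => by rw [Ad_apply, h t ht, map_zero]

/-- Loops in `localSubmodule` are approximated by finite sums of bumps. -/
theorem exists_bump_approx {ξ : TwistedLoop T} (hξ : ξ ∈ localSubmodule T α) (m : ℕ) {ε : ℝ}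
    (hε : 0 < ε) : ∃ (n : ℕ) (ψ : Fin n → ℝ → ℝ) (_ : ∀ i, T.IsLocalized α 0 (ψ i))
      (hψ' : ∀ i, T.IsLocalized α (1 / 2) (ψ i)) (b : Fin n → k),
      ∀ δ, 0 ≤ δ → δ ≤ 1 → JetBound m δ ε (ξ - ∑ i, bump (hψ' i) (b i) : TwistedLoop T) := by
  have hξ' : ∀ t, 1 / 2 ≤ T.phaseCos α t → ξ t = 0 := fun t ht => hξ t (by linarith)
  -- Untwisting makes ξ an ordinary function of period 2π/N. Its coordinates in an approximating
  -- finite-dimensional space become the profiles of the bumps.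
  set u : ℝ → k := T.floorTwist α 1 ξ with hu
  have hus : ContDiff ℝ ∞ u := T.contDiff_floorTwist ξ.smooth hξ' 1
  have huper : ∀ t, u (t + 2 * Real.pi / T.N) = u t := by
    intro t
    change (T.isom ^ (1 * ⌊T.phase α (t + 2 * Real.pi / T.N)⌋)) (ξ (t + 2 * Real.pi / T.N))
      = (T.isom ^ (1 * ⌊T.phase α t⌋)) (ξ t)
    rw [ξ.twist, T.phase_add_period, Int.floor_add_one, one_mul, one_mul, zpow_add_one]
    change (T.isom ^ ⌊T.phase α t⌋) (T.φ (T.φ.symm (ξ t))) = _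
    rw [LieEquiv.apply_symm_apply]
  have hu0 : ∀ t, 0 ≤ T.phaseCos α t → u t = 0 := fun t ht => by
    rw [hu, FiniteOrderAut.floorTwist, hξ t ht, map_zero]
  have hξu : ∀ t, (T.isom ^ ((-1) * ⌊T.phase α t⌋)) (u t) = ξ t := by
    intro t
    change ((T.isom ^ ((-1) * ⌊T.phase α t⌋)) * (T.isom ^ (1 * ⌊T.phase α t⌋))) (ξ t) = _
    rw [← zpow_add]
    simp
  have hε' : 0 < ε / (m + 1) := by positivity
  obtain ⟨n, b, hb⟩ := exists_finite_rank_approx hus T.period_pos huper m hε'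
  -- Threshold 1/2 is enough to define a bump; threshold 0 leaves room for a cutoff that is 1 on the
  -- support.
  have hloc : ∀ c : ℝ, 0 ≤ c → ∀ i, T.IsLocalized α c fun t => (inner ℝ (b i) (u t) : ℝ) :=
    fun c hc i =>
    ⟨contDiff_const.inner ℝ hus, fun t => by rw [huper], fun t ht => by
      rw [hu0 t (hc.trans ht), inner_zero_right]⟩
  refine ⟨n, fun i t => inner ℝ (b i) (u t), hloc 0 le_rfl, hloc _ (by norm_num), b,
    fun δ h0 h1 => ?_⟩
  have hfun : ⇑(ξ - ∑ i, bump (hloc (1 / 2) (by norm_num) i) (b i) : TwistedLoop T)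
      = T.floorTwist α (-1) fun t => u t - ∑ i, (inner ℝ (b i) (u t) : ℝ) • b i := by
    funext t
    have hsum : ∀ s : Finset (Fin n), (∑ i ∈ s, bump (hloc (1 / 2) (by norm_num) i) (b i) :
        TwistedLoop T) t = ∑ i ∈ s, bump (hloc (1 / 2) (by norm_num) i) (b i) t := by
      intro s
      induction s using Finset.cons_induction with
      | empty => rfl
      | cons a s ha ih => rw [Finset.sum_cons, Finset.sum_cons, add_apply, ih]
    rw [sub_apply, hsum, FiniteOrderAut.floorTwist, map_sub, map_sum, hξu]
    rfl
  have hvan : ∀ t, 1 / 2 ≤ T.phaseCos α t →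
      u t - ∑ i, (inner ℝ (b i) (u t) : ℝ) • b i = 0 := fun t ht => by
    simp [hu0 t (by linarith)]
  have hJ := jetBound_of_norm_iteratedDeriv_le (m := m) (δ := δ) (ε := ε / (m + 1))
    (u := ⇑(ξ - ∑ i, bump (hloc (1 / 2) (by norm_num) i) (b i) : TwistedLoop T)) h0 h1
    fun j hj t => by
      rw [hfun, T.norm_iteratedDeriv_floorTwist hvan]
      set L : k →L[ℝ] k := ContinuousLinearMap.id ℝ k -
        ∑ i, (innerSL ℝ (b i)).smulRight (b i) with hL
      have hLa : ∀ z, L z = z - ∑ i, (inner ℝ (b i) z : ℝ) • b i := fun z => by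
        simp [hL]
      have e := iteratedDeriv_clm_comp L hus j t
      simp only [hLa] at e
      rw [e]
      exact hb j hj t
  refine hJ.mono (le_of_eq ?_)
  field_simp

/-- With x = Nt the four functions are cos x, sin x, −cos x and −sin x, which are never all
nonnegative. -/
theorem exists_pos_neg_phaseCos (t : ℝ) :
    ∃ i : Fin 4, T.phaseCos ((i : ℝ) / 4) t < 0 := by
  set x := T.N * t with hx
  have h : ∀ a : ℝ, T.phaseCos a t = Real.cos (x - 2 * Real.pi * a) := by
    intro a
    unfold FiniteOrderAut.phaseCos FiniteOrderAut.phase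
    congr 1
    have := Real.pi_pos.ne'
    field_simp
    rw [hx]
  by_contra! hcon
  have h0 := hcon 0
  have h1 := hcon 1
  have h2 := hcon 2
  have h3 := hcon 3
  rw [h] at h0 h1 h2 h3
  have e0 : x - 2 * Real.pi * (((0 : Fin 4) : ℕ) / 4 : ℝ) = x := by simp
  have e1 : x - 2 * Real.pi * (((1 : Fin 4) : ℕ) / 4 : ℝ) = x - Real.pi / 2 := by
    norm_num; ring
  have e2 : x - 2 * Real.pi * (((2 : Fin 4) : ℕ) / 4 : ℝ) = x - Real.pi := by
    norm_num; ring
  have e3 : x - 2 * Real.pi * (((3 : Fin 4) : ℕ) / 4 : ℝ) = x - Real.pi / 2 - Real.pi := by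
    norm_num; ring
  rw [e0] at h0
  rw [e1, Real.cos_sub_pi_div_two] at h1
  rw [e2, Real.cos_sub_pi] at h2
  rw [e3, Real.cos_sub_pi, Real.cos_sub_pi_div_two] at h3
  have := Real.sin_sq_add_cos_sq x
  have hs : Real.sin x = 0 := by linarith
  have hc : Real.cos x = 0 := by linarith
  rw [hs, hc] at this
  norm_num at this

/-- A partition of unity of period 2π/N subordinate to the four arcs splits every loop. -/
theorem iSup_localSubmodule : ⨆ i : Fin 4, localSubmodule T ((i : ℝ) / 4) = ⊤ := by
  rw [eq_top_iff]
  intro ξ _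
  set ρ : Fin 4 → ℝ → ℝ := fun i t => Real.smoothTransition (0 + (-1) * T.phaseCos ((i : ℝ) / 4) t)
  have hρ : ∀ i : Fin 4, T.IsLocalized ((i : ℝ) / 4) 0 (ρ i) := fun i =>
    T.isLocalized_smoothTransition _ fun s hs => by linarith
  have hpos : ∀ t, 0 < ∑ i, ρ i t := by
    intro t
    obtain ⟨i, hi⟩ := exists_pos_neg_phaseCos (T := T) t
    refine Finset.sum_pos' (fun j _ => Real.smoothTransition.nonneg _) ⟨i, Finset.mem_univ _, ?_⟩
    exact Real.smoothTransition.pos_of_pos (by linarith)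
  have hsm : ∀ i, ContDiff ℝ ∞ fun t => ρ i t / ∑ j, ρ j t := fun i =>
    (hρ i).smooth.div (ContDiff.sum fun j _ => (hρ j).smooth) fun t => (hpos t).ne'
  have hpe : ∀ i t, ρ i (t + 2 * Real.pi / T.N) / ∑ j, ρ j (t + 2 * Real.pi / T.N)
      = ρ i t / ∑ j, ρ j t := fun i t => by simp only [(hρ _).periodic]
  have hξ : ξ = mulFun (hsm 0) (hpe 0) ξ + mulFun (hsm 1) (hpe 1) ξ + mulFun (hsm 2) (hpe 2) ξ +
      mulFun (hsm 3) (hpe 3) ξ := by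
    ext t
    simp only [add_apply, mulFun_apply, ← add_smul]
    rw [← add_div, ← add_div, ← add_div, ← Fin.sum_univ_four (fun i => ρ i t),
      div_self (hpos t).ne', one_smul]
  have hmem : ∀ i, mulFun (hsm i) (hpe i) ξ ∈ ⨆ i : Fin 4, localSubmodule T ((i : ℝ) / 4) :=
    fun i => Submodule.mem_iSup_of_mem i fun t ht => by
      rw [mulFun_apply, (hρ i).eq_zero t ht, zero_div, zero_smul]
  rw [hξ]
  exact add_mem (add_mem (add_mem (hmem 0) (hmem 1)) (hmem 2)) (hmem 3)

end TwistedLoop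

/-! ### Dominated functionals and averages of automorphisms -/

/-- Pointwise bounded families of linear functionals converge along ultrafilters. -/
theorem exists_linearMap_tendsto {ι V : Type*} [AddCommGroup V] [Module ℝ V] (l : Ultrafilter ι)
    {f : ι → V →ₗ[ℝ] ℝ} {b : V → ℝ} (hb : ∀ i u, |f i u| ≤ b u) :
    ∃ g : V →ₗ[ℝ] ℝ, ∀ u, Tendsto (fun i => f i u) l (𝓝 (g u)) := by
  have h : ∀ u, ∃ a : ℝ, Tendsto (fun i => f i u) l (𝓝 a) := by
    intro u
    have hc : IsCompact (Icc (-b u) (b u)) := isCompact_Icc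
    obtain ⟨a, -, ha⟩ := hc.ultrafilter_le_nhds (l.map fun i => f i u)
      (le_principal_iff.2 (Filter.mem_map.2 (Filter.univ_mem' fun i => abs_le.1 (hb i u))))
    exact ⟨a, ha⟩
  choose g hg using h
  refine ⟨{ toFun := g, map_add' := fun u v => ?_, map_smul' := fun c u => ?_ }, hg⟩
  · exact tendsto_nhds_unique (hg (u + v)) (by simpa using (hg u).add (hg v))
  · exact tendsto_nhds_unique (hg (c • u)) (by simpa using (hg u).const_mul c)

/-- Abel summation: differences pass from the values `b` to the weights `c`, whose increments are
controlled by `abs_pow_tent_sub_le`. -/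
theorem sum_mul_sub_eq (c b : ℕ → ℝ) (N : ℕ) :
    ∑ n ∈ Finset.range N, c n * (b (n + 1) - b n) =
      c N * b N - c 0 * b 0 - ∑ n ∈ Finset.range N, (c (n + 1) - c n) * b (n + 1) := by
  induction N with
  | zero => simp
  | succ N ih => rw [Finset.sum_range_succ, Finset.sum_range_succ, ih]; ring

/-- The weights `θ ^ min(n, 2M - n)` are nearly invariant under the shift. -/
theorem abs_pow_tent_sub_le {θ : ℝ} (hθ : 1 ≤ θ) {M n : ℕ} (hn : n < 2 * M) :
    |θ ^ min (n + 1) (2 * M - (n + 1)) - θ ^ min n (2 * M - n)| ≤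
      (θ - 1) * θ ^ min (n + 1) (2 * M - (n + 1)) := by
  have h0 : 0 ≤ θ - 1 := by linarith
  rcases lt_or_ge n M with h | h
  · have e1 : min (n + 1) (2 * M - (n + 1)) = n + 1 := by omega
    have e2 : min n (2 * M - n) = n := by omega
    have hp : (0 : ℝ) ≤ θ ^ n := by positivity
    have e : θ ^ (n + 1) - θ ^ n = (θ - 1) * θ ^ n := by ring
    rw [e1, e2, e, abs_of_nonneg (by positivity)]
    exact mul_le_mul_of_nonneg_left (pow_le_pow_right₀ hθ (Nat.le_succ n)) h0
  · have e1 : min n (2 * M - n) = min (n + 1) (2 * M - (n + 1)) + 1 := by omega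
    rw [e1]
    set j := min (n + 1) (2 * M - (n + 1))
    have hp : (0 : ℝ) ≤ θ ^ j := by positivity
    have e : θ ^ j - θ ^ (j + 1) = -((θ - 1) * θ ^ j) := by ring
    rw [e, abs_neg, abs_of_nonneg (by positivity)]

namespace HilbertLieAlgebra

variable {k : Type u} [HilbertLieAlgebra k]

/-- The equality case of the Cauchy–Schwarz inequality, since `expAd y` preserves the norm. -/
theorem expAd_eq_of_inner_eq {y z : k} (h : inner ℝ z (expAd y z) = ‖z‖ ^ 2) : expAd y z = z := by
  rw [← sub_eq_zero, ← norm_eq_zero, ← sq_eq_zero_iff, norm_sub_sq_real, norm_expAd,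
    real_inner_comm, h]
  ring

/-- The centre of a simple Hilbert–Lie algebra is trivial. -/
theorem IsSimple.eq_zero_of_forall_lie_eq_zero (hk : IsSimple k) {z : k}
    (hz : ∀ y : k, ⁅y, z⁆ = 0) : z = 0 := by
  set I : LieIdeal ℝ k := LieAlgebra.center ℝ k
  have hmem : ∀ w, w ∈ I ↔ ∀ y : k, ⁅y, w⁆ = 0 := fun w => LieModule.mem_maxTrivSubmodule (R := ℝ) (L := k) (M := k) w
  have hclosed : IsClosed (I : Set k) := by
    have : (I : Set k) = ⋂ y : k, {w | adL y w = 0} := by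
      ext w
      simp only [mem_iInter, mem_ofPred_eq, adL_apply]
      exact hmem w
    rw [this]
    exact isClosed_iInter fun y => isClosed_eq (adL y).continuous continuous_const
  rcases hk.2 I hclosed with h | h
  · have := (hmem z).2 hz
    rw [h] at this
    simpa using this
  · obtain ⟨x, y, hxy⟩ := hk.1
    have : y ∈ I := h ▸ LieSubmodule.mem_top y
    exact absurd ((hmem y).1 this x) hxy

end HilbertLieAlgebra

namespace TwistedLoop

open HilbertLieAlgebra

variable {k : Type u} [HilbertLieAlgebra k] {T : FiniteOrderAut k}

/-- The monoid generated by all `e^{ad η}`. -/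
noncomputable def adMonoid (T : FiniteOrderAut k) : Submonoid (Module.End ℝ (TwistedLoop T)) :=
  Submonoid.closure (range Ad)

theorem Ad_mem_adMonoid (η : TwistedLoop T) : Ad η ∈ adMonoid T :=
  Submonoid.subset_closure (mem_range_self η)

/-- The functionals `f` that vanish on `Z` and for which the values on the orbit of `x` dominate
those on the orbit of a `C^m` ball. -/
structure Dominated (m : ℕ) (x : TwistedLoop T) (Z : Submodule ℝ (TwistedLoop T))
    (f : TwistedLoop T →ₗ[ℝ] ℝ) : Prop where
  abs_le : ∀ S ∈ adMonoid T, ∀ (u : TwistedLoop T) (r : ℝ),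
    (∀ j ≤ m, ∀ t, ‖iteratedDeriv j u t‖ ≤ r) → |f (S u)| ≤ r * f (S x)
  eq_zero : ∀ z ∈ Z, f z = 0

variable {m : ℕ} {x : TwistedLoop T} {Z : Submodule ℝ (TwistedLoop T)} {f g : TwistedLoop T →ₗ[ℝ] ℝ}

theorem exists_iteratedDeriv_le (u : TwistedLoop T) (m : ℕ) :
    ∃ r : ℝ, ∀ j ≤ m, ∀ t, ‖iteratedDeriv j u t‖ ≤ r := by
  obtain ⟨C, -, hC⟩ := exists_norm_iteratedDeriv_le_of_periodic u.smooth
    (by positivity) u.periodic m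
  exact ⟨C, hC⟩

namespace Dominated

theorem nonneg (hf : Dominated m x Z f) : 0 ≤ f x := by
  have h := hf.abs_le 1 (one_mem _) 0 1 fun j _ t => by
    have : iteratedDeriv j (⇑(0 : TwistedLoop T)) t = 0 := by
      have e : (⇑(0 : TwistedLoop T) : ℝ → k) = fun _ => 0 := rfl
      rw [e, iteratedDeriv_const]
      split_ifs <;> rfl
    rw [this, norm_zero]
    exact zero_le_one
  simpa using (abs_nonneg _).trans h

theorem abs_le_of_jetBound (hf : Dominated m x Z f) {δ r : ℝ} (hδ : 0 < δ) (hδ1 : δ ≤ 1)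
    {u : TwistedLoop T} (hu : JetBound m δ r u) : |f u| ≤ m.factorial / δ ^ m * r * f x := by
  have h := hf.abs_le 1 (one_mem _) u _ fun j hj t => hu.norm_iteratedDeriv_le hδ hδ1 hj t
  exact h

theorem zero : Dominated m x Z (0 : TwistedLoop T →ₗ[ℝ] ℝ) :=
  ⟨fun S _ u r _ => by simp, fun z _ => rfl⟩

theorem add (hf : Dominated m x Z f) (hg : Dominated m x Z g) : Dominated m x Z (f + g) :=
  ⟨fun S hS u r hu => by
    rw [LinearMap.add_apply, LinearMap.add_apply, mul_add]
    exact (abs_add_le _ _).trans (add_le_add (hf.abs_le S hS u r hu) (hg.abs_le S hS u r hu)),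
  fun z hz => by rw [LinearMap.add_apply, hf.eq_zero z hz, hg.eq_zero z hz, add_zero]⟩

theorem smul (hf : Dominated m x Z f) {c : ℝ} (hc : 0 ≤ c) : Dominated m x Z (c • f) :=
  ⟨fun S hS u r hu => by
    rw [LinearMap.smul_apply, LinearMap.smul_apply, smul_eq_mul, smul_eq_mul, abs_mul,
      abs_of_nonneg hc, mul_left_comm]
    exact mul_le_mul_of_nonneg_left (hf.abs_le S hS u r hu) hc,
  fun z hz => by rw [LinearMap.smul_apply, hf.eq_zero z hz, smul_zero]⟩

theorem sum {ι : Type*} {s : Finset ι} {f : ι → TwistedLoop T →ₗ[ℝ] ℝ}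
    (h : ∀ i ∈ s, Dominated m x Z (f i)) : Dominated m x Z (∑ i ∈ s, f i) := by
  induction s using Finset.cons_induction with
  | empty => exact zero
  | cons a s ha ih =>
    rw [Finset.sum_cons]
    exact (h a (Finset.mem_cons_self a s)).add (ih fun i hi => h i (Finset.mem_cons_of_mem hi))

/-- Domination is demanded along whole `adMonoid` orbits so that this stability holds. -/
theorem comp (hf : Dominated m x Z f) {S : Module.End ℝ (TwistedLoop T)} (hS : S ∈ adMonoid T)
    (hZ : ∀ z ∈ Z, S z ∈ Z) : Dominated m x Z (f ∘ₗ S) :=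
  ⟨fun S' hS' u r hu => hf.abs_le (S * S') (mul_mem hS hS') u r hu,
    fun z hz => hf.eq_zero _ (hZ z hz)⟩

theorem of_tendsto {ι : Type*} {l : Filter ι} [l.NeBot] {F : ι → TwistedLoop T →ₗ[ℝ] ℝ}
    (hF : ∀ i, Dominated m x Z (F i)) (h : ∀ u, Tendsto (fun i => F i u) l (𝓝 (f u))) :
    Dominated m x Z f :=
  ⟨fun S hS u r hu => le_of_tendsto_of_tendsto (h _).abs ((h _).const_mul r)
      (Eventually.of_forall fun i => (hF i).abs_le S hS u r hu),
    fun z hz => tendsto_nhds_unique (h z) (by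
      simp only [(hF _).eq_zero z hz]; exact tendsto_const_nhds)⟩

/-- The normalised dominated functionals form a compact set. -/
theorem exists_tendsto {ι : Type*} (l : Filter ι) [l.NeBot] {F : ι → TwistedLoop T →ₗ[ℝ] ℝ}
    (hF : ∀ i, Dominated m x Z (F i)) (hx : ∀ i, F i x = 1) :
    ∃ (l' : Ultrafilter ι) (f : TwistedLoop T →ₗ[ℝ] ℝ), (l' : Filter ι) ≤ l ∧ Dominated m x Z f ∧
      f x = 1 ∧ ∀ u, Tendsto (fun i => F i u) l' (𝓝 (f u)) := by
  choose r hr using fun u : TwistedLoop T => exists_iteratedDeriv_le u m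
  obtain ⟨f, hf⟩ := exists_linearMap_tendsto (Ultrafilter.of l) (f := F) (b := r) fun i u => by
    have h := (hF i).abs_le 1 (one_mem _) u (r u) (hr u)
    simpa [hx] using h
  refine ⟨Ultrafilter.of l, f, Ultrafilter.of_le l, of_tendsto hF hf, ?_, hf⟩
  exact tendsto_nhds_unique (hf x) (by simp only [hx]; exact tendsto_const_nhds)

end Dominated

section Average

variable {ι : Type*} (s : Finset ι) (η : ι → TwistedLoop T)

/-- The average of finitely many automorphisms `e^{ad η}`. -/
noncomputable def averageAd : Module.End ℝ (TwistedLoop T) :=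
  (s.card : ℝ)⁻¹ • ∑ i ∈ s, Ad (η i)

theorem apply_averageAd (f : TwistedLoop T →ₗ[ℝ] ℝ) (u : TwistedLoop T) :
    f (averageAd s η u) = (s.card : ℝ)⁻¹ * ∑ i ∈ s, f (Ad (η i) u) := by
  simp [averageAd]

variable {s η}

theorem Dominated.comp_averageAd (hZ : ∀ η, ∀ z ∈ Z, Ad η z ∈ Z) (hf : Dominated m x Z f) :
    Dominated m x Z (f ∘ₗ averageAd s η) := by
  have h : f ∘ₗ averageAd s η = (s.card : ℝ)⁻¹ • ∑ i ∈ s, f ∘ₗ Ad (η i) := by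
    ext u
    simp [apply_averageAd]
  rw [h]
  exact (Dominated.sum fun i _ => hf.comp (Ad_mem_adMonoid (η i)) (hZ _)).smul (by positivity)

theorem Dominated.comp_averageAd_pow (hZ : ∀ η, ∀ z ∈ Z, Ad η z ∈ Z) (hf : Dominated m x Z f)
    (n : ℕ) : Dominated m x Z (f ∘ₗ (averageAd s η) ^ n) := by
  induction n with
  | zero => exact hf
  | succ n ih =>
    rw [pow_succ]
    exact Dominated.comp_averageAd hZ ih

/-- The values along the iterates of an average of automorphisms grow and decay
subexponentially. -/
theorem Dominated.exists_growth_bound (hs : s.Nonempty) (hZ : ∀ η, ∀ z ∈ Z, Ad η z ∈ Z) {ρ : ℝ}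
    (hρ : 1 < ρ) : ∃ K : ℝ, 0 < K ∧ ∀ f, Dominated m x Z f → ∀ n : ℕ,
      f ((averageAd s η ^ n) x) ≤ K * ρ ^ n * f x ∧
      f x ≤ K * ρ ^ n * f ((averageAd s η ^ n) x) := by
  have hcard : (0 : ℝ) < s.card := by exact_mod_cast hs.card_pos
  have hev : ∀ᶠ δ in 𝓝[>] (0 : ℝ), (∀ i ∈ s, ∀ ξ : TwistedLoop T, ∀ r, JetBound m δ r ξ →
      JetBound m δ (ρ * r) (Ad (η i) ξ)) ∧ (∀ i ∈ s, ∀ ξ : TwistedLoop T, ∀ r, JetBound m δ r ξ →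
      JetBound m δ (ρ * r) (Ad (-η i) ξ)) :=
    ((s.eventually_all).2 fun i _ => eventually_jetBound_Ad (η i) m hρ).and
      ((s.eventually_all).2 fun i _ => eventually_jetBound_Ad (-η i) m hρ)
  -- One weight δ serves all the finitely many operators e^{± ad η_i}: each enlarges the weighted
  -- norm at most by the factor ρ.
  obtain ⟨δ, ⟨hA, hB⟩, hδ0, hδ1⟩ :=
    (hev.and (Ioc_mem_nhdsGT (zero_lt_one (α := ℝ)))).exists
  obtain ⟨r₀, hr₀, hr⟩ := exists_jetBound x m
  have hx := hr δ hδ0.le hδ1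
  set K₀ : ℝ := m.factorial / δ ^ m with hK₀
  have hK₀pos : 0 < K₀ := by positivity
  have up : ∀ n : ℕ, ∀ f, Dominated m x Z f → ∀ (v : TwistedLoop T) r, JetBound m δ r v →
      |f ((averageAd s η ^ n) v)| ≤ K₀ * ρ ^ n * r * f x := by
    intro n
    induction n with
    | zero => intro f hf v r hv; simpa using hf.abs_le_of_jetBound hδ0 hδ1 hv
    | succ n ih =>
      intro f hf v r hv
      have e : f ((averageAd s η ^ (n + 1)) v) =
          (s.card : ℝ)⁻¹ * ∑ i ∈ s, f ((averageAd s η ^ n) (Ad (η i) v)) := by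
        rw [pow_succ]
        exact apply_averageAd s η (f ∘ₗ averageAd s η ^ n) v
      rw [e, abs_mul, abs_of_nonneg (by positivity), inv_mul_le_iff₀ hcard]
      calc _ ≤ ∑ i ∈ s, |f ((averageAd s η ^ n) (Ad (η i) v))| := Finset.abs_sum_le_sum_abs _ _
        _ ≤ ∑ i ∈ s, K₀ * ρ ^ n * (ρ * r) * f x :=
            Finset.sum_le_sum fun i hi => ih f hf _ _ (hA i hi v r hv)
        _ = _ := by rw [Finset.sum_const, nsmul_eq_mul]; ring
  -- The lower bound uses inverses: f(v) = (f ∘ Ad(η_i))(Ad(−η_i)v) for each i, the induction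
  -- hypothesis applies to f ∘ Ad(η_i), and the inequalities are averaged over i.
  have low : ∀ n : ℕ, ∀ f, Dominated m x Z f → ∀ (v : TwistedLoop T) r, JetBound m δ r v →
      f v ≤ K₀ * ρ ^ n * r * f ((averageAd s η ^ n) x) := by
    intro n
    induction n with
    | zero =>
      intro f hf v r hv
      simpa using (le_abs_self _).trans (hf.abs_le_of_jetBound hδ0 hδ1 hv)
    | succ n ih =>
      intro f hf v r hv
      have e : f ((averageAd s η ^ (n + 1)) x) =
          (s.card : ℝ)⁻¹ * ∑ i ∈ s, f (Ad (η i) ((averageAd s η ^ n) x)) := by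
        rw [pow_succ']
        exact apply_averageAd s η f _
      have h1 : ∀ i ∈ s, f v ≤ K₀ * ρ ^ n * (ρ * r) * f (Ad (η i) ((averageAd s η ^ n) x)) := by
        intro i hi
        have h := ih (f ∘ₗ Ad (η i)) (hf.comp (Ad_mem_adMonoid _) (hZ _)) _ _ (hB i hi v r hv)
        simp only [LinearMap.comp_apply, Ad_Ad_neg] at h
        exact h
      have h2 := Finset.sum_le_sum h1
      rw [Finset.sum_const, nsmul_eq_mul, ← Finset.mul_sum] at h2
      rw [e]
      calc f v = (s.card : ℝ)⁻¹ * (s.card * f v) := by field_simp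
        _ ≤ (s.card : ℝ)⁻¹ * (K₀ * ρ ^ n * (ρ * r) *
            ∑ i ∈ s, f (Ad (η i) ((averageAd s η ^ n) x))) := by gcongr
        _ = _ := by ring
  refine ⟨K₀ * r₀, by positivity, fun f hf n => ⟨?_, ?_⟩⟩
  · refine (le_abs_self _).trans ((up n f hf x r₀ hx).trans (le_of_eq (by ring)))
  · exact (low n f hf x r₀ hx).trans (le_of_eq (by ring))

/-- A normalised weighted sum of the functionals g ∘ Aⁿ. The numbers g(Aⁿx) may grow or decay up to
the rate ρ^{±n}, so boundary terms could spoil a plain Cesàro mean; tent weights θ^min(n, 2M − n)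
make the centre dominate. -/
theorem Dominated.exists_almost_invariant (hs : s.Nonempty) (hZ : ∀ η, ∀ z ∈ Z, Ad η z ∈ Z)
    (hg : Dominated m x Z g) (hgx : g x = 1) {ε : ℝ} (hε : 0 < ε) :
    ∃ f, Dominated m x Z f ∧ f x = 1 ∧ ∀ (u : TwistedLoop T) (r : ℝ),
      (∀ j ≤ m, ∀ t, ‖iteratedDeriv j u t‖ ≤ r) → |f (averageAd s η u) - f u| ≤ ε * r := by
  set A := averageAd s η
  obtain ⟨ρ, hρ, hρε⟩ : ∃ ρ : ℝ, 1 < ρ ∧ ρ ^ 4 - 1 < ε / 3 := by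
    have hc : Tendsto (fun ρ : ℝ => ρ ^ 4 - 1) (𝓝[>] 1) (𝓝 0) := by
      have h : Continuous fun ρ : ℝ => ρ ^ 4 - 1 := by fun_prop
      have := (h.tendsto 1).mono_left (nhdsWithin_le_nhds (s := Ioi 1))
      simpa using this
    obtain ⟨ρ, h1, h2⟩ := ((hc.eventually (gt_mem_nhds (by positivity : 0 < ε / 3))).and
      self_mem_nhdsWithin).exists
    exact ⟨ρ, h2, h1⟩
  have hρ0 : 0 < ρ := by linarith
  -- The central term is at least θ^M/(Kρ^M), while the boundary terms are of order ρ^{2M}. With θ =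
  -- ρ⁴ their quotient is of order ρ^{−M}, and θ − 1 < ε/3 keeps the weights almost shift invariant.
  set θ := ρ ^ 4 with hθ
  have hθ1 : 1 < θ := one_lt_pow₀ hρ (by norm_num)
  have hθ0 : 0 < θ := by linarith
  obtain ⟨K, hK, hgrow⟩ := Dominated.exists_growth_bound (m := m) (x := x) (η := η) hs hZ hρ
  have hup : ∀ n, g ((A ^ n) x) ≤ K * ρ ^ n := fun n => by
    have := (hgrow g hg n).1; rwa [hgx, mul_one] at this
  have hlow : ∀ n, 1 ≤ K * ρ ^ n * g ((A ^ n) x) := fun n => by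
    have := (hgrow g hg n).2; rwa [hgx] at this
  have hlim : Tendsto (fun M : ℕ => (θ * K + 1) * K * (ρ⁻¹) ^ M) atTop (𝓝 0) := by
    have := (tendsto_pow_atTop_nhds_zero_of_lt_one (by positivity)
      (inv_lt_one_of_one_lt₀ hρ)).const_mul ((θ * K + 1) * K)
    simpa using this
  obtain ⟨M, hM, hM1⟩ := ((hlim.eventually (gt_mem_nhds (by positivity : 0 < ε / 3))).and
    (eventually_ge_atTop 1)).exists
  set c : ℕ → ℝ := fun n => θ ^ min n (2 * M - n) with hc
  have hcpos : ∀ n, 0 < c n := fun n => by positivity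
  set a : ℕ → ℝ := fun n => g ((A ^ n) x) with ha
  have hdom : ∀ n, Dominated m x Z (g ∘ₗ A ^ n) := fun n => hg.comp_averageAd_pow hZ n
  have ha0 : ∀ n, 0 ≤ a n := fun n => (hdom n).nonneg
  set F : TwistedLoop T →ₗ[ℝ] ℝ := ∑ n ∈ Finset.range (2 * M), c n • (g ∘ₗ A ^ n) with hF
  have hFapp : ∀ u, F u = ∑ n ∈ Finset.range (2 * M), c n * g ((A ^ n) u) := fun u => by
    simp [hF]
  have hFdom : Dominated m x Z F := Dominated.sum fun n _ => (hdom n).smul (hcpos n).le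
  have hFx : θ ^ M / (K * ρ ^ M) ≤ F x := by
    have h1 : c M * a M ≤ F x := by
      rw [hFapp]
      exact Finset.single_le_sum (f := fun n => c n * a n)
        (fun n _ => mul_nonneg (hcpos n).le (ha0 n)) (Finset.mem_range.2 (by omega))
    have h2 : c M = θ ^ M := by
      simp only [hc]; congr 1; omega
    rw [h2] at h1
    refine le_trans ?_ h1
    rw [div_le_iff₀ (by positivity)]
    have := mul_le_mul_of_nonneg_left (hlow M) (by positivity : 0 ≤ θ ^ M)
    calc θ ^ M ≤ θ ^ M * (K * ρ ^ M * g ((A ^ M) x)) := by simpa using this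
      _ = _ := by ring
  have hFx0 : 0 < F x := lt_of_lt_of_le (by positivity) hFx
  have hbdry : θ * a (2 * M) + a 0 ≤ ε / 3 * F x := by
    have h1 : θ * a (2 * M) + a 0 ≤ (θ * K + 1) * ρ ^ (2 * M) := by
      have e0 : a 0 = 1 := by simp [ha, hgx]
      have h2 : (1 : ℝ) ≤ ρ ^ (2 * M) := one_le_pow₀ hρ.le
      have h3 := mul_le_mul_of_nonneg_left (hup (2 * M)) hθ0.le
      rw [e0]
      have h4 : a (2 * M) = g ((A ^ (2 * M)) x) := rfl
      rw [h4]
      nlinarith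
    have h2 : (θ * K + 1) * ρ ^ (2 * M) =
        (θ * K + 1) * K * (ρ⁻¹) ^ M * (θ ^ M / (K * ρ ^ M)) := by
      have e : θ ^ M = ρ ^ (2 * M) * ρ ^ M * ρ ^ M := by rw [hθ]; ring
      rw [e, inv_pow]
      field_simp
    rw [h2] at h1
    refine h1.trans ?_
    exact mul_le_mul hM.le hFx (by positivity) (by positivity)
  have hdiff : ∀ (u : TwistedLoop T) (r : ℝ),
      (∀ j ≤ m, ∀ t, ‖iteratedDeriv j u t‖ ≤ r) → |F (A u) - F u| ≤ ε * r * F x := by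
    intro u r hu
    have hr0 : 0 ≤ r := (norm_nonneg _).trans (hu 0 (Nat.zero_le _) 0)
    set b : ℕ → ℝ := fun n => g ((A ^ n) u) with hb
    have hbn : ∀ n, |b n| ≤ r * a n := fun n => (hdom n).abs_le 1 (one_mem _) u r hu
    have e1 : F (A u) - F u = ∑ n ∈ Finset.range (2 * M), c n * (b (n + 1) - b n) := by
      rw [hFapp, hFapp, ← Finset.sum_sub_distrib]
      refine Finset.sum_congr rfl fun n _ => ?_
      simp only [hb]
      rw [pow_succ, Module.End.mul_apply]
      ring
    have hc0 : c 0 = 1 := by simp [hc]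
    have hcM : c (2 * M) = 1 := by simp [hc]
    have h1 : |∑ n ∈ Finset.range (2 * M), (c (n + 1) - c n) * b (n + 1)|
        ≤ (θ - 1) * r * (F x + a (2 * M)) := by
      calc _ ≤ ∑ n ∈ Finset.range (2 * M), |(c (n + 1) - c n) * b (n + 1)| :=
            Finset.abs_sum_le_sum_abs _ _
        _ ≤ ∑ n ∈ Finset.range (2 * M), (θ - 1) * r * (c (n + 1) * a (n + 1)) := by
            refine Finset.sum_le_sum fun n hn => ?_
            rw [abs_mul]
            have h := mul_le_mul (abs_pow_tent_sub_le hθ1.le (Finset.mem_range.1 hn))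
              (hbn (n + 1)) (abs_nonneg _)
              (mul_nonneg (by linarith) (hcpos (n + 1)).le)
            exact h.trans (le_of_eq (by simp only [hc]; ring))
        _ = (θ - 1) * r * ∑ n ∈ Finset.range (2 * M), c (n + 1) * a (n + 1) := by
            rw [Finset.mul_sum]
        _ ≤ _ := by
            refine mul_le_mul_of_nonneg_left ?_ (mul_nonneg (by linarith) hr0)
            have h2 := Finset.sum_range_succ' (fun n => c n * a n) (2 * M)
            rw [Finset.sum_range_succ, hc0, hcM, ← hFapp] at h2
            have := ha0 0
            linarith
    rw [e1, sum_mul_sub_eq, hc0, hcM, one_mul, one_mul]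
    have h3 := hbn (2 * M)
    have h4 := hbn 0
    calc _ ≤ |b (2 * M)| + |b 0| +
          |∑ n ∈ Finset.range (2 * M), (c (n + 1) - c n) * b (n + 1)| :=
          (abs_sub _ _).trans (add_le_add_left (abs_sub _ _) _)
      _ ≤ r * a (2 * M) + r * a 0 + (θ - 1) * r * (F x + a (2 * M)) := by gcongr
      _ = r * ((θ - 1) * F x + (θ * a (2 * M) + a 0)) := by ring
      _ ≤ r * (ε / 3 * F x + ε / 3 * F x) := by
          gcongr
      _ ≤ _ := by nlinarith [mul_nonneg hr0 hFx0.le, mul_nonneg (mul_nonneg hr0 hFx0.le) hε.le]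
  refine ⟨(F x)⁻¹ • F, hFdom.smul (by positivity), by simp [hFx0.ne'], fun u r hu => ?_⟩
  rw [LinearMap.smul_apply, LinearMap.smul_apply, smul_eq_mul, smul_eq_mul, ← mul_sub, abs_mul,
    abs_of_nonneg (by positivity), inv_mul_le_iff₀ hFx0]
  exact (hdiff u r hu).trans (le_of_eq (by ring))

/-- Compactness of the normalised dominated functionals turns almost invariance with ε = 1/(n + 1)
into invariance. -/
theorem Dominated.exists_invariant (hs : s.Nonempty) (hZ : ∀ η, ∀ z ∈ Z, Ad η z ∈ Z)
    (hg : Dominated m x Z g) (hgx : g x = 1) :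
    ∃ f, Dominated m x Z f ∧ f x = 1 ∧ ∀ u, f (averageAd s η u) = f u := by
  choose F hF hFx hFA using fun n : ℕ => hg.exists_almost_invariant (s := s) (η := η) hs hZ hgx
    (ε := 1 / ((n : ℝ) + 1)) (by positivity)
  obtain ⟨l, f, hl, hf, hfx, hlim⟩ := Dominated.exists_tendsto atTop hF hFx
  refine ⟨f, hf, hfx, fun u => ?_⟩
  obtain ⟨r, hr⟩ := exists_iteratedDeriv_le u m
  have h1 : Tendsto (fun n => F n (averageAd s η u) - F n u) l (𝓝 0) := by
    refine squeeze_zero_norm (fun n => hFA n u r hr) ?_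
    have := (tendsto_one_div_add_atTop_nhds_zero_nat (𝕜 := ℝ)).mul_const r
    rw [zero_mul] at this
    exact this.mono_left hl
  have h2 := tendsto_nhds_unique h1 ((hlim (averageAd s η u)).sub (hlim u))
  linarith

end Average

end TwistedLoop

/-! ### Vanishing of dominated functionals, arc by arc -/

namespace TwistedLoop

open HilbertLieAlgebra

variable {k : Type u} [HilbertLieAlgebra k] {T : FiniteOrderAut k}
  {m : ℕ} {x : TwistedLoop T} {Z : Submodule ℝ (TwistedLoop T)} {f g : TwistedLoop T →ₗ[ℝ] ℝ}
  {α : ℝ}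

/-- A dominated functional restricted to bumps is represented by a vector. -/
theorem Dominated.exists_inner_eq_bump (hf : Dominated m x Z f) {ψ : ℝ → ℝ}
    (hψ : T.IsLocalized α (1 / 2) ψ) : ∃ z : k, ∀ v, f (bump hψ v) = inner ℝ z v := by
  obtain ⟨C, hC0, hC⟩ := exists_jetBound_bump hψ m
  set L : k →L[ℝ] ℝ := LinearMap.mkContinuous (f ∘ₗ bump hψ)
    (m.factorial / 1 ^ m * C * f x) fun v => by
      refine (hf.abs_le_of_jetBound one_pos le_rfl (hC 1 zero_le_one le_rfl v)).trans
        (le_of_eq ?_)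
      ring
  exact ⟨(InnerProductSpace.toDual ℝ k).symm L, fun v =>
    (InnerProductSpace.toDual_symm_apply (x := v) (y := L)).symm⟩

/-- On bumps with profile ψ the functional is ⟨z, ·⟩. Invariance under the average says that the
mean of ⟨z, `expAd y` z⟩ over `s` is ‖z‖², and no term exceeds this value; so each term attains it
and z is fixed by every `expAd y`. -/
theorem Dominated.exists_bump_expAd_eq_of_mem (hZ : ∀ η, ∀ z ∈ Z, Ad η z ∈ Z)
    (hg : Dominated m x Z g) (hgx : g x = 1) (α : ℝ) {s : Finset k} (hs : s.Nonempty) :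
    ∃ f, Dominated m x Z f ∧ f x = 1 ∧ ∀ ψ (_ : T.IsLocalized α 0 ψ)
      (hψ : T.IsLocalized α (1 / 2) ψ), ∀ y ∈ s, ∀ w, f (bump hψ (expAd y w)) = f (bump hψ w) := by
  have hχ : T.IsLocalized α (1 / 2) fun t => Real.smoothTransition (1 + (-2) * T.phaseCos α t) :=
    T.isLocalized_smoothTransition α fun c hc => by linarith
  obtain ⟨f, hf, hfx, hfA⟩ := hg.exists_invariant (s := s) (η := fun y => bump hχ y) hs hZ hgx
  refine ⟨f, hf, hfx, fun ψ hψ0 hψ y hy w => ?_⟩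
  have hcard : (0 : ℝ) < s.card := by exact_mod_cast hs.card_pos
  have hAd : ∀ y v, Ad (bump hχ y) (bump hψ v) = bump hψ (expAd y v) :=
    Ad_bump_bump hχ hψ fun t ht => by
      refine Real.smoothTransition.one_of_one_le ?_
      by_contra hlt
      exact ht (hψ0.eq_zero t (by linarith))
  obtain ⟨z, hz⟩ := hf.exists_inner_eq_bump hψ
  have havg : ∑ y ∈ s, (inner ℝ z (expAd y z) : ℝ) = ∑ y ∈ s, ‖z‖ ^ 2 := by
    have h := hfA (bump hψ z)
    rw [apply_averageAd, inv_mul_eq_iff_eq_mul₀ hcard.ne'] at h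
    simp only [hAd, hz, real_inner_self_eq_norm_sq] at h
    rw [h, Finset.sum_const, nsmul_eq_mul]
  have hle : ∀ y ∈ s, (inner ℝ z (expAd y z) : ℝ) ≤ ‖z‖ ^ 2 := fun y _ => by
    have := real_inner_le_norm z (expAd y z)
    rwa [norm_expAd, ← sq] at this
  have hfix := expAd_eq_of_inner_eq ((Finset.sum_eq_sum_iff_of_le hle).1 havg y hy)
  rw [hz, hz, ← inner_expAd y z w, hfix]

/-- A limit over the finite subsets, directed by inclusion, is invariant for all `y` at once. Its
vector z is fixed by all e^{ad sy}, hence central, hence 0. -/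
theorem Dominated.exists_bump_eq_zero (hk : IsSimple k) (hZ : ∀ η, ∀ z ∈ Z, Ad η z ∈ Z)
    (hg : Dominated m x Z g) (hgx : g x = 1) (α : ℝ) :
    ∃ f, Dominated m x Z f ∧ f x = 1 ∧ ∀ ψ (_ : T.IsLocalized α 0 ψ)
      (hψ : T.IsLocalized α (1 / 2) ψ), ∀ v, f (bump hψ v) = 0 := by
  classical
  -- Inserting 0 keeps the set nonempty and is harmless, since `expAd 0` is the identity.
  choose F hF hFx hFψ using fun s : Finset k =>
    hg.exists_bump_expAd_eq_of_mem hZ hgx α (s := insert 0 s) (Finset.insert_nonempty _ _)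
  obtain ⟨l, f, hl, hf, hfx, hlim⟩ := Dominated.exists_tendsto atTop hF hFx
  refine ⟨f, hf, hfx, fun ψ hψ0 hψ v => ?_⟩
  have hinv : ∀ y w, f (bump hψ (expAd y w)) = f (bump hψ w) := by
    intro y w
    refine tendsto_nhds_unique_of_eventuallyEq (hlim _) (hlim _) ?_
    filter_upwards [hl (eventually_ge_atTop {y})] with s hs
    exact hFψ s ψ hψ0 hψ y (Finset.mem_insert_of_mem (hs (Finset.mem_singleton_self y))) w
  obtain ⟨z, hz⟩ := hf.exists_inner_eq_bump hψ
  have hfix : ∀ y, expAd y z = z := fun y => expAd_eq_of_inner_eq (by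
    rw [← hz, hinv, hz, real_inner_self_eq_norm_sq])
  have hz0 : z = 0 := hk.eq_zero_of_forall_lie_eq_zero fun y =>
    lie_eq_zero_of_expAd_smul_eq fun s => hfix (s • y)
  rw [hz, hz0, inner_zero_left]

/-- Finite sums of bumps approximate a loop on the arc in a C^m norm for which `f` is bounded, so
vanishing spreads from bumps to the arc. Zeros on `Z` persist, which allows the arcs to be treated
in turn. -/
theorem Dominated.exists_sup_localSubmodule (hk : IsSimple k) (hZ : ∀ η, ∀ z ∈ Z, Ad η z ∈ Z)
    (hg : Dominated m x Z g) (hgx : g x = 1) (α : ℝ) :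
    ∃ f, Dominated m x (Z ⊔ localSubmodule T α) f ∧ f x = 1 := by
  obtain ⟨f, hf, hfx, hf0⟩ := hg.exists_bump_eq_zero hk hZ hgx α
  refine ⟨f, ⟨hf.abs_le, fun z hz => ?_⟩, hfx⟩
  have hle : Z ⊔ localSubmodule T α ≤ LinearMap.ker f := by
    refine sup_le (fun z hz => hf.eq_zero z hz) fun ξ hξ => ?_
    rw [LinearMap.mem_ker, ← abs_eq_zero]
    refine le_antisymm (le_of_forall_pos_le_add fun ε hε => ?_) (abs_nonneg _)
    obtain ⟨n, ψ, hψ0, hψ, b, hJ⟩ := exists_bump_approx hξ m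
      (by positivity : 0 < ε / m.factorial)
    have h := hf.abs_le_of_jetBound one_pos le_rfl (hJ 1 zero_le_one le_rfl)
    rw [map_sub, map_sum, Finset.sum_eq_zero fun i _ => hf0 _ (hψ0 i) (hψ i) (b i), sub_zero,
      hfx] at h
    refine h.trans (le_of_eq ?_)
    field_simp
    simp
  exact hle hz

/-- No nonzero functional is dominated. -/
theorem Dominated.apply_eq_zero (hk : IsSimple k) (hg : Dominated m x Z g) : g x = 0 := by
  by_contra hne
  have hZsup : ∀ Z : Submodule ℝ (TwistedLoop T), (∀ η, ∀ z ∈ Z, Ad η z ∈ Z) → ∀ α : ℝ,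
      ∀ η, ∀ z ∈ Z ⊔ localSubmodule T α, Ad η z ∈ Z ⊔ localSubmodule T α := by
    intro Z hZ α η
    refine sup_le (c := (Z ⊔ localSubmodule T α).comap (Ad η)) (fun z hz => ?_) fun z hz => ?_
    · exact Submodule.mem_sup_left (hZ η z hz)
    · exact Submodule.mem_sup_right (Ad_mem_localSubmodule hz η)
  have h0 : ∀ η, ∀ z ∈ (⊥ : Submodule ℝ (TwistedLoop T)), Ad η z ∈ (⊥ : Submodule ℝ _) := by
    intro η z hz
    rw [Submodule.mem_bot] at hz ⊢
    rw [hz, map_zero]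
  have hg0 : Dominated m x ⊥ ((g x)⁻¹ • g) := by
    refine Dominated.smul ⟨hg.abs_le, fun z hz => ?_⟩ (inv_nonneg.2 hg.nonneg)
    rw [(Submodule.mem_bot ℝ).1 hz, map_zero]
  have hg1 : ((g x)⁻¹ • g) x = 1 := inv_mul_cancel₀ hne
  -- Each step adds an arc and changes the functional, but keeps the old zeros and the value 1 at
  -- `x`.
  have key : ∀ n : ℕ, ∃ (Z : Submodule ℝ (TwistedLoop T)) (f : TwistedLoop T →ₗ[ℝ] ℝ),
      (∀ η, ∀ z ∈ Z, Ad η z ∈ Z) ∧ (∀ i < n, localSubmodule T ((i : ℝ) / 4) ≤ Z) ∧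
      Dominated m x Z f ∧ f x = 1 := by
    intro n
    induction n with
    | zero => exact ⟨⊥, _, h0, fun i hi => absurd hi (Nat.not_lt_zero i), hg0, hg1⟩
    | succ n ih =>
      obtain ⟨Z, f, hZ, hle, hf, hfx⟩ := ih
      obtain ⟨f', hf', hfx'⟩ := hf.exists_sup_localSubmodule hk hZ hfx ((n : ℝ) / 4)
      refine ⟨_, f', hZsup Z hZ _, fun i hi => ?_, hf', hfx'⟩
      rcases Nat.lt_succ_iff_lt_or_eq.1 hi with h | rfl
      · exact (hle i h).trans le_sup_left
      · exact le_sup_right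
  obtain ⟨Z, f, -, hle, hf, hfx⟩ := key 4
  have htop : Z = ⊤ := by
    rw [eq_top_iff, ← iSup_localSubmodule]
    exact iSup_le fun i => hle i i.2
  have := hf.eq_zero x (htop ▸ Submodule.mem_top)
  rw [hfx] at this
  exact one_ne_zero this

/-- A linear functional whose values on the orbit of a point dominate its values on the orbit of a
neighbourhood of zero vanishes at that point. -/
theorem apply_eq_zero_of_dominates (hk : IsSimple k) {U : Set (TwistedLoop T)} (hU : U ∈ 𝓝 0)
    {x : TwistedLoop T} {g : TwistedLoop T →ₗ[ℝ] ℝ}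
    (h : ∀ S ∈ adMonoid T, ∀ u ∈ U, |g (S u)| ≤ g (S x)) : g x = 0 := by
  obtain ⟨m, r₀, hr₀, hU'⟩ := exists_norm_iteratedDeriv_le_imp_mem hU
  -- `Dominated` is normalised to the unit C^m ball, whereas `U` contains the ball of radius r₀;
  -- rescaling `x` accounts for this.
  have hdom : Dominated m (r₀⁻¹ • x) ⊥ g := by
    refine ⟨fun S hS u r hu => ?_, fun z hz => by rw [(Submodule.mem_bot ℝ).1 hz, map_zero]⟩
    -- The enlarged radius r' permits division also when r = 0; afterwards r' decreases to r.
    have hscale : ∀ r' > r, |g (S u)| ≤ r' * g (S (r₀⁻¹ • x)) := by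
      intro r' hr'
      have hr0 : 0 ≤ r := (norm_nonneg _).trans (hu 0 (Nat.zero_le _) 0)
      have hr0' : 0 < r' := hr0.trans_lt hr'
      have hmem : (r₀ / r') • u ∈ U := by
        refine hU' _ fun j hj t => ?_
        have e : iteratedDeriv j (⇑((r₀ / r') • u)) t = (r₀ / r') • iteratedDeriv j u t := by
          rw [coe_smul]
          exact iteratedDeriv_const_smul_field _ _
        rw [e, norm_smul, Real.norm_eq_abs, abs_of_nonneg (by positivity)]
        calc r₀ / r' * ‖iteratedDeriv j u t‖ ≤ r₀ / r' * r' := by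
              gcongr
              exact (hu j hj t).trans hr'.le
          _ = r₀ := by field_simp
      have h1 := h S hS _ hmem
      rw [map_smul, map_smul, smul_eq_mul, abs_mul, abs_of_nonneg (by positivity)] at h1
      rw [map_smul, map_smul, smul_eq_mul]
      calc |g (S u)| = r' / r₀ * (r₀ / r' * |g (S u)|) := by field_simp
        _ ≤ r' / r₀ * g (S x) := by gcongr
        _ = _ := by ring
    have hc : Tendsto (fun r' : ℝ => r' * g (S (r₀⁻¹ • x))) (𝓝[>] r)
        (𝓝 (r * g (S (r₀⁻¹ • x)))) :=
      ((continuous_id.mul continuous_const).tendsto r).mono_left nhdsWithin_le_nhds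
    exact ge_of_tendsto hc (by filter_upwards [self_mem_nhdsWithin] with r' hr' using hscale r' hr')
  have h0 := hdom.apply_eq_zero hk
  rw [map_smul, smul_eq_mul] at h0
  exact (mul_eq_zero.1 h0).resolve_left (by positivity)

end TwistedLoop

theorem HasVelocity.clm {E F : Type*} [AddCommGroup E] [Module ℝ E] [TopologicalSpace E]
    [AddCommGroup F] [Module ℝ F] [TopologicalSpace F] {γ : ℝ → E} {y : E} (h : HasVelocity γ y)
    (L : E →L[ℝ] F) : HasVelocity (fun t => L (γ t)) (L y) := by
  refine ((L.continuous.tendsto _).comp h).congr fun t => ?_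
  simp

theorem hasVelocity_line {E : Type*} [AddCommGroup E] [Module ℝ E] [TopologicalSpace E]
    (x y : E) (s : ℝ) : HasVelocity (fun t : ℝ => x + (s + t) • y) y := by
  refine tendsto_const_nhds.congr' ?_
  filter_upwards [self_mem_nhdsWithin] with t ht
  have ht : t ≠ 0 := ht
  rw [add_zero, add_sub_add_left_eq_sub, ← sub_smul, add_sub_cancel_left, smul_smul,
    inv_mul_cancel₀ ht, one_smul]

/-! ### Loops of nonconstant norm and the cocycle -/

namespace TwistedLoop

open HilbertLieAlgebra

variable {k : Type u} [HilbertLieAlgebra k] {T : FiniteOrderAut k}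

/-- Supplies the perturbation for `exists_mem_nonconstant_norm_sq`. The factor 1 − cos(Nt) vanishes
at 0 and is 2 half a period later. -/
theorem exists_nonconstant_norm_sq (hk : IsSimple k) : ∃ (θ : TwistedLoop T) (t₀ t₁ : ℝ),
    θ t₀ = 0 ∧ θ t₁ ≠ 0 := by
  obtain ⟨x, y, hxy⟩ := hk.1
  have hx : x ≠ 0 := by
    rintro rfl
    exact hxy (zero_lie y)
  set t₁ : ℝ := (2 * Real.pi / T.N) / 2
  obtain ⟨ξ, hξ⟩ := exists_apply_eq (T := T) t₁ x
  refine ⟨mulFun (ρ := fun t => 1 - T.phaseCos 0 t) (contDiff_const.sub (T.contDiff_phaseCos 0))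
    (fun t => by rw [T.phaseCos_add_period]) ξ, 0, t₁, ?_, ?_⟩
  · simp [FiniteOrderAut.phaseCos, FiniteOrderAut.phase]
  · have hN : (T.N : ℝ) ≠ 0 := by exact_mod_cast T.N_pos.ne'
    have hph : 2 * Real.pi * T.phase 0 t₁ = Real.pi := by
      have := Real.pi_pos.ne'
      simp only [FiniteOrderAut.phase, t₁]
      field_simp
      ring
    rw [mulFun_apply, hξ, FiniteOrderAut.phaseCos, hph, Real.cos_pi]
    exact smul_ne_zero (by norm_num) hx

/-- The loops commuting with `ξ` pair nontrivially with `ξ` if `‖ξ‖` is not constant. -/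
theorem exists_lie_eq_zero_cocycle_ne_zero (ξ : TwistedLoop T) {t₀ t₁ : ℝ}
    (h : ‖ξ t₀‖ ^ 2 ≠ ‖ξ t₁‖ ^ 2) :
    ∃ η : TwistedLoop T, ⁅η, ξ⁆ = 0 ∧ cocycle η ξ ≠ 0 := by
  set f : ℝ → ℝ := fun t => ‖ξ t‖ ^ 2 with hf
  have hfs : ContDiff ℝ ∞ f := ξ.smooth.norm_sq ℝ
  have hfd : ∀ t, deriv f t = 2 * inner ℝ (ξ t) (deriv ξ t) := fun t => (ξ.hasDerivAt t).norm_sq.deriv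
  have hfds : ContDiff ℝ ∞ (deriv f) := ((contDiff_infty_iff_deriv (f := f)).1 hfs).2
  have hper : ∀ t, f (t + 2 * Real.pi / T.N) = f t := fun t => by
    simp only [hf]
    rw [ξ.twist]
    have : ‖T.φ.symm (ξ t)‖ = ‖ξ t‖ := T.isom.symm.norm_map (ξ t)
    rw [this]
  have hdper : ∀ t, deriv f (t + 2 * Real.pi / T.N) = deriv f t := fun t => by
    have := periodic_iteratedDeriv hper 1 t
    rwa [iteratedDeriv_one] at this
  have hdper' : Function.Periodic (deriv f) (2 * Real.pi) := by
    have := periodic_iteratedDeriv (u := f) (p := 2 * Real.pi)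
      (fun t => by simp only [hf, ξ.periodic]) 1
    rwa [iteratedDeriv_one] at this
  -- η = (‖ξ‖²)' ξ is a pointwise multiple of ξ, so the bracket vanishes, while ω(ξ, η) = (1/4π)∫
  -- ((‖ξ‖²)')² is positive.
  refine ⟨mulFun hfds hdper ξ, ext fun t => by simp, ?_⟩
  rw [cocycle_skew ξ, neg_ne_zero]
  unfold cocycle
  have hint : ∀ t, inner ℝ (deriv ξ t) (mulFun hfds hdper ξ t) = (1 / 2 : ℝ) * (deriv f t) ^ 2 := by
    intro t
    rw [mulFun_apply, inner_smul_right, hfd, real_inner_comm]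
    ring
  simp_rw [hint]
  have hex : ∃ t ∈ Icc (0 : ℝ) (2 * Real.pi), 0 < (1 / 2 : ℝ) * (deriv f t) ^ 2 := by
    by_contra! hcon
    have hz : ∀ t, deriv f t = 0 := by
      intro t
      obtain ⟨s, hs, hst⟩ := hdper'.exists_mem_Ico₀ (by positivity) t
      have := hcon s ⟨hs.1, hs.2.le⟩
      rw [hst]
      nlinarith [sq_nonneg (deriv f s)]
    exact h (is_const_of_deriv_eq_zero (hfs.differentiable (by simp)) hz t₀ t₁)
  have hpos := intervalIntegral.integral_pos (f := fun t => (1 / 2 : ℝ) * (deriv f t) ^ 2)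
    (by positivity : (0 : ℝ) < 2 * Real.pi)
    (continuous_const.mul (hfds.continuous.pow 2)).continuousOn
    (fun t _ => by positivity) hex
  positivity

/-- If ξ and ξ ± sθ all had constant norm, the parallelogram law at t₁, compared with the values at
t₀ where θ vanishes, would force sθ(t₁) = 0. -/
theorem exists_mem_nonconstant_norm_sq (hk : IsSimple k) (ξ : TwistedLoop T)
    {U : Set (TwistedLoop T)} (hU : U ∈ 𝓝 ξ) :
    ∃ ξ' ∈ U, ∃ t₀ t₁ : ℝ, ‖ξ' t₀‖ ^ 2 ≠ ‖ξ' t₁‖ ^ 2 := by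
  obtain ⟨θ, t₀, t₁, h0, h1⟩ := exists_nonconstant_norm_sq (T := T) hk
  by_contra! hcon
  have hc : Tendsto (fun s : ℝ => ξ + s • θ) (𝓝 0) (𝓝 ξ) := by
    have h : Continuous fun s : ℝ => ξ + s • θ := by fun_prop
    simpa using h.tendsto 0
  have hc' : Tendsto (fun s : ℝ => ξ + (-s) • θ) (𝓝 0) (𝓝 ξ) := by
    have h : Continuous fun s : ℝ => ξ + (-s) • θ := by fun_prop
    simpa using h.tendsto 0
  obtain ⟨s, ⟨hs1, hs2⟩, hs0⟩ := (((hc.eventually hU).and (hc'.eventually hU)).filter_mono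
    (nhdsWithin_le_nhds (s := Ioi 0)) |>.and self_mem_nhdsWithin).exists
  have hs0 : 0 < s := hs0
  have e1 := hcon _ hs1 t₀ t₁
  have e2 := hcon _ hs2 t₀ t₁
  have e3 := hcon ξ (mem_of_mem_nhds hU) t₀ t₁
  simp only [add_apply, smul_apply, h0, smul_zero, add_zero, neg_smul,
    ← sub_eq_add_neg, sub_apply, sub_zero] at e1 e2
  have par := parallelogram_law_with_norm ℝ (ξ t₁) (s • θ t₁)
  have hpos : 0 < ‖s • θ t₁‖ := norm_pos_iff.2 (smul_ne_zero hs0.ne' h1)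
  nlinarith

end TwistedLoop

/-! ### Momentum functionals and their covariance -/

section Momentum

variable {E : Type u} [AddCommGroup E] [Module ℝ E] [TopologicalSpace E]
    [IsTopologicalAddGroup E] [ContinuousSMul ℝ E] [LocallyConvexSpace ℝ E] [T2Space E]
    {G : Type v} [Group G] [TopologicalSpace G] [ChartedSpace E G] [LCLieGroup E G]
    {H : Type w} [NormedAddCommGroup H] [InnerProductSpace ℂ H] [CompleteSpace H]
    {π : G →* unitary (H →L[ℂ] H)} {ex : E → G} (hex : LCLieGroup.IsExp ex)

/-- The momentum `x ↦ ⟨v, i dπ(x) v⟩` of a smooth vector `v` as a linear functional. -/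
noncomputable def momentumLin {v : H} (hv : v ∈ smoothVectors E π) : E →ₗ[ℝ] ℝ where
  toFun := momentum ex π v
  map_add' x y := by
    simp only [momentum, dRep_add_left hex hv, smul_add, inner_add_right, Complex.add_re]
  map_smul' c x := by
    simp only [momentum, dRep_smul_left hex hv, RingHom.id_apply, smul_eq_mul]
    rw [smul_comm, inner_smul_right_eq_smul, Complex.smul_re, smul_eq_mul]

theorem momentumLin_apply {v : H} (hv : v ∈ smoothVectors E π) (x : E) :
    momentumLin hex hv x = momentum ex π v x := rfl

include hex

theorem inner_dRep_self {v : H} (hv : v ∈ smoothVectors E π) (x : E) :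
    inner ℂ v (dRep ex π x v) = -(Complex.I * momentum ex π v x) := by
  have h := inner_dRep_left hex hv hv x
  have hre : (inner ℂ v (dRep ex π x v)).re = 0 := by
    have h1 := congrArg Complex.re h
    rw [← inner_conj_symm, Complex.conj_re, Complex.neg_re] at h1
    linarith
  apply Complex.ext <;> simp [momentum, hre]

/-- The momentum is constant along a curve tangent to the adjoint orbit. -/
theorem momentum_flow_eq {v : H} (hv : v ∈ smoothVectors E π) (x : E) {y y' : ℝ → E}
    (hy : ∀ t, HasVelocity (fun s => y (t + s)) (y' t))
    (hxy : ∀ w ∈ smoothVectors E π, ∀ t, momentum ex π w (y' t)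
      = momentum ex π w (LCLieGroup.lieBracket E G x (y t))) (t : ℝ) :
    momentum ex π ((π (ex (t • x)) : H →L[ℂ] H) v) (y t) = momentum ex π v (y 0) := by
  have h := inner_dRep_flow_eq hex hv x hy (fun w hw t => by
    rw [inner_dRep_self hex hw, inner_dRep_self hex hw, hxy w hw t]) t
  rw [inner_dRep_self hex (rep_mem_smoothVectors hv _), inner_dRep_self hex hv, neg_inj] at h
  exact_mod_cast mul_left_cancel₀ Complex.I_ne_zero h

theorem map_smul_mul_map_neg_smul (x : E) (t : ℝ) : ex (t • x) * ex (-t • x) = 1 := by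
  rw [← hex.map_add_smul, add_neg_cancel, zero_smul, hex.map_zero]

/-- An element with vanishing momenta acts trivially. -/
theorem rep_eq_one_of_momentum_eq_zero (hπ : IsSmoothRep E π) {x : E}
    (h : ∀ v ∈ smoothVectors E π, momentum ex π v x = 0) (s : ℝ) : π (ex (s • x)) = 1 := by
  have hd : Dense (smoothVectors E π : Set H) := hπ
  let D : smoothVectors E π →ₗ[ℂ] H := (derivedRep hex π x).toFun
  have hDapp : ∀ v : smoothVectors E π, D v = dRep ex π x v := fun v => rfl
  have hq : ∀ v : smoothVectors E π, inner ℂ (v : H) (D v) = 0 := fun v => by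
    rw [hDapp, inner_dRep_self hex v.2, h v v.2]
    simp
  have hD0 : ∀ w : smoothVectors E π, D w = 0 := by
    intro w
    have horth : ∀ v ∈ (smoothVectors E π : Set H), inner ℂ v (D w) = 0 := by
      intro v hv
      lift v to smoothVectors E π using hv
      -- Polarisation with v + w and v + iw: over ℂ a vanishing quadratic form has a vanishing
      -- sesquilinear form.
      have h1 := hq (v + w)
      have h2 := hq (v + Complex.I • w)
      rw [map_add] at h1 h2
      rw [map_smul] at h2
      simp only [Submodule.coe_add, Submodule.coe_smul, inner_add_left, inner_add_right,
        inner_smul_left, inner_smul_right, hq, Complex.conj_I] at h1 h2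
      have h3 : Complex.I * (inner ℂ (v : H) (D w) - inner ℂ (w : H) (D v)) = 0 := by
        linear_combination h2
      have h4 := (mul_eq_zero.1 h3).resolve_left Complex.I_ne_zero
      linear_combination (h1 + h4) / 2
    have hall : ∀ u : H, inner ℂ u (D w) = 0 := fun u =>
      hd.induction (P := fun u => inner ℂ u (D w) = 0) horth
        (isClosed_eq (by fun_prop) (by fun_prop)) u
    exact inner_self_eq_zero.1 (hall _)
  have hfix : ∀ v ∈ (smoothVectors E π : Set H), (π (ex (s • x)) : H →L[ℂ] H) v = v := by
    intro v hv
    have hder : ∀ t, HasDerivAt (fun t : ℝ => (π (ex (t • x)) : H →L[ℂ] H) v) 0 t := fun t => by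
      have h1 := hasDerivAt_dRep_flow hex hv x t
      have h2 := hD0 ⟨_, rep_mem_smoothVectors hv (ex (t • x))⟩
      rw [hDapp] at h2
      rwa [h2] at h1
    have := is_const_of_deriv_eq_zero (fun t => (hder t).differentiableAt)
      (fun t => (hder t).deriv) s 0
    simpa [hex.map_zero] using this
  ext u
  exact hd.induction (P := fun u => (π (ex (s • x)) : H →L[ℂ] H) u = u) hfix
    (isClosed_eq (by fun_prop) (by fun_prop)) u

end Momentum

/-! ### The central extension and its centre -/

section CentralExtension

open TwistedLoop HilbertLieAlgebra

variable {k : Type u} [HilbertLieAlgebra k] {T : FiniteOrderAut k}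

namespace CentralLoop

theorem mk_add_smul_c (a b : ℝ) (ξ : TwistedLoop T) : mk a ξ + b • c T = mk (a + b) ξ :=
  ext (by change a + b * 1 = a + b; rw [mul_one]) (by
    change ξ + b • (0 : TwistedLoop T) = ξ
    rw [smul_zero, add_zero])

theorem mk_lie_mk (a b : ℝ) (ξ η : TwistedLoop T) :
    ⁅mk a ξ, mk b η⁆ = mk (cocycle ξ η) ⁅ξ, η⁆ := rfl

theorem mk_zero_right (a : ℝ) : mk a (0 : TwistedLoop T) = a • c T :=
  ext (by change a = a * 1; rw [mul_one]) (by
    change 0 = a • (0 : TwistedLoop T)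
    rw [smul_zero])

theorem mk_add (a b : ℝ) (ξ η : TwistedLoop T) : mk a ξ + mk b η = mk (a + b) (ξ + η) := rfl

theorem continuous_mk (a : ℝ) : Continuous (mk a : TwistedLoop T → CentralLoop T) :=
  (Continuous.prodMk_right a : Continuous (fun ξ : TwistedLoop T => (a, ξ)))

theorem continuous_loop : Continuous (loop : CentralLoop T → TwistedLoop T) :=
  (continuous_snd : Continuous (Prod.snd : ℝ × TwistedLoop T → TwistedLoop T))

/-- The inclusion of the loops as a continuous linear map. -/
noncomputable def incl (T : FiniteOrderAut k) : TwistedLoop T →L[ℝ] CentralLoop T where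
  toFun := mk 0
  map_add' ξ η := by rw [mk_add, add_zero]
  map_smul' s ξ := ext (by change 0 = s * 0; rw [mul_zero]) rfl
  cont := continuous_mk 0

/-- The centre of the central extension is spanned by `c`. -/
theorem eq_smul_c_of_mem_center (hk : IsSimple k) {z : CentralLoop T}
    (hz : z ∈ LieAlgebra.center ℝ (CentralLoop T)) : z = z.coord • c T := by
  have hz' := (LieModule.mem_maxTrivSubmodule (R := ℝ) (L := CentralLoop T)
    (M := CentralLoop T) z).1 hz
  have hloop : z.loop = 0 := by
    ext t
    refine hk.eq_zero_of_forall_lie_eq_zero fun y => ?_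
    obtain ⟨η, hη⟩ := exists_apply_eq (T := T) t y
    have h := congrArg (fun p : CentralLoop T => p.loop t) (hz' (mk 0 η))
    change ⁅η t, z.loop t⁆ = 0 at h
    rwa [hη] at h
  rw [← mk_zero_right, ← hloop]
  rfl

end CentralLoop

end CentralExtension

/-! ### Momenta of semibounded representations -/

section CentralExtension

open TwistedLoop HilbertLieAlgebra CentralLoop

variable {k : Type u} [HilbertLieAlgebra k] {T : FiniteOrderAut k}
    {E : Type*} [AddCommGroup E] [Module ℝ E] [TopologicalSpace E]
    [IsTopologicalAddGroup E] [ContinuousSMul ℝ E] [LocallyConvexSpace ℝ E] [T2Space E]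
    {G : Type v} [Group G] [TopologicalSpace G] [ChartedSpace E G] [LCLieGroup E G]
    {Λ : CentralLoop T ≃L[ℝ] E}
    (hΛ : ∀ x y : CentralLoop T, Λ ⁅x, y⁆ = LCLieGroup.lieBracket E G (Λ x) (Λ y))
    {ex : E → G} (hex : LCLieGroup.IsExp ex)
    {H : Type w} [NormedAddCommGroup H] [InnerProductSpace ℂ H] [CompleteSpace H]
    {π : G →* unitary (H →L[ℂ] H)}

include hΛ hex in
/-- In a semibounded representation the central element has vanishing momenta. -/
theorem momentum_c_eq_zero (hk : IsSimple k) (hπ : IsSemibounded hex π) {v : H}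
    (hv : v ∈ smoothVectors E π) : momentum ex π v (Λ (c T)) = 0 := by
  obtain ⟨hsm, x₀, M, hM⟩ := hπ
  set a := (Λ.symm x₀).coord
  set ξ := (Λ.symm x₀).loop
  have hx₀ : Λ (mk a ξ) = x₀ := Λ.apply_symm_apply x₀
  have hU : {ζ : TwistedLoop T | supSpec hex π (Λ (mk a ζ)) ≤ (M : EReal)} ∈ 𝓝 ξ := by
    have hc : Tendsto (fun ζ : TwistedLoop T => Λ (mk a ζ)) (𝓝 ξ) (𝓝 x₀) := by
      have h := (Λ.continuous.comp (continuous_mk (T := T) a)).tendsto ξ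
      rw [Function.comp_apply, hx₀] at h
      exact h
    exact hc.eventually hM
  obtain ⟨ζ, hζ, t₀, t₁, hne⟩ := exists_mem_nonconstant_norm_sq hk ξ hU
  obtain ⟨η, hη, hω⟩ := exists_lie_eq_zero_cocycle_ne_zero ζ hne
  set κ := cocycle η ζ
  -- As η commutes with ζ, bracketing with η moves (a, ζ) only centrally, with constant speed κ; the
  -- orbit curve is a line.
  have hbr : ∀ t : ℝ, LCLieGroup.lieBracket E G (Λ (mk 0 η)) (Λ (mk a ζ) + t • κ • Λ (c T))
      = κ • Λ (c T) := by
    intro t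
    rw [← map_smul, ← map_smul, ← map_add, ← hΛ, smul_smul, mk_add_smul_c, mk_lie_mk, hη,
      mk_zero_right]
  have hbound : ∀ t : ℝ, momentum ex π v (Λ (mk a ζ)) + t * (κ * momentum ex π v (Λ (c T)))
      ≤ M * ‖v‖ ^ 2 := by
    intro t
    -- The flow of η carries w to v at time t. So the momentum of v at the point of the line at time
    -- t is that of w at (a, ζ), where the spectral bound applies.
    set w := (π (ex (-t • Λ (mk 0 η))) : H →L[ℂ] H) v with hw
    have hws : w ∈ smoothVectors E π := rep_mem_smoothVectors hv _
    have h := momentum_flow_eq hex hws (Λ (mk 0 η))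
      (y := fun t => Λ (mk a ζ) + t • κ • Λ (c T)) (y' := fun _ => κ • Λ (c T))
      (fun s => hasVelocity_line _ _ s) (fun u _ s => by rw [hbr]) t
    have hwv : (π (ex (t • Λ (mk 0 η))) : H →L[ℂ] H) w = v := by
      rw [hw, ← rep_mul_apply, map_smul_mul_map_neg_smul hex]
      simp
    rw [hwv, zero_smul, add_zero] at h
    have h2 := (supSpec_le_iff hex hsm _ _).1 hζ w hws
    rw [← h, hw, unitary_norm_map] at h2
    have e := map_add (momentumLin hex hv) (Λ (mk a ζ)) (t • κ • Λ (c T))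
    rw [map_smul, map_smul] at e
    simp only [momentumLin_apply, smul_eq_mul] at e
    rwa [e] at h2
  by_contra h0
  have hne0 : κ * momentum ex π v (Λ (c T)) ≠ 0 := mul_ne_zero hω h0
  -- At this time the left side is M‖v‖² + 1.
  have := hbound ((M * ‖v‖ ^ 2 - momentum ex π v (Λ (mk a ζ)) + 1) /
    (κ * momentum ex π v (Λ (c T))))
  rw [div_mul_cancel₀ _ hne0] at this
  linarith

/-- The momentum functional on the loop algebra. -/
noncomputable def loopMomentum (Λ : CentralLoop T ≃L[ℝ] E) {v : H} (hv : v ∈ smoothVectors E π) :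
    TwistedLoop T →ₗ[ℝ] ℝ :=
  momentumLin hex hv ∘ₗ Λ.toLinearEquiv.toLinearMap ∘ₗ (incl T).toLinearMap

theorem loopMomentum_apply {v : H} (hv : v ∈ smoothVectors E π) (ξ : TwistedLoop T) :
    loopMomentum hex Λ hv ξ = momentum ex π v (Λ (mk 0 ξ)) := rfl

-- In the extension the bracket of η with e^{ad tη} ξ has an additional central term, whose momenta
-- vanish by `momentum_c_eq_zero`. For momenta the curve e^{ad tη} ξ is therefore an adjoint orbit.
include hΛ in
theorem loopMomentum_Ad (hk : IsSimple k) (hπ : IsSemibounded hex π) {v : H}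
    (hv : v ∈ smoothVectors E π) (η ξ : TwistedLoop T) :
    loopMomentum hex Λ hv (Ad η ξ) =
      loopMomentum hex Λ (rep_mem_smoothVectors hv (ex (-(1 : ℝ) • Λ (mk 0 η)))) ξ := by
  set w := (π (ex (-(1 : ℝ) • Λ (mk 0 η))) : H →L[ℂ] H) v with hw
  have hws : w ∈ smoothVectors E π := rep_mem_smoothVectors hv _
  have hwv : (π (ex ((1 : ℝ) • Λ (mk 0 η))) : H →L[ℂ] H) w = v := by
    rw [hw, ← rep_mul_apply, map_smul_mul_map_neg_smul hex]
    simp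
  have h := momentum_flow_eq hex hws (Λ (mk 0 η))
    (y := fun t => Λ (mk 0 (Ad (t • η) ξ))) (y' := fun t => Λ (mk 0 ⁅η, Ad (t • η) ξ⁆))
    (fun s => (hasVelocity_Ad η ξ s).clm ((Λ : CentralLoop T →L[ℝ] E).comp (incl T)))
    (fun u hu s => by
      rw [← hΛ, mk_lie_mk, ← zero_add (cocycle η (Ad (s • η) ξ)), ← mk_add_smul_c, map_add,
        map_smul, ← momentumLin_apply hex hu, ← momentumLin_apply hex hu, map_add, map_smul,
        momentumLin_apply hex hu (Λ (c T)), momentum_c_eq_zero hΛ hex hk hπ hu, smul_zero,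
        add_zero]) 1
  rw [hwv, zero_smul, one_smul, Ad_zero] at h
  exact h

-- Each e^{ad η} is implemented by a group element, hence every product by a unitary operator.
-- Bounds in terms of ‖v‖² thus hold along the whole orbit with the same constant.
include hΛ in
theorem exists_loopMomentum_eq_comp (hk : IsSimple k) (hπ : IsSemibounded hex π)
    {S : Module.End ℝ (TwistedLoop T)} (hS : S ∈ adMonoid T) :
    ∀ {v : H} (hv : v ∈ smoothVectors E π), ∃ (w : H) (hw : w ∈ smoothVectors E π), ‖w‖ = ‖v‖ ∧
      ∀ ξ, loopMomentum hex Λ hv (S ξ) = loopMomentum hex Λ hw ξ := by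
  induction hS using Submonoid.closure_induction with
  | mem S hS =>
    obtain ⟨η, rfl⟩ := hS
    exact fun hv => ⟨_, _, unitary_norm_map _ _, fun ξ => loopMomentum_Ad hΛ hex hk hπ hv η ξ⟩
  | one => exact fun hv => ⟨_, hv, rfl, fun ξ => rfl⟩
  | mul S S' _ _ ih ih' =>
    intro v hv
    obtain ⟨w, hw, hn, h⟩ := ih hv
    obtain ⟨w', hw', hn', h'⟩ := ih' hw
    exact ⟨w', hw', hn'.trans hn, fun ξ => by rw [Module.End.mul_apply, h, h']⟩

include hΛ in
/-- The momenta of a semibounded representation are uniformly bounded on a neighbourhood of zero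
of the loop algebra. -/
theorem exists_loopMomentum_bound (hk : IsSimple k) (hπ : IsSemibounded hex π) :
    ∃ U ∈ 𝓝 (0 : TwistedLoop T), ∃ M : ℝ, ∀ {v : H} (hv : v ∈ smoothVectors E π), ∀ u ∈ U,
      |loopMomentum hex Λ hv u| ≤ M * ‖v‖ ^ 2 := by
  obtain ⟨x₀, M, hM⟩ := hπ.2
  set a := (Λ.symm x₀).coord
  set ζ := (Λ.symm x₀).loop
  have hx₀ : Λ (mk a ζ) = x₀ := Λ.apply_symm_apply x₀
  have hmom : ∀ {v : H} (hv : v ∈ smoothVectors E π) (ξ : TwistedLoop T),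
      momentum ex π v (Λ (mk a ξ)) = loopMomentum hex Λ hv ξ := by
    intro v hv ξ
    rw [← zero_add a, ← mk_add_smul_c, map_add, map_smul, ← momentumLin_apply hex hv, map_add,
      map_smul, momentumLin_apply hex hv (Λ (c T)), momentum_c_eq_zero hΛ hex hk hπ hv, smul_zero,
      add_zero]
    rfl
  have hc : ∀ s : ℝ, Tendsto (fun u : TwistedLoop T => Λ (mk a (ζ + s • u))) (𝓝 0) (𝓝 x₀) := by
    intro s
    have h : Continuous fun u : TwistedLoop T => Λ (mk a (ζ + s • u)) :=
      Λ.continuous.comp ((continuous_mk a).comp (by fun_prop))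
    have h0 := h.tendsto 0
    rwa [smul_zero, add_zero, hx₀] at h0
  set U : Set (TwistedLoop T) := {u | supSpec hex π (Λ (mk a (ζ + (1 : ℝ) • u))) ≤ (M : EReal) ∧
    supSpec hex π (Λ (mk a (ζ + (-1 : ℝ) • u))) ≤ (M : EReal)} with hUdef
  have hU : U ∈ 𝓝 (0 : TwistedLoop T) := ((hc 1).eventually hM).and ((hc (-1)).eventually hM)
  -- The upper bounds at ζ + u and ζ − u control both signs of the momentum at u.
  have hUb : ∀ {v : H} (hv : v ∈ smoothVectors E π), ∀ u ∈ U,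
      |loopMomentum hex Λ hv u| ≤ M * ‖v‖ ^ 2 + loopMomentum hex Λ hv (-ζ) := by
    intro v hv u hu
    have h1 := (supSpec_le_iff hex hπ.1 _ _).1 hu.1 v hv
    have h2 := (supSpec_le_iff hex hπ.1 _ _).1 hu.2 v hv
    rw [hmom hv, map_add, map_smul, smul_eq_mul] at h1 h2
    rw [map_neg, abs_le]
    constructor <;> linarith
  refine ⟨U, hU, ?_⟩
  by_cases hB : ∃ B : ℝ, ∀ {v : H} (hv : v ∈ smoothVectors E π),
      loopMomentum hex Λ hv (-ζ) ≤ B * ‖v‖ ^ 2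
  · obtain ⟨B, hB⟩ := hB
    exact ⟨M + B, fun hv u hu => (hUb hv u hu).trans (by rw [add_mul]; gcongr; exact hB hv)⟩
  exfalso
  push Not at hB
  -- Here Φ(−ζ) exceeds (n + 1)‖v‖². After division by Φ(−ζ) the term with M tends to 0, and in the
  -- limit only the domination by the value at −ζ survives.
  choose v hv hlt using fun n : ℕ => hB ((n : ℝ) + 1)
  set A : ℕ → ℝ := fun n => loopMomentum hex Λ (hv n) (-ζ) with hA
  have hA0 : ∀ n, 0 < A n := fun n => lt_of_le_of_lt (by positivity) (hlt n)
  have hMA : ∀ n, |M| * ‖v n‖ ^ 2 / A n ≤ |M| * (1 / ((n : ℝ) + 1)) := by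
    intro n
    rw [div_le_iff₀ (hA0 n), mul_assoc]
    refine mul_le_mul_of_nonneg_left ?_ (abs_nonneg _)
    rw [one_div, ← div_eq_inv_mul, le_div_iff₀ (by positivity), mul_comm]
    exact (hlt n).le
  set F : ℕ → TwistedLoop T →ₗ[ℝ] ℝ := fun n => (A n)⁻¹ • loopMomentum hex Λ (hv n) with hF
  have hFx : ∀ n, F n (-ζ) = 1 := fun n => inv_mul_cancel₀ (hA0 n).ne'
  have hFS : ∀ n, ∀ S ∈ adMonoid T, ∀ u ∈ U,
      |F n (S u)| ≤ |M| * (1 / ((n : ℝ) + 1)) + F n (S (-ζ)) := by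
    intro n S hS u hu
    obtain ⟨w, hw, hnorm, hSw⟩ := exists_loopMomentum_eq_comp hΛ hex hk hπ hS (hv n)
    have h := hUb hw u hu
    rw [← hSw, ← hSw, hnorm] at h
    simp only [hF, LinearMap.smul_apply, smul_eq_mul, abs_mul, abs_inv, abs_of_pos (hA0 n)]
    calc _ ≤ (A n)⁻¹ * (|M| * ‖v n‖ ^ 2 + loopMomentum hex Λ (hv n) (S (-ζ))) := by
          have := (hA0 n).le
          gcongr
          exact h.trans (by gcongr; exact le_abs_self M)
      _ = |M| * ‖v n‖ ^ 2 / A n + (A n)⁻¹ * loopMomentum hex Λ (hv n) (S (-ζ)) := by ring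
      _ ≤ _ := by gcongr; exact hMA n
  -- `U` is absorbing, so the normalised functionals are pointwise bounded and an ultrafilter limit
  -- exists.
  have habs : ∀ u : TwistedLoop T, ∃ s : ℝ, 0 < s ∧ s • u ∈ U := by
    intro u
    have hcu : Tendsto (fun s : ℝ => s • u) (𝓝[>] 0) (𝓝 0) := by
      have h : Continuous fun s : ℝ => s • u := by fun_prop
      have h0 := (h.tendsto 0).mono_left (nhdsWithin_le_nhds (s := Ioi 0))
      simpa using h0
    obtain ⟨s, h1, h2⟩ := ((hcu.eventually hU).and self_mem_nhdsWithin).exists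
    exact ⟨s, h2, h1⟩
  choose s hs hsU using habs
  obtain ⟨g, hg⟩ := exists_linearMap_tendsto (Ultrafilter.of (atTop : Filter ℕ)) (f := F)
    (b := fun u => (s u)⁻¹ * (|M| + 1)) fun n u => by
      have h := hFS n 1 (one_mem _) _ (hsU u)
      simp only [Module.End.one_apply, hFx, map_smul, smul_eq_mul, abs_mul,
        abs_of_pos (hs u)] at h
      rw [← div_eq_inv_mul, le_div_iff₀ (hs u), mul_comm]
      refine h.trans ?_
      gcongr
      refine mul_le_of_le_one_right (abs_nonneg _) ?_
      rw [div_le_one (by positivity)]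
      linarith [(Nat.cast_nonneg n : (0 : ℝ) ≤ n)]
  have hgx : g (-ζ) = 1 :=
    tendsto_nhds_unique (hg (-ζ)) (by simp only [hFx]; exact tendsto_const_nhds)
  have h0 : g (-ζ) = 0 := apply_eq_zero_of_dominates hk hU fun S hS u hu => by
    have hlim : Tendsto (fun n : ℕ => |M| * (1 / ((n : ℝ) + 1)) + F n (S (-ζ)))
        (Ultrafilter.of (atTop : Filter ℕ)) (𝓝 (|M| * 0 + g (S (-ζ)))) :=
      (((tendsto_one_div_add_atTop_nhds_zero_nat (𝕜 := ℝ)).mono_left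
        (Ultrafilter.of_le atTop)).const_mul _).add (hg _)
    rw [mul_zero, zero_add] at hlim
    exact le_of_tendsto_of_tendsto (hg (S u)).abs hlim
      (Filter.Eventually.of_forall fun n => hFS n S hS u hu)
  rw [hgx] at h0
  exact one_ne_zero h0

end CentralExtension

/-! ### The main theorem -/

theorem mainTheorem10 {k : Type*} [HilbertLieAlgebra k] (hk : HilbertLieAlgebra.IsSimple k)
    (T : FiniteOrderAut k)
    {E : Type*} [AddCommGroup E] [Module ℝ E] [TopologicalSpace E] [IsTopologicalAddGroup E]
    [ContinuousSMul ℝ E] [LocallyConvexSpace ℝ E] [T2Space E]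
    {G : Type*} [Group G] [TopologicalSpace G] [ChartedSpace E G] [LCLieGroup E G]
    (Λ : CentralLoop T ≃L[ℝ] E)
    (hΛ : ∀ x y : CentralLoop T, Λ ⁅x, y⁆ = LCLieGroup.lieBracket E G (Λ x) (Λ y))
    (ex : E → G) (hex : LCLieGroup.IsExp ex)
    {H : Type*} [NormedAddCommGroup H] [InnerProductSpace ℂ H] [CompleteSpace H]
    (π : G →* unitary (H →L[ℂ] H)) (hπ : IsSemibounded hex π) :
    (∀ s : ℝ, π (ex (Λ (s • CentralLoop.c T))) = 1) ∧
      (∀ z ∈ LieAlgebra.center ℝ (CentralLoop T), π (ex (Λ z)) = 1) ∧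
      IsBoundedRep hex π := by
  have hc : ∀ s : ℝ, π (ex (Λ (s • CentralLoop.c T))) = 1 := fun s => by
    rw [map_smul]
    exact rep_eq_one_of_momentum_eq_zero hex hπ.1
      (fun v hv => momentum_c_eq_zero hΛ hex hk hπ hv) s
  refine ⟨hc, fun z hz => ?_, hπ.1, ?_⟩
  · rw [CentralLoop.eq_smul_c_of_mem_center hk hz]
    exact hc _
  obtain ⟨U, hU, M, hM⟩ := exists_loopMomentum_bound (Λ := Λ) hΛ hex hk hπ
  refine eq_univ_of_forall fun x₀ => ?_
  set ζ := (Λ.symm x₀).loop with hζ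
  obtain ⟨s, hsU, hs⟩ : ∃ s : ℝ, s • ζ ∈ U ∧ 0 < s := by
    have hcu : Tendsto (fun s : ℝ => s • ζ) (𝓝[>] 0) (𝓝 0) := by
      have h : Continuous fun s : ℝ => s • ζ := by fun_prop
      have h0 := (h.tendsto 0).mono_left (nhdsWithin_le_nhds (s := Ioi 0))
      simpa using h0
    exact ((hcu.eventually hU).and self_mem_nhdsWithin).exists
  have hnhds : ∀ᶠ x in 𝓝 x₀, (Λ.symm x).loop - ζ ∈ U := by
    have h : Continuous fun x : E => (Λ.symm x).loop - ζ :=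
      (CentralLoop.continuous_loop.comp Λ.symm.continuous).sub continuous_const
    have h0 := h.tendsto x₀
    rw [← hζ, sub_self] at h0
    exact h0.eventually hU
  -- The loop part of x is ζ plus an element of `U`. The value at ζ costs s⁻¹M because sζ lies in
  -- `U`, the remainder costs M, and the central part contributes nothing.
  refine ⟨s⁻¹ * M + M, ?_⟩
  filter_upwards [hnhds] with x hx
  rw [supSpec_le_iff hex hπ.1]
  intro v hv
  have hxe : x = Λ (CentralLoop.mk 0 (Λ.symm x).loop) + (Λ.symm x).coord • Λ (CentralLoop.c T) := by
    rw [← map_smul, ← map_add, CentralLoop.mk_add_smul_c, zero_add]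
    exact (Λ.apply_symm_apply x).symm
  have hmom : momentum ex π v x = loopMomentum hex Λ hv ζ +
      loopMomentum hex Λ hv ((Λ.symm x).loop - ζ) := by
    rw [← map_add, add_sub_cancel, loopMomentum_apply]
    conv_lhs => rw [hxe]
    rw [← momentumLin_apply hex hv, map_add, map_smul, momentumLin_apply hex hv (Λ (CentralLoop.c T)),
      momentum_c_eq_zero hΛ hex hk hπ hv, smul_zero, add_zero]
    rfl
  have h1 := (le_abs_self _).trans (hM hv _ hsU)
  have h2 := (le_abs_self _).trans (hM hv _ hx)
  rw [map_smul, smul_eq_mul] at h1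
  have h3 : loopMomentum hex Λ hv ζ ≤ s⁻¹ * (M * ‖v‖ ^ 2) := by
    rw [← div_eq_inv_mul, le_div_iff₀ hs, mul_comm]
    exact h1
  rw [hmom]
  linarith [add_mul (s⁻¹ * M) M (‖v‖ ^ 2), mul_assoc s⁻¹ M (‖v‖ ^ 2)]
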